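/- Let $\pi:E\to M$ be a smooth fiber bundle, $\dim M=n\ge 1$, $\dim E=n+m$, and $k\ge 0$. Let $\pi_r:J^r\to M$ ($0\le r\le\infty$) be the bundle of $r$-jets of local sections of $\pi$, with jet coordinates $(x^i,u^\alpha_I)$, where $I$ runs over unordered multi-indices with $|I|\le r$, and let $\pi_{k+1,k}:J^{k+1}\to J^k$ be the projection. Let $\mathscr L$ be a Lagrangian density of order $\le k+1$, i.e. a smooth horizontal $n$-form on $J^{k+1}$, locally $\mathscr L=L\,d^nx$, $d^nx=dx^1\wedge\dots\wedge dx^n$, $L=L(x^i,u^\alpha_I)$, $|I|\le k+1$. Let $J^\dagger\pi_k\to J^k$ be the reduced multimomentum bundle, the vector bundle whose fiber over $\theta\in J^k$, $x=\pi_k(\theta)$, is $V^*_\theta J^k\otimes\Lambda^{n-1}T^*_xM$ ($V_\theta J^k$ being the vertical tangent space of $\pi_k$), with momentum coordinates $p^{I.i}_\alpha$, $|I|\le k$: a point of it is written $\sum p_\alpha^{I.i}\,du^\alpha_I\otimes d^{n-1}x_i$, $d^{n-1}x_i=i_{\partial/\partial x^i}d^nx$. On the pull-back bundle $W=\pi_{k+1,k}^\circ(J^\dagger\pi_k)=J^{k+1}\times_{J^k}J^\dagger\pi_k$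 let $\omega$ be the $(n+1)$-form which in all such coordinates is $$\omega=\sum_{|I|\le k}dp^{I.i}_\alpha\wedge du^\alpha_I\wedge d^{n-1}x_i-dE_{\mathscr L}\wedge d^nx,\qquad E_{\mathscr L}=\sum_{|I|\le k}u^\alpha_{Ii}\,p^{I.i}_\alpha-L .$$ Let $\mathscr P\subset W$ be the first constraint subbundle, defined locally by $\partial L/\partial u^\alpha_K=\sum_{(J,i):\,Ji=K}p^{J.i}_\alpha$ for all $|K|=k+1$ and all $\alpha$, and let $\mathscr P_0\subset J^\dagger\pi_k$ be its image under the projection $W\to J^\dagger\pi_k$. Assume that $\mathscr P_0$ is a submanifold of $J^\dagger\pi_k$ and that $\mathscr P\to\mathscr P_0$ is a smooth submersion with connected fibers; then the restriction of $\omega$ to $\mathscr P$ is the pull-back of a unique $(n+1)$-form $\omega_0$ on $\mathscr P_0$. For a bundle $P\to M$, an $(n+1)$-form $\eta$ on $P$ and a connection $\nabla$ in $P\to M$ (or the first jet $j_1\sigma$ of a local section $\sigma$), $i^{1,n}(\nabla)\eta$ is obtained by evaluating $\eta$ on one vertical vector and on the $\nabla$-lifts of $n$ tangent vectors of $M$ (along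 $\sigma$, on their images under $d\sigma$). A local section $\sigma$ of $W\to M$ solves the Euler–Lagrange–Hamilton (ELH) equations if $i^{1,n}(j_1\sigma)\omega|_\sigma=0$; a local section $\sigma_0$ of $\mathscr P_0\to M$ solves the Hamilton–de Donder–Weyl (HDW) equations if $i^{1,n}(j_1\sigma_0)\omega_0|_{\sigma_0}=0$. Let $\nabla$ be a flat holonomic connection in $\pi_k$, i.e. a smooth section of $\pi_{k+1,k}$ with vanishing curvature when regarded as a section of $J^1\pi_k\to J^k$ through the inclusion $J^{k+1}\subset J^1\pi_k$, $(u^\alpha_I)_i=u^\alpha_{Ii}$; let $T$ be a smooth section of $J^\dagger\pi_k\to J^k$, and let $(\nabla,T):J^k\to W$ be the corresponding section. A local section $j$ of $\pi_k$ is $\nabla$-constant if $\nabla\circ j=j_1j$. The pair $(\nabla,T)$ is a solution of the generalized Hamilton–Jacobi problem if $(\nabla,T)\circ j$ solves the ELH equations for every $\nabla$-constant local section $j$. **Theorem.** The following conditions are equivalent: 1. $(\nabla,T)$ is a solution of the generalized Hamilton–Jacobi problem; 2. $\operatorname{im}(\nabla,T)\subset\mathscr P$ and, for every $\nabla$-constant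 local section $j$, $T\circ j$ solves the HDW equations; 3. $\operatorname{im}(\nabla,T)\subset\mathscr P$ (hence $\operatorname{im}T\subset\mathscr P_0$) and $i^{1,n}(\nabla)\,T^*\omega_0=0$; 4. $\operatorname{im}(\nabla,T)\subset\mathscr P$ and $i^{1,n}(\nabla)\,(\nabla,T)^*\omega=0$. Moreover, each of these conditions implies that $\mathscr Y^\nabla_\infty$ is an elementary Hamilton–Jacobi subdiffiety of the Euler–Lagrange diffiety $\mathscr E_{EL}$, i.e. $\mathscr Y^\nabla_\infty\subset\mathscr E_{EL}$, where $\mathscr Y^\nabla_\infty\subset J^\infty$ is the infinite prolongation of the equation $\operatorname{im}\nabla\subset J^{k+1}$, and $\mathscr E_{EL}\subset J^\infty$ is the infinite prolongation of the Euler–Lagrange equations $\sum_{|I|\le k+1}(-1)^{|I|}D_I\,\partial L/\partial u^\alpha_I=0$ in $J^{2k+2}$ ($D_I$ being iterated total derivatives). Here the infinite prolongation of an equation $S\subset J^r$ is the set of all $j_\infty s(x)$ such that $j_rs(x)\in S$ and $\operatorname{im}j_rs$ is tangent to $S$ at $j_rs(x)$ up to infinite order. -/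

import Mathlib

open scoped Manifold ContDiff

noncomputable section

namespace HJ

/-! ## Multi-indices and partial derivatives -/

/-- The `n`-dimensional coordinate space. -/
abbrev Coord (n : ℕ) : Type := EuclideanSpace ℝ (Fin n)

/-- The `i`-th partial derivative. -/
def pd {n : ℕ} (i : Fin n) (f : Coord n → ℝ) : Coord n → ℝ :=
  fun y => fderiv ℝ f y (EuclideanSpace.single i 1)

/-- `∂^{|I|} / ∂x^I = ∂/∂x^{i₁} ∘ ⋯ ∘ ∂/∂x^{i_l}` for an unordered multi-index `I`. -/
def pdMulti {n : ℕ} (I : Multiset (Fin n)) (f : Coord n → ℝ) : Coord n → ℝ :=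
  I.sort.foldr pd f

/-- Unordered multi-indices of length at most `k` with entries in `{1, …, n}`. -/
abbrev MIdx (n k : ℕ) : Type := {I : Multiset (Fin n) // I.card ≤ k}

instance (n k : ℕ) : Finite (MIdx n k) := by
  let f : MIdx n k → (Σ j : Fin (k + 1), Sym (Fin n) j) :=
    fun I => ⟨⟨I.1.card, Nat.lt_succ_of_le I.2⟩, ⟨I.1, rfl⟩⟩
  let g : (Σ j : Fin (k + 1), Sym (Fin n) j) → Multiset (Fin n) := fun x => x.2.1
  refine Finite.of_injective f ?_
  intro I J h
  exact Subtype.ext (congrArg g h)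

instance (n k : ℕ) : Fintype (MIdx n k) := Fintype.ofFinite _

/-- The multi-index `iI`. -/
def MIdx.cons {n k : ℕ} (i : Fin n) (I : MIdx n k) : MIdx n (k + 1) :=
  ⟨i ::ₘ I.1, by rw [Multiset.card_cons]; exact Nat.succ_le_succ I.2⟩

/-- A multi-index of length `≤ k`, viewed as one of length `≤ k + 1`. -/
def MIdx.incl {n k : ℕ} (I : MIdx n k) : MIdx n (k + 1) :=
  ⟨I.1, I.2.trans (Nat.le_succ k)⟩

/-! ## Bundles, adapted charts, jets -/

section Bundles

variable {n m : ℕ}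
variable {M : Type*} [TopologicalSpace M] [ChartedSpace (Coord n) M]
variable {E : Type*} [TopologicalSpace E] [ChartedSpace (Coord n × Coord m) E]

variable (n m) in
/-- `π : E → M` is a smooth fiber bundle with typical fiber `F`. -/
structure IsSmoothFiberBundle (F : Type*) [TopologicalSpace F] [ChartedSpace (Coord m) F]
    (π : E → M) : Prop where
  contMDiff : ContMDiff 𝓘(ℝ, Coord n × Coord m) 𝓘(ℝ, Coord n) ∞ π
  locally_trivial : ∀ x : M, ∃ e : Bundle.Trivialization F π, x ∈ e.baseSet ∧
    ContMDiffOn 𝓘(ℝ, Coord n × Coord m) (𝓘(ℝ, Coord n).prod 𝓘(ℝ, Coord m)) ∞ e e.source ∧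
    ContMDiffOn (𝓘(ℝ, Coord n).prod 𝓘(ℝ, Coord m)) 𝓘(ℝ, Coord n × Coord m) ∞
      e.toOpenPartialHomeomorph.symm e.target

variable (n m) in
/-- Bundle coordinates `(x^i, u^α)` on an open subset of `E`, over coordinates `x^i` on `M`. -/
structure AdaptedChart (π : E → M) where
  base : OpenPartialHomeomorph M (Coord n)
  total : OpenPartialHomeomorph E (Coord n × Coord m)
  base_mem : base ∈ IsManifold.maximalAtlas 𝓘(ℝ, Coord n) ∞ M
  total_mem : total ∈ IsManifold.maximalAtlas 𝓘(ℝ, Coord n × Coord m) ∞ E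
  proj_mem : ∀ e ∈ total.source, π e ∈ base.source
  fst_total : ∀ e ∈ total.source, (total e).1 = base (π e)

variable (n m) in
/-- A smooth local section of `π`, defined on the open set `dom`. -/
structure LocalSection (π : E → M) where
  toFun : M → E
  dom : Set M
  isOpen_dom : IsOpen dom
  smooth : ContMDiffOn 𝓘(ℝ, Coord n) 𝓘(ℝ, Coord n × Coord m) ∞ toFun dom
  isSection : ∀ x ∈ dom, π (toFun x) = x

/-- Coordinates `(x^i, u_I^α)`, `|I| ≤ k`, of the `k`-th jet bundle. -/
abbrev JetCoord (n m k : ℕ) : Type := Coord n × (MIdx n k → Fin m → ℝ)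

/-- The fiber component `u^α` of a local section, as a function of the base coordinates. -/
def AdaptedChart.localRep {π : E → M} (c : AdaptedChart n m π) (s : M → E) (α : Fin m) :
    Coord n → ℝ :=
  fun y => (c.total (s (c.base.symm y))).2 α

/-- Coordinate expression `x ↦ (x^i, ∂_I s^α (x))` of the jet prolongation `j_k s`. -/
def AdaptedChart.prolong {π : E → M} (c : AdaptedChart n m π) (k : ℕ) (s : M → E)
    (y : Coord n) : JetCoord n m k :=
  (y, fun I α => pdMulti I.1 (c.localRep s α) y)

variable (n m) in
/-- Local sections together with a point of their domain. -/
abbrev PointedSection (π : E → M) : Type _ :=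
  {p : M × LocalSection n m π // p.1 ∈ p.2.dom}

variable (n m) in
/-- Two local sections are `r`-equivalent at a point `x` if they have the same value there and the
same partial derivatives at `x` up to order `r` in bundle coordinates. -/
def jetSetoid (π : E → M) (r : ℕ∞) : Setoid (PointedSection n m π) where
  r p q := p.1.1 = q.1.1 ∧ p.1.2.toFun p.1.1 = q.1.2.toFun q.1.1 ∧
    ∀ c : AdaptedChart n m π, p.1.2.toFun p.1.1 ∈ c.total.source →
      ∀ I : Multiset (Fin n), (I.card : ℕ∞) ≤ r → ∀ α : Fin m,
        pdMulti I (c.localRep p.1.2.toFun α) (c.base p.1.1) =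
          pdMulti I (c.localRep q.1.2.toFun α) (c.base q.1.1)
  iseqv :=
    { refl := fun _ => ⟨rfl, rfl, fun _ _ _ _ _ => rfl⟩
      symm := fun h => ⟨h.1.symm, h.2.1.symm,
        fun c hc I hI α => (h.2.2 c (h.2.1 ▸ hc) I hI α).symm⟩
      trans := fun h h' => ⟨h.1.trans h'.1, h.2.1.trans h'.2.1,
        fun c hc I hI α => (h.2.2 c hc I hI α).trans (h'.2.2 c (h.2.1 ▸ hc) I hI α)⟩ }

variable (n m) in
/-- The set `J^r π` of `r`-jets of local sections of `π`, `0 ≤ r ≤ ∞`. -/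
def Jet (π : E → M) (r : ℕ∞) : Type _ := Quotient (jetSetoid n m π r)

/-- The `r`-jet `j_r s (x)`. -/
def LocalSection.jet {π : E → M} (r : ℕ∞) (s : LocalSection n m π) (x : M) (hx : x ∈ s.dom) :
    Jet n m π r :=
  Quotient.mk (jetSetoid n m π r) ⟨(x, s), hx⟩

/-- The projection `π_{r,0} : J^r → E`. -/
def Jet.pt {π : E → M} {r : ℕ∞} (θ : Jet n m π r) : E :=
  Quotient.lift (s := jetSetoid n m π r) (fun p => p.1.2.toFun p.1.1) (fun _ _ h => h.2.1) θ

/-- The projection `π_{r,r'} : J^r → J^{r'}`, `r' ≤ r`. -/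
def Jet.trunc {π : E → M} {r r' : ℕ∞} (h : r' ≤ r) (θ : Jet n m π r) : Jet n m π r' :=
  Quotient.map (sa := jetSetoid n m π r) (sb := jetSetoid n m π r') id
    (fun _ _ hpq => ⟨hpq.1, hpq.2.1, fun c hc I hI α => hpq.2.2 c hc I (hI.trans h) α⟩) θ

/-- The projection `π_{k+1,k} : J^{k+1} → J^k`. -/
def Jet.down {π : E → M} {k : ℕ} (θ : Jet n m π (k + 1 : ℕ)) : Jet n m π k :=
  Jet.trunc (Nat.cast_le.2 (Nat.le_succ k)) θ

/-- The jet coordinates `(x^i, u_I^α)`, `|I| ≤ k`, of a jet over the domain of the chart. By the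
definition of jets they do not depend on the local section that represents the jet. -/
def AdaptedChart.coord {π : E → M} (c : AdaptedChart n m π) {k : ℕ} (θ : Jet n m π k) :
    JetCoord n m k :=
  let p : PointedSection n m π := Quotient.out (s := jetSetoid n m π k) θ
  c.prolong k p.1.2.toFun (c.base p.1.1)

/-- The range of the jet coordinates in `J^k`. -/
def AdaptedChart.jetTarget {π : E → M} (c : AdaptedChart n m π) (k : ℕ) : Set (JetCoord n m k) :=
  {z | ∃ θ : Jet n m π k, θ.pt ∈ c.total.source ∧ c.coord θ = z}

open Classical in
/-- The expression in jet coordinates of a map on `J^k` (extended by `0`). -/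
def AdaptedChart.rep {π : E → M} (c : AdaptedChart n m π) {k : ℕ} {V : Type*} [Zero V]
    (f : Jet n m π k → V) : JetCoord n m k → V :=
  fun z => if h : ∃ θ : Jet n m π k, θ.pt ∈ c.total.source ∧ c.coord θ = z then f h.choose else 0

/-- Smooth local sections over `U` of a bundle `X → E → M`, where `pt : X → E` and where
`coord c` are the coordinates induced on `X` by an adapted chart `c`. -/
def IsSmoothSection {π : E → M} {X V : Type*} [NormedAddCommGroup V] [NormedSpace ℝ V]
    (pt : X → E) (coord : AdaptedChart n m π → X → V) (U : Set M) (σ : M → X) : Prop :=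
  IsOpen U ∧ (∀ x ∈ U, π (pt (σ x)) = x) ∧ ContinuousOn (fun x => pt (σ x)) U ∧
    ∀ x ∈ U, ∀ c : AdaptedChart n m π, pt (σ x) ∈ c.total.source →
      ContDiffAt ℝ ∞ (fun y => coord c (σ (c.base.symm y))) (c.base x)

/-! ## Holonomic connections -/

/-- The inclusion `J^{k+1} ⊂ J^1 π_k` in coordinates, `(u_I^α)_i = u_{Ii}^α`: the `R`-plane (as the
linear map `T_x M → T_θ J^k`) which corresponds to a point of `J^{k+1}`. -/
def rPlane {k : ℕ} (z : JetCoord n m (k + 1)) : Coord n →L[ℝ] JetCoord n m k :=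
  (ContinuousLinearMap.id ℝ (Coord n)).prod
    (ContinuousLinearMap.pi fun I => ContinuousLinearMap.pi fun α =>
      ∑ i : Fin n, z.2 (MIdx.cons i I) α • (EuclideanSpace.proj i : Coord n →L[ℝ] ℝ))

variable (n m) in
/-- A holonomic connection in `π_k : J^k → M`: a smooth section of `J^{k+1} ⊂ J^1 π_k → J^k`. -/
structure HolonomicConnection (π : E → M) (k : ℕ) where
  toFun : Jet n m π k → Jet n m π (k + 1 : ℕ)
  isSection : ∀ θ, (toFun θ).down = θ
  smooth : ∀ c : AdaptedChart n m π,
    ContDiffOn ℝ ∞ (c.rep fun θ => c.coord (toFun θ)) (c.jetTarget k)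

namespace HolonomicConnection

variable {π : E → M} {k : ℕ}

/-- The lift `X^∇` to `J^k` of a vector field `X` on `M`, in coordinates. -/
def lift (D : HolonomicConnection n m π k) (c : AdaptedChart n m π) (X : Coord n → Coord n) :
    JetCoord n m k → JetCoord n m k :=
  fun z => rPlane (c.rep (fun θ => c.coord (D.toFun θ)) z) (X z.1)

/-- The curvature `R^∇(X, Y) = [X^∇, Y^∇] - [X, Y]^∇`, in coordinates. -/
def curvature (D : HolonomicConnection n m π k) (c : AdaptedChart n m π)
    (X Y : Coord n → Coord n) : JetCoord n m k → JetCoord n m k :=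
  fun z => VectorField.lieBracket ℝ (D.lift c X) (D.lift c Y) z -
    D.lift c (VectorField.lieBracket ℝ X Y) z

/-- The connection is flat: its curvature vanishes. -/
def IsFlat (D : HolonomicConnection n m π k) : Prop :=
  ∀ c : AdaptedChart n m π, ∀ X Y : Coord n → Coord n, ContDiff ℝ ∞ X → ContDiff ℝ ∞ Y →
    ∀ z ∈ c.jetTarget k, D.curvature c X Y z = 0

/-- `σ` is a (smooth, local) `∇`-constant section of `π_k` over `U`: `∇ ∘ σ = j_1 σ`. -/
def IsConstant (D : HolonomicConnection n m π k) (U : Set M) (σ : M → Jet n m π k) : Prop :=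
  IsSmoothSection Jet.pt (fun c : AdaptedChart n m π => c.coord) U σ ∧
    ∀ x ∈ U, ∀ c : AdaptedChart n m π, (σ x).pt ∈ c.total.source →
      fderiv ℝ (fun y => c.coord (σ (c.base.symm y))) (c.base x) =
        rPlane (c.coord (D.toFun (σ x)))

end HolonomicConnection

/-! ## The reduced multimomentum bundle -/

/-- A smooth curve in the fiber of `π_k : J^k → M` which is at `θ` at time `0`. -/
structure VerticalCurve {π : E → M} {k : ℕ} (θ : Jet n m π k) where
  toFun : ℝ → Jet n m π k
  map_zero : toFun 0 = θ
  vertical : ∀ t, π (toFun t).pt = π θ.pt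
  smooth : ∀ c : AdaptedChart n m π, θ.pt ∈ c.total.source →
    (∀ᶠ t in nhds 0, (toFun t).pt ∈ c.total.source) ∧
      ContDiffAt ℝ ∞ (fun t => c.coord (toFun t)) 0

/-- The components `v_I^α` of the velocity at time `0` of a vertical curve. -/
def AdaptedChart.velocity {π : E → M} {k : ℕ} (c : AdaptedChart n m π) {θ : Jet n m π k}
    (γ : VerticalCurve θ) : MIdx n k → Fin m → ℝ :=
  deriv (fun t => (c.coord (γ.toFun t)).2) 0

/-- The coordinate vector `∂/∂x^i` at `x ∈ M`. -/
def AdaptedChart.frame {π : E → M} (c : AdaptedChart n m π) (x : M) (i : Fin n) :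
    TangentSpace 𝓘(ℝ, Coord n) x :=
  mfderiv 𝓘(ℝ, Coord n) 𝓘(ℝ, Coord n) c.base.symm (c.base x)
    (EuclideanSpace.single i (1 : ℝ) : Coord n)

/-- The coordinate covector `dx^i` at `x ∈ M`. -/
def AdaptedChart.coframe {π : E → M} (c : AdaptedChart n m π) (x : M) (i : Fin n) :
    TangentSpace 𝓘(ℝ, Coord n) x →ₗ[ℝ] ℝ :=
  (EuclideanSpace.proj i : Coord n →L[ℝ] ℝ).toLinearMap ∘ₗ
    (mfderiv 𝓘(ℝ, Coord n) 𝓘(ℝ, Coord n) c.base x).toLinearMap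

/-- The exterior product `l₁ ∧ ⋯ ∧ l_N` of covectors. -/
def wedge {N : ℕ} {V : Type*} [AddCommGroup V] [Module ℝ V] (l : Fin N → V →ₗ[ℝ] ℝ) :
    V [⋀^Fin N]→ₗ[ℝ] ℝ :=
  Matrix.detRowAlternating.compLinearMap (LinearMap.pi l)

/-- The form `d^{n-1}x_i = i_{∂/∂x^i} (dx^1 ∧ ⋯ ∧ dx^n)` at `x ∈ M`. -/
def AdaptedChart.dx {π : E → M} (c : AdaptedChart n m π) (x : M) (i : Fin n) :
    TangentSpace 𝓘(ℝ, Coord n) x [⋀^Fin (n - 1)]→ₗ[ℝ] ℝ :=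
  AlternatingMap.curryLeft
    ((wedge (c.coframe x)).domDomCongr (finCongr (Nat.succ_pred_eq_of_pos i.pos).symm))
    (c.frame x i)

/-- Fiber coordinates `p_α^{I.i}` of the reduced multimomentum bundle of `π_k`. -/
abbrev MomCoord (n m k : ℕ) : Type := MIdx n k → Fin m → Fin n → ℝ

/-- The fiber `V_θ^* J^k ⊗ Λ^{n-1} T_x^* M` at `θ ∈ J^k` of the reduced multimomentum bundle
`J^† π_k`: maps from vertical tangent vectors at `θ` (velocities of vertical curves) to
`Λ^{n-1} T_x^* M` which are linear, i.e. of the form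
`∑ p_α^{I.i} du_I^α ⊗ d^{n-1}x_i` in adapted coordinates. -/
def Multimomentum {π : E → M} {k : ℕ} (θ : Jet n m π k) : Type _ :=
  {p : VerticalCurve θ → TangentSpace 𝓘(ℝ, Coord n) (π θ.pt) [⋀^Fin (n - 1)]→ₗ[ℝ] ℝ //
    ∀ c : AdaptedChart n m π, θ.pt ∈ c.total.source → ∃ a : MomCoord n m k,
      ∀ γ : VerticalCurve θ,
        p γ = ∑ I, ∑ α, ∑ i, (a I α i * c.velocity γ I α) • c.dx (π θ.pt) i}

open Classical in
/-- The momentum coordinates `p_α^{I.i}` of a multimomentum. -/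
def AdaptedChart.momCoord {π : E → M} {k : ℕ} (c : AdaptedChart n m π) {θ : Jet n m π k}
    (p : Multimomentum θ) : MomCoord n m k :=
  if h : θ.pt ∈ c.total.source then (p.2 c h).choose else 0

variable (n m) in
/-- The reduced multimomentum bundle `J^† π_k` (total space). -/
def MultimomentumBundle (π : E → M) (k : ℕ) : Type _ :=
  Σ θ : Jet n m π k, Multimomentum θ

/-- The projection of the multimomentum bundle to `E`. -/
def MultimomentumBundle.pt {π : E → M} {k : ℕ} (q : MultimomentumBundle n m π k) : E := q.1.pt

/-- Coordinates `(x^i, u_I^α, p_α^{I.i})`, `|I| ≤ k`, of `J^† π_k`. -/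
abbrev MMCoord (n m k : ℕ) : Type :=
  Coord n × ((MIdx n k → Fin m → ℝ) × MomCoord n m k)

/-- The coordinates of a point of `J^† π_k`. -/
def AdaptedChart.mmCoord {π : E → M} {k : ℕ} (c : AdaptedChart n m π)
    (q : MultimomentumBundle n m π k) : MMCoord n m k :=
  ((c.coord q.1).1, ((c.coord q.1).2, c.momCoord q.2))

variable (n m) in
/-- The pull-back bundle `π_{k+1,k}^∘ (J^† π_k)` (total space). -/
def MixedBundle (π : E → M) (k : ℕ) : Type _ :=
  {w : Jet n m π (k + 1 : ℕ) × MultimomentumBundle n m π k // w.1.down = w.2.1}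

/-- The projection of the pull-back bundle to `E`. -/
def MixedBundle.pt {π : E → M} {k : ℕ} (w : MixedBundle n m π k) : E := w.1.1.pt

/-- The projection `π_{k+1,k}^∘ (J^† π_k) → J^† π_k`. -/
def MixedBundle.toMM {π : E → M} {k : ℕ} (w : MixedBundle n m π k) :
    MultimomentumBundle n m π k := w.1.2

/-- Coordinates `(x^i, u_K^α, p_α^{I.i})`, `|K| ≤ k + 1`, `|I| ≤ k`, of
`π_{k+1,k}^∘ (J^† π_k)`. -/
abbrev MixedCoord (n m k : ℕ) : Type :=
  Coord n × ((MIdx n (k + 1) → Fin m → ℝ) × MomCoord n m k)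

/-- The coordinates of a point of `π_{k+1,k}^∘ (J^† π_k)`. -/
def AdaptedChart.mixedCoord {π : E → M} {k : ℕ} (c : AdaptedChart n m π)
    (w : MixedBundle n m π k) : MixedCoord n m k :=
  ((c.coord w.1.1).1, ((c.coord w.1.1).2, c.momCoord w.1.2.2))

/-- The projection `π_{k+1,k}^∘ (J^† π_k) → J^† π_k` in coordinates. -/
def forget {k : ℕ} (w : MixedCoord n m k) : MMCoord n m k :=
  (w.1, (fun I => w.2.1 I.incl, w.2.2))

variable (n m) in
/-- A smooth section `T` of `J^† π_k → J^k`. -/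
structure MultimomentumSection (π : E → M) (k : ℕ) where
  toFun : (θ : Jet n m π k) → Multimomentum θ
  smooth : ∀ c : AdaptedChart n m π,
    ContDiffOn ℝ ∞ (c.rep fun θ => c.momCoord (toFun θ)) (c.jetTarget k)

/-- The map `T : J^k → J^† π_k`. -/
def MultimomentumSection.map {π : E → M} {k : ℕ} (T : MultimomentumSection n m π k)
    (θ : Jet n m π k) : MultimomentumBundle n m π k := ⟨θ, T.toFun θ⟩

/-- The map `(∇, T) : J^k → π_{k+1,k}^∘ (J^† π_k)`. -/
def pair {π : E → M} {k : ℕ} (D : HolonomicConnection n m π k)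
    (T : MultimomentumSection n m π k) (θ : Jet n m π k) : MixedBundle n m π k :=
  ⟨(D.toFun θ, T.map θ), D.isSection θ⟩

/-! ## Differential forms on coordinate spaces -/

/-- The form `i^{1,n}` of an `(n+1)`-covector `η` with respect to the horizontal lifts
`h_1, …, h_n` of `∂/∂x^1, …, ∂/∂x^n`, evaluated on the vertical vector `Y` (and on
`∂/∂x^1, …, ∂/∂x^n`). -/
def i1n {R : Type*} [AddCommGroup R] [Module ℝ R]
    (η : (Fin (n + 1) → Coord n × R) → ℝ) (h : Fin n → Coord n × R) (Y : R) : ℝ :=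
  η (Fin.cons ((0 : Coord n), Y) h)

/-- Pull-back of a form along `f`, at the point `z`. -/
def pullback {N : ℕ} {V W : Type*} [NormedAddCommGroup V] [NormedSpace ℝ V]
    [NormedAddCommGroup W] [NormedSpace ℝ W] (f : V → W) (η : W → (Fin N → W) → ℝ) (z : V) :
    (Fin N → V) → ℝ :=
  fun X => η (f z) (fun j => fderiv ℝ f z (X j))

/-- The partial derivatives at `y` of a map on the base coordinates, i.e. the lifts of
`∂/∂x^1, …, ∂/∂x^n` along a section. -/
def partials {V : Type*} [NormedAddCommGroup V] [NormedSpace ℝ V] (f : Coord n → V)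
    (y : Coord n) : Fin n → V :=
  fun i => fderiv ℝ f y (EuclideanSpace.single i 1)

/-- The tangent vectors at `q` of a submanifold `S` of a vector space: velocities of smooth curves
in `S`. -/
def tangentVectors {V : Type*} [NormedAddCommGroup V] [NormedSpace ℝ V] (S : Set V) (q : V) :
    Set V :=
  {v | ∃ γ : ℝ → V, γ 0 = q ∧ (∀ᶠ t in nhds 0, γ t ∈ S) ∧ ContDiffAt ℝ ∞ γ 0 ∧ deriv γ 0 = v}

/-- `S` is an (embedded) submanifold: locally the zero set of a smooth submersion to some `ℝ^r`. -/
def IsSubmanifold {V : Type*} [NormedAddCommGroup V] [NormedSpace ℝ V] (S : Set V) : Prop :=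
  ∀ q ∈ S, ∃ (U : Set V) (r : ℕ) (f : V → Coord r), IsOpen U ∧ q ∈ U ∧ ContDiffOn ℝ ∞ f U ∧
    (∀ y ∈ U, Function.Surjective (fderiv ℝ f y)) ∧ S ∩ U = {y ∈ U | f y = 0}

/-! ## Lagrangian field theories -/

variable (n m) in
/-- A Lagrangian density `ℒ ∈ Λ_n^n(J^{k+1}, π_{k+1})` of order `≤ k + 1`, a smooth horizontal
`n`-form on `J^{k+1}`. -/
structure Lagrangian (π : E → M) (k : ℕ) where
  toFun : (θ : Jet n m π (k + 1 : ℕ)) → TangentSpace 𝓘(ℝ, Coord n) (π θ.pt) [⋀^Fin n]→ₗ[ℝ] ℝ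
  smooth : ∀ c : AdaptedChart n m π,
    ContDiffOn ℝ ∞ (c.rep fun θ => toFun θ (c.frame (π θ.pt))) (c.jetTarget (k + 1))

namespace Lagrangian

variable {π : E → M} {k : ℕ}

/-- The local function `L` with `ℒ = L d^n x`. -/
def density (ℒ : Lagrangian n m π k) (c : AdaptedChart n m π) : JetCoord n m (k + 1) → ℝ :=
  c.rep fun θ => ℒ.toFun θ (c.frame (π θ.pt))

/-- `∂L / ∂u_K^α`. -/
def dLdu (ℒ : Lagrangian n m π k) (c : AdaptedChart n m π) (K : MIdx n (k + 1)) (α : Fin m)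
    (z : JetCoord n m (k + 1)) : ℝ :=
  fderiv ℝ (ℒ.density c) z (0, Pi.single K (Pi.single α 1))

/-- `E = ∑ u_{Ii}^α p_α^{I.i} - L`. -/
def energy (ℒ : Lagrangian n m π k) (c : AdaptedChart n m π) (w : MixedCoord n m k) : ℝ :=
  (∑ I : MIdx n k, ∑ α, ∑ i, w.2.1 (I.cons i) α * w.2.2 I α i) - ℒ.density c (w.1, w.2.1)

/-- The PD Hamiltonian system on `π_{k+1,k}^∘ (J^† π_k)`, in coordinates:
`ω = ∑ dp_α^{I.i} ∧ du_I^α ∧ d^{n-1}x_i - dE ∧ d^n x`, where `du_I^α ∧ d^{n-1}x_i` is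
`dx^1 ∧ ⋯ ∧ dx^n` with the factor `dx^i` replaced by `du_I^α`. -/
def omega (ℒ : Lagrangian n m π k) (c : AdaptedChart n m π) (w : MixedCoord n m k) :
    MixedCoord n m k [⋀^Fin (n + 1)]→ₗ[ℝ] ℝ :=
  let dx : Fin n → MixedCoord n m k →ₗ[ℝ] ℝ := fun i =>
    (EuclideanSpace.proj i : Coord n →L[ℝ] ℝ).toLinearMap ∘ₗ LinearMap.fst ℝ _ _
  let du : MIdx n k → Fin m → MixedCoord n m k →ₗ[ℝ] ℝ := fun I α =>
    LinearMap.proj α ∘ₗ LinearMap.proj I.incl ∘ₗ LinearMap.fst ℝ _ _ ∘ₗ LinearMap.snd ℝ _ _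
  let dp : MIdx n k → Fin m → Fin n → MixedCoord n m k →ₗ[ℝ] ℝ := fun I α i =>
    LinearMap.proj i ∘ₗ LinearMap.proj α ∘ₗ LinearMap.proj I ∘ₗ LinearMap.snd ℝ _ _ ∘ₗ
      LinearMap.snd ℝ _ _
  let dE : MixedCoord n m k →ₗ[ℝ] ℝ := (fderiv ℝ (ℒ.energy c) w).toLinearMap
  (∑ I : MIdx n k, ∑ α, ∑ i, wedge (Fin.cons (dp I α i) (Function.update dx i (du I α)))) -
    wedge (Fin.cons dE dx)

/-- `σ` is a (smooth, local) section of `π_{k+1,k}^∘ (J^† π_k) → M` over `U` which solves the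
Euler–Lagrange–Hamilton equations `i^{1,n}(j_1 σ) ω|_σ = 0`. -/
def SolvesELH (ℒ : Lagrangian n m π k) (U : Set M) (σ : M → MixedBundle n m π k) : Prop :=
  IsSmoothSection MixedBundle.pt (fun c : AdaptedChart n m π => c.mixedCoord) U σ ∧
    ∀ x ∈ U, ∀ c : AdaptedChart n m π, (σ x).pt ∈ c.total.source →
      ∀ Y : (MIdx n (k + 1) → Fin m → ℝ) × MomCoord n m k,
        i1n (ℒ.omega c (c.mixedCoord (σ x)))
          (partials (fun y => c.mixedCoord (σ (c.base.symm y))) (c.base x)) Y = 0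

/-- The first constraint subbundle `𝒫`, in coordinates:
`∂L/∂u_K^α = ∑_{Ji = K} p_α^{J.i}` for `|K| = k + 1`. -/
def constraintCoord (ℒ : Lagrangian n m π k) (c : AdaptedChart n m π) : Set (MixedCoord n m k) :=
  {w | (w.1, w.2.1) ∈ c.jetTarget (k + 1) ∧
    ∀ K : MIdx n (k + 1), K.1.card = k + 1 → ∀ α : Fin m,
      ℒ.dLdu c K α (w.1, w.2.1) =
        ∑ J : MIdx n k, ∑ i, if J.cons i = K then w.2.2 J α i else 0}

/-- The first constraint subbundle `𝒫 ⊂ π_{k+1,k}^∘ (J^† π_k)`. -/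
def constraint (ℒ : Lagrangian n m π k) : Set (MixedBundle n m π k) :=
  {w | ∀ c : AdaptedChart n m π, w.pt ∈ c.total.source → c.mixedCoord w ∈ ℒ.constraintCoord c}

/-- The image `𝒫₀ ⊂ J^† π_k` of `𝒫`. -/
def constraint₀ (ℒ : Lagrangian n m π k) : Set (MultimomentumBundle n m π k) :=
  MixedBundle.toMM '' ℒ.constraint

/-- The image `𝒫₀ ⊂ J^† π_k` of `𝒫`, in coordinates. -/
def constraintCoord₀ (ℒ : Lagrangian n m π k) (c : AdaptedChart n m π) : Set (MMCoord n m k) :=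
  forget '' ℒ.constraintCoord c

/-- The standing assumption on `ℒ`: `𝒫₀` is a submanifold and `𝒫 → 𝒫₀` is a submersion with
connected fibers. -/
def IsAdmissible (ℒ : Lagrangian n m π k) : Prop :=
  ∀ c : AdaptedChart n m π,
    IsSubmanifold (ℒ.constraintCoord₀ c) ∧
    (∀ w ∈ ℒ.constraintCoord c,
      ∀ v ∈ tangentVectors (ℒ.constraintCoord₀ c) (forget w),
        ∃ v' ∈ tangentVectors (ℒ.constraintCoord c) w, forget v' = v) ∧
    ∀ q ∈ ℒ.constraintCoord₀ c, IsConnected {w ∈ ℒ.constraintCoord c | forget w = q}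

/-- The form `ω₀` on `𝒫₀` whose pull-back to `𝒫` is the restriction of `ω`, in coordinates: its
value at `q ∈ 𝒫₀` on vectors tangent to `𝒫₀` is the value of `ω` on lifts of these vectors to
vectors tangent to `𝒫`, at a point of `𝒫` over `q`. -/
def omega₀ (ℒ : Lagrangian n m π k) (c : AdaptedChart n m π) (q : MMCoord n m k)
    (v : Fin (n + 1) → MMCoord n m k) : ℝ :=
  Classical.epsilon fun r : ℝ => ∃ w ∈ ℒ.constraintCoord c, forget w = q ∧
    ∃ v' : Fin (n + 1) → MixedCoord n m k,
      (∀ j, v' j ∈ tangentVectors (ℒ.constraintCoord c) w ∧ forget (v' j) = v j) ∧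
      r = ℒ.omega c w v'

/-- `σ₀` is a (smooth, local) section of `𝒫₀ → M` over `U` which solves the
Hamilton–de Donder–Weyl equations `i^{1,n}(j_1 σ₀) ω₀|_{σ₀} = 0`. -/
def SolvesHDW (ℒ : Lagrangian n m π k) (U : Set M) (σ₀ : M → MultimomentumBundle n m π k) : Prop :=
  IsSmoothSection MultimomentumBundle.pt (fun c : AdaptedChart n m π => c.mmCoord) U σ₀ ∧
    (∀ x ∈ U, σ₀ x ∈ ℒ.constraint₀) ∧
    ∀ x ∈ U, ∀ c : AdaptedChart n m π, (σ₀ x).pt ∈ c.total.source →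
      ∀ Y : (MIdx n k → Fin m → ℝ) × MomCoord n m k,
        ((0 : Coord n), Y) ∈ tangentVectors (ℒ.constraintCoord₀ c) (c.mmCoord (σ₀ x)) →
          i1n (ℒ.omega₀ c (c.mmCoord (σ₀ x)))
            (partials (fun y => c.mmCoord (σ₀ (c.base.symm y))) (c.base x)) Y = 0

/-- `(∇, T)`, with `∇` flat, solves the generalized Hamilton–Jacobi problem: `(∇, T) ∘ σ` solves
the Euler–Lagrange–Hamilton equations for every `∇`-constant local section `σ`. -/
def SolvesHJ (ℒ : Lagrangian n m π k) (D : HolonomicConnection n m π k)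
    (T : MultimomentumSection n m π k) : Prop :=
  D.IsFlat ∧ ∀ (U : Set M) (σ : M → Jet n m π k), D.IsConstant U σ →
    ℒ.SolvesELH U (fun x => pair D T (σ x))

/-- `i^{1,n}(∇) T^* ω₀ = 0` on `J^k`. -/
def ReducedEquation (ℒ : Lagrangian n m π k) (D : HolonomicConnection n m π k)
    (T : MultimomentumSection n m π k) : Prop :=
  ∀ c : AdaptedChart n m π, ∀ z ∈ c.jetTarget k, ∀ Y : MIdx n k → Fin m → ℝ,
    i1n (pullback (fun z => (z.1, (z.2, c.rep (fun θ => c.momCoord (T.toFun θ)) z)))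
        (ℒ.omega₀ c) z)
      (fun i => D.lift c (fun _ => EuclideanSpace.single i 1) z) Y = 0

/-- `i^{1,n}(∇) (∇, T)^* ω = 0` on `J^k`. -/
def PairEquation (ℒ : Lagrangian n m π k) (D : HolonomicConnection n m π k)
    (T : MultimomentumSection n m π k) : Prop :=
  ∀ c : AdaptedChart n m π, ∀ z ∈ c.jetTarget k, ∀ Y : MIdx n k → Fin m → ℝ,
    i1n (pullback
        (fun z => (z.1, ((c.rep (fun θ => c.coord (D.toFun θ)) z).2,
          c.rep (fun θ => c.momCoord (T.toFun θ)) z)))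
        (fun w v => ℒ.omega c w v) z)
      (fun i => D.lift c (fun _ => EuclideanSpace.single i 1) z) Y = 0

/-- The Euler–Lagrange expression `δL/δu^α = ∑ (-1)^{|I|} D_I (∂L/∂u_I^α)`, `|I| ≤ k + 1`, along a
section `s` (the total derivatives `D_I` are partial derivatives along jet prolongations). -/
def eulerLagrange (ℒ : Lagrangian n m π k) (c : AdaptedChart n m π) (s : M → E) (α : Fin m)
    (y : Coord n) : ℝ :=
  ∑ I : MIdx n (k + 1), (-1 : ℝ) ^ I.1.card *
    pdMulti I.1 (fun y' => ℒ.dLdu c I α (c.prolong (k + 1) s y')) y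

/-- The Euler–Lagrange equations `𝑬(ℒ) = 0`, as a subset of `J^{2(k+1)}`. -/
def eulerLagrangeEq (ℒ : Lagrangian n m π k) : Set (Jet n m π (2 * (k + 1) : ℕ)) :=
  {θ | ∃ (s : LocalSection n m π) (x : M) (hx : x ∈ s.dom), s.jet _ x hx = θ ∧
    ∀ c : AdaptedChart n m π, s.toFun x ∈ c.total.source →
      ∀ α : Fin m, ℒ.eulerLagrange c s.toFun α (c.base x) = 0}

end Lagrangian

/-! ## Infinite prolongations and Hamilton–Jacobi subdiffieties -/

/-- The image of `j_r s` is tangent to `S ⊂ J^r` at `j_r s (x)` up to infinite order: it meets `S`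
there, and for every smooth function `f` which vanishes on `S` near that point all partial
derivatives of `f ∘ j_r s` vanish at `x`. -/
def InfinitelyTangent {π : E → M} {r : ℕ} (S : Set (Jet n m π r)) (s : LocalSection n m π)
    (x : M) (hx : x ∈ s.dom) : Prop :=
  s.jet r x hx ∈ S ∧
    ∀ c : AdaptedChart n m π, s.toFun x ∈ c.total.source →
      ∀ (V : Set (JetCoord n m r)) (f : JetCoord n m r → ℝ), IsOpen V →
        c.prolong r s.toFun (c.base x) ∈ V → ContDiffOn ℝ ∞ f V →
        (∀ θ ∈ S, θ.pt ∈ c.total.source → c.coord θ ∈ V → f (c.coord θ) = 0) →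
        ∀ I : Multiset (Fin n), pdMulti I (fun y => f (c.prolong r s.toFun y)) (c.base x) = 0

/-- The infinite prolongation `S_∞ ⊂ J^∞` of a differential equation `S ⊂ J^r`. -/
def infiniteProlongation {π : E → M} {r : ℕ} (S : Set (Jet n m π r)) : Set (Jet n m π ⊤) :=
  {Θ | ∃ (s : LocalSection n m π) (x : M) (hx : x ∈ s.dom),
    s.jet ⊤ x hx = Θ ∧ InfinitelyTangent S s x hx}

/-- The Euler–Lagrange diffiety `𝓔_EL ⊂ J^∞`. -/
def Lagrangian.diffiety {π : E → M} {k : ℕ} (ℒ : Lagrangian n m π k) : Set (Jet n m π ⊤) :=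
  infiniteProlongation ℒ.eulerLagrangeEq

/-- `𝒴_∞^∇`, the infinite prolongation of the equation `𝒴^∇ = im ∇ ⊂ J^{k+1}`. -/
def HolonomicConnection.diffiety {π : E → M} {k : ℕ} (D : HolonomicConnection n m π k) :
    Set (Jet n m π ⊤) :=
  infiniteProlongation (Set.range D.toFun)

/-- `𝒴_∞^∇` is an elementary Hamilton–Jacobi subdiffiety of `𝓔 ⊂ J^∞`: the holonomic connection
`∇` is flat and `𝒴_∞^∇ ⊂ 𝓔`. -/
def HolonomicConnection.IsElementaryHJSubdiffiety {π : E → M} {k : ℕ}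
    (D : HolonomicConnection n m π k) (𝓔 : Set (Jet n m π ⊤)) : Prop :=
  D.IsFlat ∧ D.diffiety ⊆ 𝓔

end Bundles

end HJ

end

/-!
All the conditions are compared with one system of equations in jet coordinates, `HJCoord`: the
image of `(∇, T)` lies in `𝒫`, and for `|I| ≤ k`
`∂L/∂u_I^α = ∑_{Ji = I} p_α^{J.i} + ∑_i D_i p_α^{I.i}`,
where the momenta `p` are those of `T` and `D_i` is the derivative along the `∇`-lift of `∂/∂x^i`.

* The form `ω` is a sum of products in which `n` of the `n + 1` factors are, up to one exchange, the
  coordinate covectors `dx^i`. On a vertical vector and on `n` lifts of the coordinate vectors which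
  are holonomic it is therefore explicit (`Lagrangian.i1n_omega_eq`): its coefficients are the
  equations above together with the equations of `𝒫`. For arbitrary vertical vectors this is the
  Euler–Lagrange–Hamilton condition at a point; for vertical vectors tangent to `im (∇, T) ⊂ 𝒫` it
  is the condition `i^{1,n}(∇) (∇, T)^* ω = 0`.

* A flat holonomic connection is an integrable total differential equation, so by the Frobenius
  theorem (`exists_hasFDerivAt_of_flat`) there is a `∇`-constant section through every point of
  `J^k`, and it is the prolongation of a section of `π`
  (`HolonomicConnection.IsFlat.exists_section`). Equations along all the `∇`-constant sections are
  thus the same as equations on `J^k`. Frobenius' theorem is proved by integrating along rays and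
  comparing neighbouring rays by Grönwall's inequality.

* The conditions on `ω₀` are conditions on `ω` because `ω₀` is well defined
  (`Lagrangian.IsAdmissible.omega₀_eq`). All terms of `ω` except the one with `dE` are pulled back
  from `J^† π_k`, so this means that the restriction of `dE` to `𝒫` is basic
  (`fderiv_eq_of_map_eq`). As `𝒫` is the set of points where `E` is critical along the fibers of
  `W → J^† π_k`, the derivative of `E` in a given direction is constant along arcs in the fibers of
  `𝒫 → 𝒫₀`, by the symmetry of the second derivative. Points of such a fiber are joined by chains of
  arcs because the fibers are connected, and locally they are level sets of a submersion: the
  derivative of `E` along the fibers of `W` is already a submersion in the momentum variables.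

* Along a `∇`-constant section the equations above express `∂L/∂u_K` through the momenta in such a
  way that `∑ (-1)^{|K|} D_K ∂L/∂u_K` telescopes to zero (`sum_neg_one_pow_pdMulti_eq_zero`). The
  equation `im ∇` determines all derivatives of order above `k`, so a section which is tangent to it
  up to infinite order at a point has there the infinite jet of a `∇`-constant section
  (`InfinitelyTangent.pdMulti_localRep_eq`), which is a solution of the Euler–Lagrange equations.

Coordinate changes enter only through the fact that jets may be compared in a single chart
(`LocalSection.jet_eq_of_chart`), a consequence of Faà di Bruno's formula.
-/


namespace HJ

open Set Filter Topology

/-! ### Iterated partial derivatives on open sets -/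

section PartialDerivatives

variable {n : ℕ} {s : Set (Coord n)} {f g : Coord n → ℝ}

lemma contDiffOn_pd (hs : IsOpen s) (hf : ContDiffOn ℝ ∞ f s) (i : Fin n) :
    ContDiffOn ℝ ∞ (pd i f) s :=
  (hf.fderiv_of_isOpen hs (by simp)).clm_apply contDiffOn_const

lemma eqOn_pd (hs : IsOpen s) (h : EqOn f g s) (i : Fin n) : EqOn (pd i f) (pd i g) s := by
  intro y hy
  have : f =ᶠ[𝓝 y] g := h.eventuallyEq_of_mem (hs.mem_nhds hy)
  simp only [pd, this.fderiv_eq]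

lemma contDiffOn_foldr_pd (hs : IsOpen s) (hf : ContDiffOn ℝ ∞ f s) (l : List (Fin n)) :
    ContDiffOn ℝ ∞ (l.foldr pd f) s := by
  induction l with
  | nil => exact hf
  | cons i l ih => exact contDiffOn_pd hs ih i

lemma eqOn_foldr_pd (hs : IsOpen s) (h : EqOn f g s) (l : List (Fin n)) :
    EqOn (l.foldr pd f) (l.foldr pd g) s := by
  induction l with
  | nil => exact h
  | cons i l ih => exact eqOn_pd hs ih i

lemma pd_comm (hs : IsOpen s) (hf : ContDiffOn ℝ ∞ f s) (i j : Fin n) :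
    EqOn (pd i (pd j f)) (pd j (pd i f)) s := by
  intro y hy
  have hfy : ContDiffAt ℝ ∞ f y := hf.contDiffAt (hs.mem_nhds hy)
  have hd : DifferentiableAt ℝ (fderiv ℝ f) y :=
    ((hf.fderiv_of_isOpen hs (m := ∞) (by simp)).contDiffAt (hs.mem_nhds hy)).differentiableAt
      (by simp)
  have key : ∀ a b : Coord n, fderiv ℝ (fun z => fderiv ℝ f z a) y b =
      fderiv ℝ (fderiv ℝ f) y b a := by
    intro a b
    rw [fderiv_clm_apply hd (differentiableAt_const a)]
    simp
  change fderiv ℝ (fun z => fderiv ℝ f z _) y _ = fderiv ℝ (fun z => fderiv ℝ f z _) y _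
  rw [key, key]
  exact (hfy.isSymmSndFDerivAt (by
    rw [minSmoothness_of_isRCLikeNormedField]
    exact WithTop.coe_le_coe.2 le_top)).eq _ _

lemma eqOn_foldr_pd_of_perm (hs : IsOpen s) (hf : ContDiffOn ℝ ∞ f s) {l l' : List (Fin n)}
    (h : l.Perm l') : EqOn (l.foldr pd f) (l'.foldr pd f) s := by
  induction h with
  | nil => exact fun _ _ => rfl
  | cons i _ ih => exact eqOn_pd hs ih i
  | swap i j l => exact pd_comm hs (contDiffOn_foldr_pd hs hf l) _ _
  | trans _ _ h₁ h₂ => exact h₁.trans h₂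

/-- The derivatives in `pdMulti`, which are taken in sorted order, may be taken in any order. -/
lemma pdMulti_eqOn_foldr (hs : IsOpen s) (hf : ContDiffOn ℝ ∞ f s) (l : List (Fin n)) :
    EqOn (pdMulti (l : Multiset (Fin n)) f) (l.foldr pd f) s := by
  refine eqOn_foldr_pd_of_perm hs hf ?_
  rw [← Multiset.coe_eq_coe, Multiset.sort_eq]

lemma contDiffOn_pdMulti (hs : IsOpen s) (hf : ContDiffOn ℝ ∞ f s) (I : Multiset (Fin n)) :
    ContDiffOn ℝ ∞ (pdMulti I f) s :=
  contDiffOn_foldr_pd hs hf _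

lemma eqOn_pdMulti (hs : IsOpen s) (h : EqOn f g s) (I : Multiset (Fin n)) :
    EqOn (pdMulti I f) (pdMulti I g) s :=
  eqOn_foldr_pd hs h _

lemma pdMulti_congr {y : Coord n} (h : f =ᶠ[𝓝 y] g) (I : Multiset (Fin n)) :
    pdMulti I f y = pdMulti I g y := by
  obtain ⟨t, ht, hto, hyt⟩ := eventually_nhds_iff.1 h
  exact eqOn_pdMulti hto ht I hyt

@[simp] lemma pdMulti_zero (f : Coord n → ℝ) : pdMulti 0 f = f := by
  simp [pdMulti]

lemma pdMulti_cons (hs : IsOpen s) (hf : ContDiffOn ℝ ∞ f s) (i : Fin n)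
    (I : Multiset (Fin n)) : EqOn (pdMulti (i ::ₘ I) f) (pd i (pdMulti I f)) s := by
  induction I using Quotient.inductionOn with
  | h l =>
    exact (pdMulti_eqOn_foldr hs hf (i :: l)).trans
      (eqOn_pd hs (pdMulti_eqOn_foldr hs hf l).symm i)

lemma pdMulti_add (hs : IsOpen s) (hf : ContDiffOn ℝ ∞ f s) (I J : Multiset (Fin n)) :
    EqOn (pdMulti (I + J) f) (pdMulti I (pdMulti J f)) s := by
  induction I using Multiset.induction_on with
  | empty => intro y _; simp
  | cons i I ih =>
    rw [Multiset.cons_add]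
    exact (pdMulti_cons hs hf i (I + J)).trans
      ((eqOn_pd hs ih i).trans (pdMulti_cons hs (contDiffOn_pdMulti hs hf J) i I).symm)

lemma foldr_pd_eq_iteratedFDeriv (hs : IsOpen s) (hf : ContDiffOn ℝ ∞ f s)
    (l : List (Fin n)) : ∀ y ∈ s, l.foldr pd f y =
      iteratedFDeriv ℝ l.length f y (fun j => EuclideanSpace.single (l.get j) 1) := by
  induction l with
  | nil => intro y _; simp
  | cons i l ih =>
    intro y hy
    rw [List.foldr_cons]
    have h1 : (l.foldr pd f) =ᶠ[𝓝 y] fun z =>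
        iteratedFDeriv ℝ l.length f z (fun j => EuclideanSpace.single (l.get j) 1) :=
      eventually_of_mem (hs.mem_nhds hy) ih
    have hd : DifferentiableAt ℝ (iteratedFDeriv ℝ l.length f) y :=
      (hf.contDiffAt (hs.mem_nhds hy)).differentiableAt_iteratedFDeriv
        (by exact_mod_cast ENat.natCast_lt_top _)
    have h2 := ((ContinuousMultilinearMap.apply ℝ (fun _ : Fin l.length => Coord n) ℝ
      (fun j => EuclideanSpace.single (l.get j) 1)).hasFDerivAt.comp y hd.hasFDerivAt).fderiv
    rw [pd, h1.fderiv_eq]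
    simp only [List.length_cons, iteratedFDeriv_succ_apply_left]
    have h3 : (fun z => iteratedFDeriv ℝ l.length f z
        (fun j => EuclideanSpace.single (l.get j) 1)) =
        (ContinuousMultilinearMap.apply ℝ (fun _ : Fin l.length => Coord n) ℝ
      (fun j => EuclideanSpace.single (l.get j) 1)) ∘ iteratedFDeriv ℝ l.length f := rfl
    rw [h3, h2]
    rfl

end PartialDerivatives

/-! ### Agreement of functions up to a given order -/

section Agreement

variable {V W X : Type*} [NormedAddCommGroup V] [NormedSpace ℝ V] [NormedAddCommGroup W]
  [NormedSpace ℝ W] [NormedAddCommGroup X] [NormedSpace ℝ X]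

/-- `f` and `g` have the same Taylor polynomial of order `r` at `x`. -/
def AgreeAt (r : ℕ) (f g : V → W) (x : V) : Prop :=
  ∀ j ≤ r, iteratedFDeriv ℝ j f x = iteratedFDeriv ℝ j g x

lemma AgreeAt.value {r : ℕ} {f g : V → W} {x : V} (h : AgreeAt r f g x) : f x = g x := by
  have := congrArg (fun T => T 0) (h 0 (Nat.zero_le _))
  simpa using this

/-- Faà di Bruno's formula: the Taylor polynomial of a composition is determined by the Taylor
polynomials of the two functions. -/
lemma AgreeAt.comp {r : ℕ} {f f' : V → W} {g g' : W → X} {x : V} (hf : ContDiffAt ℝ ∞ f x)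
    (hf' : ContDiffAt ℝ ∞ f' x) (hg : ContDiffAt ℝ ∞ g (f x)) (hg' : ContDiffAt ℝ ∞ g' (f x))
    (h : AgreeAt r f f' x) (h' : AgreeAt r g g' (f x)) : AgreeAt r (g ∘ f) (g' ∘ f') x := by
  intro j hj
  have hle : ((j : ℕ∞) : WithTop ℕ∞) ≤ ∞ := by exact_mod_cast le_top
  rw [iteratedFDeriv_comp hg hf hle, iteratedFDeriv_comp (h.value ▸ hg') hf' hle]
  simp only [FormalMultilinearSeries.taylorComp]
  refine Finset.sum_congr rfl fun c _ => ?_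
  have hq : ftaylorSeries ℝ g (f x) c.length = ftaylorSeries ℝ g' (f' x) c.length := by
    rw [← h.value]; exact h' _ (c.length_le.trans hj)
  have hp : (fun k => ftaylorSeries ℝ f x (c.partSize k)) =
      fun k => ftaylorSeries ℝ f' x (c.partSize k) :=
    funext fun k => h _ ((c.partSize_le k).trans hj)
  ext v
  simp only [FormalMultilinearSeries.compAlongOrderedFinpartition_apply, hq]
  congr 1
  ext k
  simp only [OrderedFinpartition.applyOrderedFinpartition]
  exact DFunLike.congr_fun (congrFun hp k) _

lemma AgreeAt.refl (r : ℕ) (f : V → W) (x : V) : AgreeAt r f f x := fun _ _ => rfl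

lemma AgreeAt.congr {r : ℕ} {f f' g g' : V → W} {x : V} (h : AgreeAt r f g x)
    (hf : f =ᶠ[𝓝 x] f') (hg : g =ᶠ[𝓝 x] g') : AgreeAt r f' g' x := by
  intro j hj
  rw [← hf.iteratedFDeriv ℝ j |>.eq_of_nhds, ← hg.iteratedFDeriv ℝ j |>.eq_of_nhds]
  exact h j hj

/-- Agreement can be tested on a family of linear maps which separates points. -/
lemma AgreeAt.of_clm {r : ℕ} {f g : V → W} {x : V} {ι : Type*} (L : ι → W →L[ℝ] X)
    (hL : ∀ w w', (∀ i, L i w = L i w') → w = w') (hf : ContDiffAt ℝ ∞ f x)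
    (hg : ContDiffAt ℝ ∞ g x) (h : ∀ i, AgreeAt r (L i ∘ f) (L i ∘ g) x) : AgreeAt r f g x := by
  intro j hj
  have hle : ((j : ℕ∞) : WithTop ℕ∞) ≤ ∞ := by exact_mod_cast le_top
  ext v
  refine hL _ _ fun i => ?_
  have := congrArg (fun T => T v) (h i j hj)
  simpa [(L i).iteratedFDeriv_comp_left hf hle, (L i).iteratedFDeriv_comp_left hg hle] using this

lemma agreeAt_of_pdMulti {n r : ℕ} {f g : Coord n → ℝ} {s : Set (Coord n)} (hs : IsOpen s)
    (hf : ContDiffOn ℝ ∞ f s) (hg : ContDiffOn ℝ ∞ g s) {y : Coord n} (hy : y ∈ s)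
    (h : ∀ I : Multiset (Fin n), I.card ≤ r → pdMulti I f y = pdMulti I g y) :
    AgreeAt r f g y := by
  intro j hj
  refine ContinuousMultilinearMap.toMultilinearMap_injective ?_
  refine Module.Basis.ext_multilinear (fun _ => (EuclideanSpace.basisFun (Fin n) ℝ).toBasis)
    fun v => ?_
  have key : ∀ {f : Coord n → ℝ}, ContDiffOn ℝ ∞ f s →
      iteratedFDeriv ℝ j f y (fun a => EuclideanSpace.single (v a) (1 : ℝ)) =
        pdMulti ((List.ofFn v : List (Fin n)) : Multiset (Fin n)) f y := by
    intro f hf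
    rw [pdMulti_eqOn_foldr hs hf _ hy, foldr_pd_eq_iteratedFDeriv hs hf _ y hy]
    -- the length of `List.ofFn v` is only propositionally equal to `j`
    have : ∀ (N : ℕ) (hN : N = j) (w : Fin N → Fin n), (∀ a, w a = v (Fin.cast hN a)) →
        iteratedFDeriv ℝ j f y (fun a => EuclideanSpace.single (v a) (1 : ℝ)) =
          iteratedFDeriv ℝ N f y (fun a => EuclideanSpace.single (w a) (1 : ℝ)) := by
      rintro N rfl w hw
      simp [hw]
    exact this _ (by simp) _ (fun a => by simp [Fin.cast])
  simpa using (key hf).trans ((h _ (by simpa using hj)).trans (key hg).symm)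

lemma AgreeAt.pdMulti_eq {n r : ℕ} {f g : Coord n → ℝ} {s : Set (Coord n)} (hs : IsOpen s)
    (hf : ContDiffOn ℝ ∞ f s) (hg : ContDiffOn ℝ ∞ g s) {y : Coord n} (hy : y ∈ s)
    (h : AgreeAt r f g y) {I : Multiset (Fin n)} (hI : I.card ≤ r) :
    pdMulti I f y = pdMulti I g y := by
  induction I using Quotient.inductionOn with
  | h l =>
    change pdMulti (l : Multiset (Fin n)) f y = pdMulti (l : Multiset (Fin n)) g y
    rw [pdMulti_eqOn_foldr hs hf _ hy, pdMulti_eqOn_foldr hs hg _ hy,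
      foldr_pd_eq_iteratedFDeriv hs hf _ y hy, foldr_pd_eq_iteratedFDeriv hs hg _ y hy,
      h _ (by simpa using hI)]

end Agreement

/-! ### Functions with prescribed partial derivatives at a point -/

section Monomials

variable {n : ℕ}

/-- The monomial `(y - y₀)^K / K!`. -/
noncomputable def monomial (y₀ : Coord n) (K : Multiset (Fin n)) (y : Coord n) : ℝ :=
  ∏ i, (y i - y₀ i) ^ K.count i / (K.count i).factorial

lemma contDiff_monomial (y₀ : Coord n) (K : Multiset (Fin n)) :
    ContDiff ℝ ∞ (monomial y₀ K) := by
  unfold monomial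
  fun_prop

lemma pd_monomial (y₀ : Coord n) (K : Multiset (Fin n)) (i : Fin n) :
    pd i (monomial y₀ K) = if i ∈ K then monomial y₀ (K.erase i) else 0 := by
  classical
  funext y
  have hder : ∀ j : Fin n, HasFDerivAt
      (fun y : Coord n => (y j - y₀ j) ^ K.count j / (K.count j).factorial)
      (((K.count j : ℝ) * (y j - y₀ j) ^ (K.count j - 1) / (K.count j).factorial) •
        (EuclideanSpace.proj j : Coord n →L[ℝ] ℝ)) y := by
    intro j
    have h1 : HasFDerivAt (fun y : Coord n => y j - y₀ j)
        (EuclideanSpace.proj j : Coord n →L[ℝ] ℝ) y :=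
      (EuclideanSpace.proj j : Coord n →L[ℝ] ℝ).hasFDerivAt.sub_const _
    have h2 := ((hasDerivAt_pow (K.count j) (y j - y₀ j)).div_const
      ((K.count j).factorial : ℝ)).comp_hasFDerivAt y h1
    exact h2
  have hprod := HasFDerivAt.finsetProd (u := Finset.univ) (fun j _ => hder j)
  have : pd i (monomial y₀ K) y = (∏ j ∈ Finset.univ.erase i,
      (y j - y₀ j) ^ K.count j / (K.count j).factorial) *
      ((K.count i : ℝ) * (y i - y₀ i) ^ (K.count i - 1) / (K.count i).factorial) := by
    unfold pd monomial
    rw [hprod.fderiv]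
    simp only [sum_apply, smul_apply, PiLp.proj_apply, PiLp.single_apply, smul_eq_mul]
    rw [Finset.sum_eq_single i]
    · simp
    · intro j _ hj; simp [hj]
    · simp
  rw [this]
  split_ifs with hi
  · unfold monomial
    rw [← Finset.mul_prod_erase Finset.univ _ (Finset.mem_univ i), mul_comm]
    congr 1
    · obtain ⟨c, hc⟩ : ∃ c, K.count i = c + 1 :=
        Nat.exists_eq_succ_of_ne_zero (Multiset.count_ne_zero.2 hi)
      rw [Multiset.count_erase_self, hc, Nat.factorial_succ]
      have : ((c + 1 : ℕ) : ℝ) ≠ 0 := by positivity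
      have : (c.factorial : ℝ) ≠ 0 := by positivity
      push_cast
      field_simp
    · refine Finset.prod_congr rfl fun j hj => ?_
      rw [Multiset.count_erase_of_ne (Finset.ne_of_mem_erase hj)]
  · simp [Multiset.count_eq_zero.2 hi]

lemma foldr_pd_zero (l : List (Fin n)) : l.foldr pd (0 : Coord n → ℝ) = 0 := by
  induction l with
  | nil => rfl
  | cons i l ih => rw [List.foldr_cons, ih]; funext y; simp [pd]

lemma pdMulti_monomial_self (y₀ : Coord n) (J K : Multiset (Fin n)) :
    pdMulti J (monomial y₀ K) y₀ = if J = K then 1 else 0 := by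
  classical
  induction J using Multiset.induction_on generalizing K with
  | empty =>
    simp only [pdMulti_zero, monomial, sub_self]
    split_ifs with h
    · subst h; simp
    · obtain ⟨i, hi⟩ := Multiset.exists_mem_of_ne_zero (Ne.symm h)
      refine Finset.prod_eq_zero (Finset.mem_univ i) ?_
      rw [zero_pow (Multiset.count_ne_zero.2 hi), zero_div]
  | cons i J ih =>
    have h1 := pdMulti_add isOpen_univ (contDiff_monomial y₀ K).contDiffOn J {i} (mem_univ y₀)
    rw [Multiset.add_comm, Multiset.singleton_add] at h1
    have h2 : pdMulti {i} (monomial y₀ K) = pd i (monomial y₀ K) := by simp [pdMulti]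
    rw [h1, h2, pd_monomial]
    split_ifs with hi hJ hJ
    · rw [ih, if_pos]; rw [← hJ, Multiset.erase_cons_head]
    · rw [ih, if_neg]
      rintro rfl
      exact hJ (Multiset.cons_erase hi)
    · exact absurd (hJ ▸ Multiset.mem_cons_self i J) hi
    · have : pdMulti J (0 : Coord n → ℝ) = 0 := foldr_pd_zero _
      rw [this]; rfl

end Monomials

/-! ### Linearity of iterated partial derivatives -/

section Linearity

variable {n : ℕ} {s : Set (Coord n)}

lemma pdMulti_finsum (hs : IsOpen s) {ι : Type*} (t : Finset ι) (f : ι → Coord n → ℝ)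
    (a : ι → ℝ) (hf : ∀ i ∈ t, ContDiffOn ℝ ∞ (f i) s) (I : Multiset (Fin n)) :
    EqOn (pdMulti I (fun y => ∑ i ∈ t, a i * f i y)) (fun y => ∑ i ∈ t, a i * pdMulti I (f i) y)
      s := by
  have hsum : ContDiffOn ℝ ∞ (fun y => ∑ i ∈ t, a i * f i y) s :=
    ContDiffOn.sum fun i hi => contDiffOn_const.mul (hf i hi)
  induction I using Multiset.induction_on with
  | empty => intro y _; simp
  | cons i I ih =>
    refine (pdMulti_cons hs hsum i I).trans ((eqOn_pd hs ih i).trans fun y hy => ?_)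
    have hd : ∀ j ∈ t, DifferentiableAt ℝ (pdMulti I (f j)) y := fun j hj =>
      ((contDiffOn_pdMulti hs (hf j hj) I).contDiffAt (hs.mem_nhds hy)).differentiableAt (by simp)
    simp only [pd]
    rw [fderiv_fun_sum fun j hj => (hd j hj).const_mul _]
    simp only [sum_apply]
    refine Finset.sum_congr rfl fun j hj => ?_
    rw [fderiv_const_mul (hd j hj), pdMulti_cons hs (hf j hj) i I hy]
    rfl

end Linearity

/-! ### Local sections in an adapted chart -/

section Sections

variable {n m : ℕ}
variable {M : Type*} [TopologicalSpace M] [ChartedSpace (Coord n) M]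
variable {E : Type*} [TopologicalSpace E] [ChartedSpace (Coord n × Coord m) E]
variable {π : E → M}

/-- The coordinate expression `y ↦ (y, u(y))` of a map `s : M → E`. -/
def AdaptedChart.totalRep (c : AdaptedChart n m π) (s : M → E) (y : Coord n) :
    Coord n × Coord m :=
  c.total (s (c.base.symm y))

/-- The open set of base coordinates over which a local section stays in an adapted chart. -/
def AdaptedChart.domIn (c : AdaptedChart n m π) (s : LocalSection n m π) : Set (Coord n) :=
  c.base.target ∩ c.base.symm ⁻¹' (s.dom ∩ s.toFun ⁻¹' c.total.source)

variable (c c' : AdaptedChart n m π) (s s' : LocalSection n m π)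

lemma AdaptedChart.base_mem_target {e : E} (he : e ∈ c.total.source) :
    c.base (π e) ∈ c.base.target :=
  c.base.map_source (c.proj_mem e he)

lemma AdaptedChart.base_symm_base {e : E} (he : e ∈ c.total.source) :
    c.base.symm (c.base (π e)) = π e :=
  c.base.left_inv (c.proj_mem e he)

lemma AdaptedChart.fst_mem_target {z : Coord n × Coord m} (hz : z ∈ c.total.target) :
    z.1 ∈ c.base.target := by
  have h := c.fst_total _ (c.total.map_target hz)
  rw [c.total.right_inv hz] at h
  rw [h]
  exact c.base_mem_target (c.total.map_target hz)

lemma AdaptedChart.proj_total_symm {z : Coord n × Coord m} (hz : z ∈ c.total.target) :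
    π (c.total.symm z) = c.base.symm z.1 := by
  have h := c.fst_total _ (c.total.map_target hz)
  rw [c.total.right_inv hz] at h
  rw [h, c.base_symm_base (c.total.map_target hz)]

lemma AdaptedChart.mem_domIn {x : M} (hx : x ∈ s.dom) (h : s.toFun x ∈ c.total.source) :
    c.base x ∈ c.domIn s ∧ c.base.symm (c.base x) = x := by
  have h1 := c.base_mem_target h
  have h2 := c.base_symm_base h
  rw [s.isSection x hx] at h1 h2
  refine ⟨⟨h1, ?_⟩, h2⟩
  simp [h2, hx, h]

lemma AdaptedChart.fst_totalRep {y : Coord n} (hy : y ∈ c.domIn s) :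
    (c.totalRep s.toFun y).1 = y := by
  unfold AdaptedChart.totalRep
  rw [c.fst_total _ hy.2.2, s.isSection _ hy.2.1, c.base.right_inv hy.1]

lemma AdaptedChart.isOpen_domIn : IsOpen (c.domIn s) := by
  refine c.base.isOpen_inter_preimage_symm ?_
  exact s.smooth.continuousOn.isOpen_inter_preimage s.isOpen_dom c.total.open_source

lemma AdaptedChart.contDiffOn_totalRep :
    ContDiffOn ℝ ∞ (c.totalRep s.toFun) (c.domIn s) := by
  rw [← contMDiffOn_iff_contDiffOn]
  have h1 := contMDiffOn_of_mem_maximalAtlas c.total_mem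
  have h2 := contMDiffOn_symm_of_mem_maximalAtlas c.base_mem
  exact h1.comp (s.smooth.comp (h2.mono inter_subset_left) fun y hy => hy.2.1)
    fun y hy => hy.2.2

lemma AdaptedChart.contDiffOn_localRep (α : Fin m) :
    ContDiffOn ℝ ∞ (c.localRep s.toFun α) (c.domIn s) :=
  (EuclideanSpace.proj α : Coord m →L[ℝ] ℝ).contDiff.comp_contDiffOn
    (contDiff_snd.comp_contDiffOn (c.contDiffOn_totalRep s))

lemma AdaptedChart.agreeAt_totalRep {r : ℕ} {y : Coord n} (hy : y ∈ c.domIn s)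
    (hy' : y ∈ c.domIn s') (h : ∀ I : Multiset (Fin n), I.card ≤ r → ∀ α,
      pdMulti I (c.localRep s.toFun α) y = pdMulti I (c.localRep s'.toFun α) y) :
    AgreeAt r (c.totalRep s.toFun) (c.totalRep s'.toFun) y := by
  have hn := (c.isOpen_domIn s).mem_nhds hy
  have hn' := (c.isOpen_domIn s').mem_nhds hy'
  refine AgreeAt.of_clm (ι := Option (Fin m)) (X := Coord n × ℝ)
    (fun o => o.elim ((ContinuousLinearMap.inl ℝ _ _).comp (ContinuousLinearMap.fst ℝ _ _))
      (fun α => (ContinuousLinearMap.inr ℝ _ _).comp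
        ((EuclideanSpace.proj α : Coord m →L[ℝ] ℝ).comp (ContinuousLinearMap.snd ℝ _ _))))
    ?_ ((c.contDiffOn_totalRep s).contDiffAt hn) ((c.contDiffOn_totalRep s').contDiffAt hn') ?_
  · intro w w' hw
    refine Prod.ext ?_ ?_
    · simpa using hw none
    · ext α; simpa using hw (some α)
  · rintro (_ | α)
    · refine (AgreeAt.refl r (fun y => (y, (0 : ℝ))) y).congr ?_ ?_
      · filter_upwards [hn] with y' hy'
        simp [c.fst_totalRep s hy']
      · filter_upwards [hn'] with y' hy'
        simp [c.fst_totalRep s' hy']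
    · have := agreeAt_of_pdMulti ((c.isOpen_domIn s).inter (c.isOpen_domIn s'))
        ((c.contDiffOn_localRep s α).mono inter_subset_left)
        ((c.contDiffOn_localRep s' α).mono inter_subset_right) ⟨hy, hy'⟩ (fun I hI => h I hI α)
      have hc : ContDiff ℝ ∞ (fun t : ℝ => ((0 : Coord n), t)) := by fun_prop
      exact AgreeAt.comp (f := c.localRep s.toFun α) (f' := c.localRep s'.toFun α)
        ((c.contDiffOn_localRep s α).contDiffAt hn)
        ((c.contDiffOn_localRep s' α).contDiffAt hn') hc.contDiffAt hc.contDiffAt this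
        (AgreeAt.refl _ _ _)

lemma AdaptedChart.contDiffAt_baseChange {e : E} (h : e ∈ c.total.source)
    (h' : e ∈ c'.total.source) :
    ContDiffAt ℝ ∞ (fun y => c.base (c'.base.symm y)) (c'.base (π e)) := by
  rw [← contMDiffAt_iff_contDiffAt]
  refine ContMDiffAt.comp (I' := 𝓘(ℝ, Coord n)) (g := c.base) _ ?_
    (contMDiffAt_symm_of_mem_maximalAtlas c'.base_mem (c'.base_mem_target h'))
  rw [c'.base_symm_base h']
  exact contMDiffAt_of_mem_maximalAtlas c.base_mem (c.proj_mem e h)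

lemma AdaptedChart.contDiffAt_totalChange {e : E} (h : e ∈ c.total.source)
    (h' : e ∈ c'.total.source) :
    ContDiffAt ℝ ∞ (fun z => c'.total (c.total.symm z)) (c.total e) := by
  rw [← contMDiffAt_iff_contDiffAt]
  refine ContMDiffAt.comp (I' := 𝓘(ℝ, Coord n × Coord m)) (g := c'.total) _ ?_
    (contMDiffAt_symm_of_mem_maximalAtlas c.total_mem (c.total.map_source h))
  rw [c.total.left_inv h]
  exact contMDiffAt_of_mem_maximalAtlas c'.total_mem h'

lemma AdaptedChart.totalRep_eventuallyEq {x : M} (hx : x ∈ s.dom)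
    (h : s.toFun x ∈ c.total.source) (h' : s.toFun x ∈ c'.total.source) :
    (fun z => c'.total (c.total.symm z)) ∘ (c.totalRep s.toFun) ∘
      (fun y => c.base (c'.base.symm y)) =ᶠ[𝓝 (c'.base x)] c'.totalRep s.toFun := by
  obtain ⟨h1, h2⟩ := c'.mem_domIn s hx h'
  have hb := (c.contDiffAt_baseChange c' h h').continuousAt
  rw [s.isSection x hx] at hb
  have h3 := hb.preimage_mem_nhds (t := c.domIn s)
    (by rw [h2]; exact (c.isOpen_domIn s).mem_nhds (c.mem_domIn s hx h).1)
  have h4 : ∀ᶠ y in 𝓝 (c'.base x), c'.base.symm y ∈ c.base.source := by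
    refine (c'.base.continuousAt_symm h1.1).preimage_mem_nhds ?_
    rw [h2]
    refine c.base.open_source.mem_nhds ?_
    have := c.proj_mem _ h
    rwa [s.isSection x hx] at this
  filter_upwards [h3, h4] with y hy hy4
  simp only [Function.comp_apply, AdaptedChart.totalRep, c.base.left_inv hy4]
  have := hy.2.2
  simp only [mem_preimage, c.base.left_inv hy4] at this
  rw [c.total.left_inv this]

/-- Agreement of the derivatives up to order `r` in one adapted chart implies agreement in every
other one, since the coordinate expressions differ by composition with smooth maps. -/
lemma AdaptedChart.pdMulti_localRep_eq_of_chart {r : ℕ} {x : M} (hx : x ∈ s.dom)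
    (hx' : x ∈ s'.dom) (hxx : s.toFun x = s'.toFun x) (h : s.toFun x ∈ c.total.source)
    (h' : s.toFun x ∈ c'.total.source) (hpd : ∀ I : Multiset (Fin n), I.card ≤ r → ∀ α,
      pdMulti I (c.localRep s.toFun α) (c.base x) =
        pdMulti I (c.localRep s'.toFun α) (c.base x)) :
    ∀ I : Multiset (Fin n), I.card ≤ r → ∀ α,
      pdMulti I (c'.localRep s.toFun α) (c'.base x) =
        pdMulti I (c'.localRep s'.toFun α) (c'.base x) := by
  intro I hI α
  obtain ⟨hd, hbx⟩ := c.mem_domIn s hx h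
  obtain ⟨hd', -⟩ := c.mem_domIn s' hx' (hxx ▸ h)
  obtain ⟨he, hbx'⟩ := c'.mem_domIn s hx h'
  obtain ⟨he', -⟩ := c'.mem_domIn s' hx' (hxx ▸ h')
  have hS := (c.contDiffOn_totalRep s).contDiffAt ((c.isOpen_domIn s).mem_nhds hd)
  have hS' := (c.contDiffOn_totalRep s').contDiffAt ((c.isOpen_domIn s').mem_nhds hd')
  have hb := c.contDiffAt_baseChange c' h h'
  rw [s.isSection x hx] at hb
  have ht := c.contDiffAt_totalChange c' h h'
  have hval : (c.totalRep s.toFun) (c.base x) = c.total (s.toFun x) := by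
    simp only [AdaptedChart.totalRep, hbx]
  have a1 := c.agreeAt_totalRep s s' hd hd' hpd
  have a2 : AgreeAt r (c.totalRep s.toFun ∘ fun y => c.base (c'.base.symm y))
      (c.totalRep s'.toFun ∘ fun y => c.base (c'.base.symm y)) (c'.base x) :=
    AgreeAt.comp hb hb (by simpa only [hbx'] using hS) (by simpa only [hbx'] using hS')
      (AgreeAt.refl _ _ _) (by simpa only [hbx'] using a1)
  have hv2 : (c.totalRep s.toFun ∘ fun y => c.base (c'.base.symm y)) (c'.base x) =
      c.total (s.toFun x) := by
    simp only [Function.comp_apply, hbx', hval]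
  have b1 : ContDiffAt ℝ ∞ (c.totalRep s.toFun ∘ fun y => c.base (c'.base.symm y))
      (c'.base x) := ContDiffAt.comp _ (by simpa only [hbx'] using hS) hb
  have b2 : ContDiffAt ℝ ∞ (c.totalRep s'.toFun ∘ fun y => c.base (c'.base.symm y))
      (c'.base x) := ContDiffAt.comp _ (by simpa only [hbx'] using hS') hb
  have a3 := (AgreeAt.comp b1 b2 (by rw [hv2]; exact ht) (by rw [hv2]; exact ht) a2
    (AgreeAt.refl _ _ _)).congr (c.totalRep_eventuallyEq c' s hx h h')
    (c.totalRep_eventuallyEq c' s' hx' (hxx ▸ h) (hxx ▸ h'))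
  have hproj : ContDiff ℝ ∞ (fun z : Coord n × Coord m => z.2 α) :=
    (EuclideanSpace.proj α : Coord m →L[ℝ] ℝ).contDiff.comp contDiff_snd
  have a4 : AgreeAt r (c'.localRep s.toFun α) (c'.localRep s'.toFun α) (c'.base x) :=
    AgreeAt.comp ((c'.contDiffOn_totalRep s).contDiffAt ((c'.isOpen_domIn s).mem_nhds he))
      ((c'.contDiffOn_totalRep s').contDiffAt ((c'.isOpen_domIn s').mem_nhds he'))
      hproj.contDiffAt hproj.contDiffAt a3 (AgreeAt.refl _ _ _)
  exact a4.pdMulti_eq ((c'.isOpen_domIn s).inter (c'.isOpen_domIn s'))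
    ((c'.contDiffOn_localRep s α).mono inter_subset_left)
    ((c'.contDiffOn_localRep s' α).mono inter_subset_right) ⟨he, he'⟩ hI

/-- The local section with coordinate expression `y ↦ (y, v(y))`, `y ∈ B`. -/
def AdaptedChart.mkSection (B : Set (Coord n)) (hB : IsOpen B) (v : Coord n → Coord m)
    (hv : ContDiffOn ℝ ∞ v B) (h : ∀ y ∈ B, (y, v y) ∈ c.total.target) :
    LocalSection n m π where
  toFun x := c.total.symm (c.base x, v (c.base x))
  dom := c.base.source ∩ c.base ⁻¹' B
  isOpen_dom := c.base.isOpen_inter_preimage hB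
  smooth := by
    have h1 := contMDiffOn_of_mem_maximalAtlas c.base_mem
    have h2 := contMDiffOn_symm_of_mem_maximalAtlas c.total_mem
    have h3 : ContMDiffOn 𝓘(ℝ, Coord n) 𝓘(ℝ, Coord n × Coord m) ∞
        (fun y => (y, v y)) B := (contDiffOn_id.prodMk hv).contMDiffOn
    exact h2.comp (h3.comp (h1.mono inter_subset_left) fun x hx => hx.2) fun x hx => h _ hx.2
  isSection x hx := by
    rw [c.proj_total_symm (h _ hx.2), c.base.left_inv hx.1]

variable {c} in
lemma AdaptedChart.mkSection_spec {B : Set (Coord n)} {hB : IsOpen B} {v : Coord n → Coord m}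
    {hv : ContDiffOn ℝ ∞ v B} {h : ∀ y ∈ B, (y, v y) ∈ c.total.target} {y : Coord n}
    (hy : y ∈ B) :
    c.base.symm y ∈ (c.mkSection B hB v hv h).dom ∧ c.base (c.base.symm y) = y ∧
      (c.mkSection B hB v hv h).toFun (c.base.symm y) ∈ c.total.source ∧
      ∀ α, c.localRep (c.mkSection B hB v hv h).toFun α y = v y α := by
  have hyt := c.fst_mem_target (h y hy)
  have hr := c.base.right_inv hyt
  refine ⟨⟨c.base.map_target hyt, by simpa [hr] using hy⟩, hr, ?_, fun α => ?_⟩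
  · simp only [AdaptedChart.mkSection, hr]
    exact c.total.map_target (h y hy)
  · simp only [AdaptedChart.mkSection, AdaptedChart.localRep, hr, c.total.right_inv (h y hy)]

end Sections

/-! ### Jet coordinates -/

section Jets

variable {n m : ℕ}
variable {M : Type*} [TopologicalSpace M] [ChartedSpace (Coord n) M]
variable {E : Type*} [TopologicalSpace E] [ChartedSpace (Coord n × Coord m) E]
variable {π : E → M} {k : ℕ}

lemma Jet.exists_rep {r : ℕ∞} (θ : Jet n m π r) :
    ∃ (s : LocalSection n m π) (x : M) (hx : x ∈ s.dom), s.jet r x hx = θ := by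
  induction θ using Quotient.inductionOn with
  | h p => exact ⟨p.1.2, p.1.1, p.2, rfl⟩

lemma LocalSection.pt_jet {r : ℕ∞} (s : LocalSection n m π) {x : M} (hx : x ∈ s.dom) :
    (s.jet r x hx).pt = s.toFun x := rfl

lemma LocalSection.down_jet (s : LocalSection n m π) {x : M} (hx : x ∈ s.dom) :
    (s.jet (k + 1 : ℕ) x hx).down = s.jet k x hx := rfl

lemma Jet.pt_down (θ : Jet n m π (k + 1 : ℕ)) : θ.down.pt = θ.pt := by
  obtain ⟨s, x, hx, rfl⟩ := θ.exists_rep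
  rfl

lemma AdaptedChart.coord_jet (c : AdaptedChart n m π) (s : LocalSection n m π) {x : M}
    (hx : x ∈ s.dom) (h : s.toFun x ∈ c.total.source) :
    c.coord (s.jet k x hx) = c.prolong k s.toFun (c.base x) := by
  unfold AdaptedChart.coord
  set p : PointedSection n m π := Quotient.out (s := jetSetoid n m π k) (s.jet k x hx) with hp
  have hrel : (jetSetoid n m π k).r p ⟨(x, s), hx⟩ := Quotient.mk_out (s := jetSetoid n m π k) _
  obtain ⟨h1, h2, h3⟩ := hrel
  change p.1.1 = x at h1
  change p.1.2.toFun p.1.1 = s.toFun x at h2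
  simp only [AdaptedChart.prolong]
  refine Prod.ext (by rw [h1]) ?_
  funext I α
  have := h3 c (h2 ▸ h) I.1 (by exact_mod_cast I.2) α
  exact (this.trans rfl)

/-- Equality of jets, which refers to all adapted charts, can be checked in a single one. -/
lemma LocalSection.jet_eq_of_chart (c : AdaptedChart n m π) {r : ℕ∞} (s s' : LocalSection n m π)
    {x : M} (hx : x ∈ s.dom) (hx' : x ∈ s'.dom) (h : s.toFun x ∈ c.total.source)
    (h' : s'.toFun x ∈ c.total.source)
    (hpd : ∀ I : Multiset (Fin n), (I.card : ℕ∞) ≤ r → ∀ α,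
      pdMulti I (c.localRep s.toFun α) (c.base x) =
        pdMulti I (c.localRep s'.toFun α) (c.base x)) :
    s.jet r x hx = s'.jet r x hx' := by
  have hb := (c.mem_domIn s hx h).2
  have hxx : s.toFun x = s'.toFun x := by
    refine c.total.injOn h h' (Prod.ext ?_ ?_)
    · rw [c.fst_total _ h, c.fst_total _ h', s.isSection x hx, s'.isSection x hx']
    · ext α
      have := hpd 0 (by simp) α
      simpa only [pdMulti_zero, AdaptedChart.localRep, hb] using this
  refine Quotient.sound (s := jetSetoid n m π r) ⟨rfl, hxx, fun c' hc' I hI α => ?_⟩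
  exact c.pdMulti_localRep_eq_of_chart c' s s' hx hx' hxx h hc' (r := I.card)
    (fun J hJ => hpd J (le_trans (by exact_mod_cast hJ) hI)) I le_rfl α

lemma AdaptedChart.coord_inj (c : AdaptedChart n m π) {θ θ' : Jet n m π k}
    (h : θ.pt ∈ c.total.source) (h' : θ'.pt ∈ c.total.source) (hc : c.coord θ = c.coord θ') :
    θ = θ' := by
  obtain ⟨s, x, hx, rfl⟩ := θ.exists_rep
  obtain ⟨s', x', hx', rfl⟩ := θ'.exists_rep
  rw [c.coord_jet s hx h, c.coord_jet s' hx' h'] at hc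
  have hb : c.base x = c.base x' := congrArg Prod.fst hc
  obtain rfl : x = x' := by
    rw [← (c.mem_domIn s hx h).2, hb, (c.mem_domIn s' hx' h').2]
  refine s.jet_eq_of_chart c s' hx hx' h h' fun I hI α => ?_
  exact congrFun (congrFun (congrArg Prod.snd hc) ⟨I, by exact_mod_cast hI⟩) α

/-- The coordinate expression `rep` does not depend on the choice in its definition, since jet
coordinates are injective. -/
lemma AdaptedChart.rep_coord (c : AdaptedChart n m π) {V : Type*} [Zero V]
    (f : Jet n m π k → V) {θ : Jet n m π k} (h : θ.pt ∈ c.total.source) :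
    c.rep f (c.coord θ) = f θ := by
  have hex : ∃ θ' : Jet n m π k, θ'.pt ∈ c.total.source ∧ c.coord θ' = c.coord θ := ⟨θ, h, rfl⟩
  simp only [AdaptedChart.rep, dif_pos hex]
  rw [c.coord_inj hex.choose_spec.1 h hex.choose_spec.2]

lemma AdaptedChart.coord_mem_jetTarget (c : AdaptedChart n m π) {θ : Jet n m π k}
    (h : θ.pt ∈ c.total.source) : c.coord θ ∈ c.jetTarget k := ⟨θ, h, rfl⟩

lemma AdaptedChart.coord_fst (c : AdaptedChart n m π) {θ : Jet n m π k}
    (h : θ.pt ∈ c.total.source) : (c.coord θ).1 = c.base (π θ.pt) := by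
  obtain ⟨s, x, hx, rfl⟩ := θ.exists_rep
  rw [c.coord_jet s hx h, s.pt_jet, s.isSection x hx]
  rfl

/-- The projection `J^{k+1} → J^k` in coordinates. -/
def truncCoord (z : JetCoord n m (k + 1)) : JetCoord n m k := (z.1, fun I => z.2 I.incl)

lemma AdaptedChart.coord_down (c : AdaptedChart n m π) {θ : Jet n m π (k + 1 : ℕ)}
    (h : θ.pt ∈ c.total.source) : c.coord θ.down = truncCoord (c.coord θ) := by
  obtain ⟨s, x, hx, rfl⟩ := θ.exists_rep
  rw [c.coord_jet s hx h, s.down_jet, c.coord_jet s hx h]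
  rfl

/-- The empty multi-index. -/
def MIdx.nil : MIdx n k := ⟨0, by simp⟩

/-- The coordinates of the underlying point of `E`. -/
def JetCoord.pt (z : JetCoord n m k) : Coord n × Coord m :=
  (z.1, WithLp.toLp 2 (z.2 MIdx.nil))

lemma AdaptedChart.total_pt (c : AdaptedChart n m π) {θ : Jet n m π k}
    (h : θ.pt ∈ c.total.source) : c.total θ.pt = JetCoord.pt (c.coord θ) := by
  refine Prod.ext ?_ ?_
  · rw [c.fst_total _ h]; exact (c.coord_fst h).symm
  · obtain ⟨s, x, hx, rfl⟩ := θ.exists_rep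
    rw [c.coord_jet s hx h]
    ext α
    simp [JetCoord.pt, AdaptedChart.prolong, MIdx.nil, AdaptedChart.localRep, s.pt_jet,
      (c.mem_domIn s hx h).2]

lemma continuous_jetCoord_pt : Continuous (JetCoord.pt : JetCoord n m k → _) := by
  unfold JetCoord.pt
  fun_prop

/-- The jet coordinates take all values over the domain of the chart: every family of prescribed
derivatives is attained, namely by a polynomial section. -/
lemma AdaptedChart.mem_jetTarget_iff (c : AdaptedChart n m π) {z : JetCoord n m k} :
    z ∈ c.jetTarget k ↔ JetCoord.pt z ∈ c.total.target := by
  constructor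
  · rintro ⟨θ, h, rfl⟩
    rw [← c.total_pt h]
    exact c.total.map_source h
  · intro hz
    let v : Coord n → Coord m := fun y => WithLp.toLp 2 fun α =>
      ∑ I : MIdx n k, z.2 I α * monomial z.1 I.1 y
    have hv : ContDiff ℝ ∞ v := by
      refine (contDiff_piLp 2).2 fun α => ?_
      exact ContDiff.sum fun I _ => contDiff_const.mul (contDiff_monomial _ _)
    have hvpd : ∀ (J : MIdx n k) (α : Fin m), pdMulti J.1 (fun y => v y α) z.1 = z.2 J α := by
      intro J α
      have := pdMulti_finsum isOpen_univ (Finset.univ : Finset (MIdx n k))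
        (fun I => monomial z.1 I.1) (fun I => z.2 I α)
        (fun I _ => (contDiff_monomial _ _).contDiffOn) J.1 (mem_univ z.1)
      refine this.trans ?_
      simp only [pdMulti_monomial_self]
      rw [Finset.sum_eq_single J]
      · simp
      · intro I _ hI
        rw [if_neg fun h => hI (Subtype.ext h).symm, mul_zero]
      · simp
    have hv0 : v z.1 = WithLp.toLp 2 (z.2 MIdx.nil) := by
      ext α
      have := hvpd MIdx.nil α
      simpa [MIdx.nil] using this
    let B : Set (Coord n) := (fun y => (y, v y)) ⁻¹' c.total.target
    have hB : IsOpen B :=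
      c.total.open_target.preimage (continuous_id.prodMk hv.continuous)
    have hzB : z.1 ∈ B := by
      change (z.1, v z.1) ∈ c.total.target
      rw [hv0]; exact hz
    let s := c.mkSection B hB v hv.contDiffOn (fun y hy => hy)
    obtain ⟨h1, h2, h3, -⟩ := AdaptedChart.mkSection_spec (c := c) (hB := hB) (v := v)
      (hv := hv.contDiffOn) (h := fun y hy => hy) hzB
    refine ⟨s.jet k _ h1, h3, ?_⟩
    rw [c.coord_jet s h1 h3, h2]
    refine Prod.ext rfl ?_
    funext J α
    rw [← hvpd J α]
    refine pdMulti_congr ?_ _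
    filter_upwards [hB.mem_nhds hzB] with y hy
    exact (AdaptedChart.mkSection_spec (c := c) (hB := hB) (v := v)
      (hv := hv.contDiffOn) (h := fun y hy => hy) hy).2.2.2 α

lemma AdaptedChart.isOpen_jetTarget (c : AdaptedChart n m π) : IsOpen (c.jetTarget k) := by
  have : c.jetTarget k = JetCoord.pt ⁻¹' c.total.target := by
    ext z; exact c.mem_jetTarget_iff
  rw [this]
  exact c.total.open_target.preimage continuous_jetCoord_pt

lemma AdaptedChart.truncCoord_mem_jetTarget_iff (c : AdaptedChart n m π)
    {z : JetCoord n m (k + 1)} : truncCoord z ∈ c.jetTarget k ↔ z ∈ c.jetTarget (k + 1) := by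
  rw [c.mem_jetTarget_iff, c.mem_jetTarget_iff]
  rfl

end Jets

/-! ### The Frobenius theorem -/

section Frobenius

variable {V Z : Type*} [NormedAddCommGroup V] [NormedSpace ℝ V] [NormedAddCommGroup Z]
  [NormedSpace ℝ Z]

/-- An integral curve on `[0, 1]` of a Lipschitz vector field which is bounded by the radius of the
ball on which it is given; the curve stays in that ball. -/
lemma exists_integralCurve_mem_closedBall [CompleteSpace Z] {f : Z → Z} {z₀ : Z} {a K : NNReal}
    (hb : ∀ z ∈ Metric.closedBall z₀ a, ‖f z‖ ≤ a)
    (hl : LipschitzOnWith K f (Metric.closedBall z₀ a)) :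
    ∃ w : ℝ → Z, w 0 = z₀ ∧ (∀ t, w t ∈ Metric.closedBall z₀ a) ∧
      ∀ t ∈ Icc (0 : ℝ) 1, HasDerivWithinAt w (f (w t)) (Icc 0 1) t := by
  have hf : IsPicardLindelof (fun _ => f) (⟨0, by simp⟩ : Icc (0 : ℝ) 1) z₀ a 0 a K :=
    IsPicardLindelof.of_time_independent hb hl (by simp)
  have hx : z₀ ∈ Metric.closedBall z₀ ((0 : NNReal) : ℝ) := by simp
  obtain ⟨w, hw⟩ := ODE.FunSpace.exists_isFixedPt_next hf hx
  -- `compProj` extends the curve by constants outside `[0, 1]`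
  refine ⟨w.compProj, ?_, fun t => w.compProj_mem_closedBall hf.mul_max_le, fun t ht => ?_⟩
  · have : w.compProj ((⟨0, by simp⟩ : Icc (0 : ℝ) 1) : ℝ) = z₀ := by
      rw [ODE.FunSpace.compProj_val, ← hw, ODE.FunSpace.next_apply₀]
    exact this
  · refine (ODE.hasDerivWithinAt_picard_Icc (f := fun _ => f) (left_mem_Icc.2 zero_le_one)
      hf.continuousOn_uncurry w.continuous_compProj.continuousOn
      (fun _ _ => w.compProj_mem_closedBall hf.mul_max_le)
      z₀ ht).congr_of_mem ?_ ht
    intro t' ht'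
    nth_rw 1 [← hw]
    rw [ODE.FunSpace.compProj_of_mem ht', ODE.FunSpace.next_apply]

/-- For solutions of `w' = P(w) y` and `w' = P(w) (y + h)` with the same initial value, flatness of
`P` makes `w_y + t P(w_y) h` an approximate solution of the second equation up to `O(‖h‖²)`, so
that Grönwall's inequality gives the derivative of the end point. -/
lemma norm_endpoint_sub_le {P : Z → V →L[ℝ] Z} {B : Set Z} {C : NNReal} {ρ : ℝ} {y h : V}
    (hPd : ∀ z ∈ B, DifferentiableAt ℝ P z) (hP : ∀ z ∈ B, ‖P z‖ ≤ C)
    (hP' : ∀ z ∈ B, ‖fderiv ℝ P z‖ ≤ C) (hl : LipschitzOnWith C P B)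
    (hl' : LipschitzOnWith C (fderiv ℝ P) B)
    (hflat : ∀ z ∈ B, fderiv ℝ P z (P z y) h = fderiv ℝ P z (P z h) y)
    (hyh : ‖y + h‖ ≤ ρ) {w w' : ℝ → Z}
    (hw : ∀ t ∈ Icc (0 : ℝ) 1, HasDerivWithinAt w (P (w t) y) (Icc 0 1) t)
    (hw' : ∀ t ∈ Icc (0 : ℝ) 1, HasDerivWithinAt w' (P (w' t) (y + h)) (Icc 0 1) t)
    (hwB : ∀ t, ∀ z, ‖z - w t‖ ≤ C * ‖h‖ → z ∈ B) (hw'B : ∀ t, w' t ∈ B)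
    (h0 : w 0 = w' 0) :
    ‖w' 1 - w 1 - P (w 1) h‖ ≤ gronwallBound 0 (C * ρ) 1 1 * (C ^ 2 + C ^ 3 * ρ) * ‖h‖ ^ 2 := by
  have hρ : 0 ≤ ρ := (norm_nonneg _).trans hyh
  have hwB0 : ∀ t, w t ∈ B := fun t => hwB t _ (by simp; positivity)
  set f : ℝ → Z := fun t => w t + t • P (w t) h with hf
  set f' : ℝ → Z := fun t => P (w t) y + (P (w t) h + t • fderiv ℝ P (w t) (P (w t) y) h)
    with hf'
  have hder : ∀ t ∈ Icc (0 : ℝ) 1, HasDerivWithinAt f (f' t) (Icc 0 1) t := by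
    intro t ht
    have h1 : HasDerivWithinAt (fun t => P (w t)) (fderiv ℝ P (w t) (P (w t) y)) (Icc 0 1) t :=
      (hPd _ (hwB0 t)).hasFDerivAt.comp_hasDerivWithinAt t (hw t ht)
    have h2 : HasDerivWithinAt (fun t => P (w t) h) (fderiv ℝ P (w t) (P (w t) y) h)
        (Icc 0 1) t := by
      simpa using h1.clm_apply (hasDerivWithinAt_const t (Icc (0 : ℝ) 1) h)
    have h3 := (hasDerivWithinAt_id t (Icc (0 : ℝ) 1)).smul h2
    refine (hw t ht).add (h3.congr_deriv ?_)
    simp [add_comm]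
  have hfw : ∀ t ∈ Icc (0 : ℝ) 1, ‖f t - w t‖ ≤ C * ‖h‖ := by
    intro t ht
    simp only [hf, add_sub_cancel_left, norm_smul, Real.norm_eq_abs, abs_of_nonneg ht.1]
    calc t * ‖P (w t) h‖ ≤ 1 * (C * ‖h‖) := by
          gcongr
          · exact ht.2
          · exact ((P (w t)).le_opNorm h).trans (by gcongr; exact hP _ (hwB0 t))
      _ = C * ‖h‖ := one_mul _
  have hbound : ∀ t ∈ Icc (0 : ℝ) 1,
      dist (f' t) (P (f t) (y + h)) ≤ (C ^ 2 + C ^ 3 * ρ) * ‖h‖ ^ 2 := by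
    intro t ht
    have hseg : segment ℝ (w t) (f t) ⊆ B := by
      intro z hz
      refine hwB t z (le_trans ?_ (hfw t ht))
      rw [segment_eq_image'] at hz
      obtain ⟨θ, hθ, rfl⟩ := hz
      rw [add_sub_cancel_left, norm_smul, Real.norm_eq_abs, abs_of_nonneg hθ.1]
      exact mul_le_of_le_one_left (norm_nonneg _) hθ.2
    have hrem : ‖P (f t) - P (w t) - fderiv ℝ P (w t) (f t - w t)‖ ≤
        (C * (C * ‖h‖)) * (C * ‖h‖) := by
      refine ((convex_segment (w t) (f t)).norm_image_sub_le_of_norm_fderiv_le'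
        (C := C * (C * ‖h‖)) (fun z hz => hPd z (hseg hz)) ?_ (left_mem_segment ℝ _ _)
        (right_mem_segment ℝ _ _)).trans (by gcongr; exact hfw t ht)
      intro z hz
      refine (hl'.norm_sub_le (hseg hz) (hwB0 t)).trans ?_
      gcongr
      rw [segment_eq_image'] at hz
      obtain ⟨θ, hθ, rfl⟩ := hz
      rw [add_sub_cancel_left, norm_smul, Real.norm_eq_abs, abs_of_nonneg hθ.1]
      exact (mul_le_of_le_one_left (norm_nonneg _) hθ.2).trans (hfw t ht)
    -- by flatness the terms of first order in `h` cancel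
    have hid : f' t - P (f t) (y + h) = -(t • fderiv ℝ P (w t) (P (w t) h) h) -
        (P (f t) - P (w t) - fderiv ℝ P (w t) (f t - w t)) (y + h) := by
      have hft : f t - w t = t • P (w t) h := by simp [hf]
      rw [hft]
      simp only [hf', hflat _ (hwB0 t), map_smul, sub_apply, map_add, smul_apply]
      abel
    rw [dist_eq_norm, hid]
    have e1 : ‖t • fderiv ℝ P (w t) (P (w t) h) h‖ ≤ C * (C * ‖h‖) * ‖h‖ := by
      rw [norm_smul, Real.norm_eq_abs, abs_of_nonneg ht.1]
      refine (mul_le_of_le_one_left (norm_nonneg _) ht.2).trans ?_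
      refine (ContinuousLinearMap.le_opNorm _ _).trans ?_
      gcongr
      refine (ContinuousLinearMap.le_opNorm _ _).trans ?_
      gcongr
      · exact hP' _ (hwB0 t)
      · exact (ContinuousLinearMap.le_opNorm _ _).trans (by gcongr; exact hP _ (hwB0 t))
    have e2 : ‖(P (f t) - P (w t) - fderiv ℝ P (w t) (f t - w t)) (y + h)‖ ≤
        (C * (C * ‖h‖)) * (C * ‖h‖) * ρ :=
      (ContinuousLinearMap.le_opNorm _ _).trans (by gcongr)
    calc _ ≤ _ := norm_sub_le _ _
      _ ≤ C * (C * ‖h‖) * ‖h‖ + (C * (C * ‖h‖)) * (C * ‖h‖) * ρ := by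
          rw [norm_neg]; exact add_le_add e1 e2
      _ = _ := by ring
  have hright : ∀ {g : ℝ → Z} {g' : Z} {t : ℝ}, t ∈ Ico (0 : ℝ) 1 →
      HasDerivWithinAt g g' (Icc 0 1) t → HasDerivWithinAt g g' (Ici t) t := by
    intro g g' t ht hg
    exact hg.mono_of_mem_nhdsWithin (Icc_mem_nhdsGE_of_mem ht)
  have hρC : ((C * ρ.toNNReal : NNReal) : ℝ) = C * ρ := by simp [hρ]
  have hgr := dist_le_of_approx_trajectories_ODE_of_mem (v := fun _ z => P z (y + h))
    (s := fun _ => B) (K := C * ρ.toNNReal) (f := f) (f' := f') (g := w')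
    (g' := fun t => P (w' t) (y + h)) (a := 0) (b := 1) (δ := 0)
    (εf := (C ^ 2 + C ^ 3 * ρ) * ‖h‖ ^ 2) (εg := 0)
    (fun t _ => by
      refine LipschitzOnWith.of_dist_le_mul fun z hz z' hz' => ?_
      rw [dist_eq_norm, ← sub_apply, hρC, dist_eq_norm]
      calc _ ≤ ‖P z - P z'‖ * ‖y + h‖ := ContinuousLinearMap.le_opNorm _ _
        _ ≤ (C * ‖z - z'‖) * ρ := by gcongr; exact hl.norm_sub_le hz hz'
        _ = _ := by ring)
    (fun t ht => (hder t ht).continuousWithinAt)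
    (fun t ht => hright ht (hder t (Ico_subset_Icc_self ht)))
    (fun t ht => hbound t (Ico_subset_Icc_self ht))
    (fun t ht => hwB t _ (hfw t (Ico_subset_Icc_self ht)))
    (fun t ht => (hw' t ht).continuousWithinAt)
    (fun t ht => hright ht (hw' t (Ico_subset_Icc_self ht)))
    (fun t _ => by simp) (fun t _ => hw'B t) (by simp [hf, h0]) 1 (by simp)
  -- Grönwall's bound is linear in the defect `ε`, which here is of order `‖h‖ ^ 2`
  have hlin : ∀ ε : ℝ, gronwallBound 0 (C * ρ) ε 1 = gronwallBound 0 (C * ρ) 1 1 * ε := by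
    intro ε
    unfold gronwallBound
    split_ifs <;> ring
  rw [hρC, add_zero, sub_zero, hlin, dist_comm, dist_eq_norm] at hgr
  have : w' 1 - w 1 - P (w 1) h = w' 1 - f 1 := by simp only [hf, one_smul]; abel
  rw [this, mul_assoc]
  exact hgr

/-- **Frobenius theorem**: a total differential equation `du = P(u)` whose right-hand side satisfies
the integrability condition has a local solution through every point. -/
theorem exists_hasFDerivAt_of_flat [CompleteSpace Z] {P : Z → V →L[ℝ] Z} {O : Set Z}
    (hO : IsOpen O) (hP : ContDiffOn ℝ ∞ P O)
    (hflat : ∀ z ∈ O, ∀ g h, fderiv ℝ P z (P z g) h = fderiv ℝ P z (P z h) g) {z₀ : Z}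
    (hz₀ : z₀ ∈ O) :
    ∃ ρ > 0, ∃ u : V → Z, u 0 = z₀ ∧
      ∀ y ∈ Metric.ball (0 : V) ρ, u y ∈ O ∧ HasFDerivAt u (P (u y)) y := by
  have hPz : ContDiffAt ℝ ∞ P z₀ := hP.contDiffAt (hO.mem_nhds hz₀)
  have hP'z : ContDiffAt ℝ ∞ (fderiv ℝ P) z₀ :=
    (hP.fderiv_of_isOpen hO (by simp)).contDiffAt (hO.mem_nhds hz₀)
  obtain ⟨K₁, s₁, hs₁, hl₁⟩ := (hPz.of_le (by simp)).exists_lipschitzOnWith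
  obtain ⟨K₂, s₂, hs₂, hl₂⟩ := (hP'z.of_le (by simp)).exists_lipschitzOnWith
  obtain ⟨R, hR, hRs⟩ := Metric.nhds_basis_closedBall.mem_iff.1
    (inter_mem (inter_mem hs₁ hs₂) (hO.mem_nhds hz₀))
  set B := Metric.closedBall z₀ R with hB
  have hz₀B : z₀ ∈ B := Metric.mem_closedBall_self hR.le
  lift R to NNReal using hR.le
  have hbd : ∀ {W : Type _} [NormedAddCommGroup W] {g : Z → W} {K : NNReal},
      LipschitzOnWith K g B → ∀ z ∈ B, ‖g z‖ ≤ ‖g z₀‖ + K * R := by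
    intro W _ g K hg z hz
    calc ‖g z‖ ≤ ‖g z₀‖ + ‖g z - g z₀‖ := norm_le_norm_add_norm_sub' _ _
      _ ≤ _ := by
        gcongr
        refine (hg.norm_sub_le hz hz₀B).trans ?_
        gcongr
        rwa [← mem_closedBall_iff_norm]
  have hl₁' := hl₁.mono fun z hz => (hRs hz).1.1
  have hl₂' := hl₂.mono fun z hz => (hRs hz).1.2
  -- `C` bounds `P` and its derivative on `B`, and is a Lipschitz constant for both
  set C : NNReal := (‖P z₀‖₊ + K₁ * R) + (‖fderiv ℝ P z₀‖₊ + K₂ * R) + K₁ + K₂ + 1 with hC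
  have hC0 : 0 < C := by positivity
  have hC1 : ‖P z₀‖ + K₁ * R ≤ C := by
    have : ‖P z₀‖₊ + K₁ * R ≤ C := by rw [hC]; simp only [add_assoc]; gcongr; simp
    exact_mod_cast this
  have hC2 : ‖fderiv ℝ P z₀‖ + K₂ * R ≤ C := by
    have : ‖fderiv ℝ P z₀‖₊ + K₂ * R ≤ C := by
      rw [hC]; simp only [add_assoc]
      exact le_add_left (le_add_left (by gcongr; simp))
    exact_mod_cast this
  have hCb : ∀ z ∈ B, ‖P z‖ ≤ C := fun z hz => (hbd hl₁' z hz).trans hC1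
  have hCb' : ∀ z ∈ B, ‖fderiv ℝ P z‖ ≤ C := fun z hz => (hbd hl₂' z hz).trans hC2
  have hL1 : LipschitzOnWith C P B := hl₁'.weaken (by
    rw [hC]; simp only [add_assoc]
    exact le_add_left (le_add_left (le_add_left (le_add_left (by simp)))))
  have hL2 : LipschitzOnWith C (fderiv ℝ P) B := hl₂'.weaken (by
    rw [hC]; exact le_add_right (le_add_left le_rfl))
  -- for `‖y‖ < ρ` the curves stay in the ball of radius `R / 2`, and the approximate solutions of
  -- `norm_endpoint_sub_le` in the ball of radius `R`
  set ρ : ℝ := R / (2 * C) with hρ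
  have hρ0 : 0 < ρ := by positivity
  have hCρ : C * ρ = R / 2 := by rw [hρ]; field_simp
  have hhalf : Metric.closedBall z₀ ((R / 2 : NNReal) : ℝ) ⊆ B :=
    Metric.closedBall_subset_closedBall (by push_cast; linarith)
  -- `w' = P(w) y` is the equation for the restriction `t ↦ u (t y)` of a solution `u` to a ray
  have hsol : ∀ y ∈ Metric.ball (0 : V) ρ, ∃ w : ℝ → Z, w 0 = z₀ ∧
      (∀ t, w t ∈ Metric.closedBall z₀ ((R / 2 : NNReal) : ℝ)) ∧
      ∀ t ∈ Icc (0 : ℝ) 1, HasDerivWithinAt w (P (w t) y) (Icc 0 1) t := by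
    intro y hy
    rw [mem_ball_zero_iff] at hy
    refine exists_integralCurve_mem_closedBall (f := fun z => P z y) (K := C * ‖y‖₊) ?_ ?_
    · intro z hz
      calc ‖P z y‖ ≤ C * ρ := ((P z).le_opNorm y).trans (by gcongr; exact hCb z (hhalf hz))
        _ = _ := by rw [hCρ]; simp
    · refine LipschitzOnWith.of_dist_le_mul fun z hz z' hz' => ?_
      rw [dist_eq_norm, ← sub_apply, dist_eq_norm]
      calc _ ≤ ‖P z - P z'‖ * ‖y‖ := ContinuousLinearMap.le_opNorm _ _
        _ ≤ (C * ‖z - z'‖) * ‖y‖ := by gcongr; exact hL1.norm_sub_le (hhalf hz) (hhalf hz')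
        _ = _ := by rw [NNReal.coe_mul, coe_nnnorm]; ring
  choose! w hw0 hwB hw using hsol
  refine ⟨ρ, hρ0, fun y => w y 1, ?_, fun y hy => ⟨(hRs (hhalf (hwB y hy 1))).2, ?_⟩⟩
  · -- for `y = 0` the curve is constant
    have h0 : (0 : V) ∈ Metric.ball (0 : V) ρ := Metric.mem_ball_self hρ0
    have := constant_of_has_deriv_right_zero (f := w 0) (a := 0) (b := 1)
      (fun t ht => (hw 0 h0 t ht).continuousWithinAt) (fun t ht => by
        have := hw 0 h0 t (Ico_subset_Icc_self ht)
        rw [map_zero] at this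
        exact this.mono_of_mem_nhdsWithin (Icc_mem_nhdsGE_of_mem ht)) 1 (by simp)
    exact this.trans (hw0 0 h0)
  · rw [hasFDerivAt_iff_isLittleO_nhds_zero]
    have hO2 : (fun h => w (y + h) 1 - w y 1 - P (w y 1) h) =O[𝓝 0] fun h : V => ‖h‖ ^ 2 := by
      refine Asymptotics.IsBigO.of_bound
        (gronwallBound 0 (C * ρ) 1 1 * (C ^ 2 + C ^ 3 * ρ)) ?_
      have h1 : ∀ᶠ h in 𝓝 (0 : V), y + h ∈ Metric.ball (0 : V) ρ := by
        have : Tendsto (fun h : V => y + h) (𝓝 0) (𝓝 y) := by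
          simpa using (continuous_const_add y).tendsto 0
        exact this.eventually (Metric.isOpen_ball.mem_nhds hy)
      filter_upwards [h1, Metric.ball_mem_nhds (0 : V) hρ0] with h hyh hh
      have hyh' := hyh
      rw [mem_ball_zero_iff] at hyh' hh
      rw [norm_pow, norm_norm]
      refine norm_endpoint_sub_le (B := B) (fun z hz => (hP.contDiffAt
        (hO.mem_nhds (hRs hz).2)).differentiableAt (by simp)) hCb hCb' hL1 hL2
        (fun z hz => hflat z (hRs hz).2 y h) hyh'.le (hw y hy) (hw _ hyh) ?_
        (fun t => hhalf (hwB _ hyh t)) (by rw [hw0 y hy, hw0 _ hyh])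
      intro t z hz
      have h2 := hwB y hy t
      rw [mem_closedBall_iff_norm] at h2 ⊢
      push_cast at h2
      have h3 : ‖z - z₀‖ ≤ ‖z - w y t‖ + ‖w y t - z₀‖ := norm_sub_le_norm_sub_add_norm_sub ..
      have h4 : C * ‖h‖ ≤ C * ρ := by gcongr
      linarith
    refine hO2.trans_isLittleO ?_
    have := Asymptotics.isLittleO_norm_pow_id (E' := V) one_lt_two
    exact this

/-- Solutions of `du = P(u)` are as smooth as `P`. -/
lemma contDiffOn_of_hasFDerivAt_comp {P : Z → V →L[ℝ] Z} {O : Set Z} (hP : ContDiffOn ℝ ∞ P O)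
    {u : V → Z} {s : Set V} (hs : IsOpen s)
    (hu : ∀ y ∈ s, u y ∈ O ∧ HasFDerivAt u (P (u y)) y) : ContDiffOn ℝ ∞ u s := by
  refine contDiffOn_infty.2 fun N => ?_
  induction N with
  | zero => exact contDiffOn_zero.2 fun y hy => (hu y hy).2.continuousAt.continuousWithinAt
  | succ N ih =>
    refine (contDiffOn_succ_iff_fderiv_of_isOpen (n := N) hs).2
      ⟨fun y hy => (hu y hy).2.differentiableAt.differentiableWithinAt, by simp, ?_⟩
    refine ((hP.of_le (by exact_mod_cast le_top)).comp ih fun y hy => (hu y hy).1).congr ?_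
    intro y hy
    rw [(hu y hy).2.fderiv]
    rfl

end Frobenius

/-! ### Constant sections of a flat holonomic connection -/

section ConstantSections

variable {n m : ℕ}
variable {M : Type*} [TopologicalSpace M] [ChartedSpace (Coord n) M]
variable {E : Type*} [TopologicalSpace E] [ChartedSpace (Coord n × Coord m) E]
variable {π : E → M} {k : ℕ}

lemma fderiv_eq_sum_pd {f : Coord n → ℝ} {y : Coord n} (h : Coord n) :
    fderiv ℝ f y h = ∑ i, pd i f y * h i := by
  have : h = ∑ i, h i • EuclideanSpace.single i (1 : ℝ) := by
    ext j; simp [Pi.single_apply]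
  conv_lhs => rw [this]
  simp only [map_sum, map_smul, smul_eq_mul, pd, mul_comm]

lemma rPlane_apply (z : JetCoord n m (k + 1)) (h : Coord n) :
    rPlane z h = (h, fun I α => ∑ i, z.2 (MIdx.cons i I) α * h i) := by
  refine Prod.ext rfl ?_
  funext I α
  simp [rPlane]

lemma rPlane_single (z : JetCoord n m (k + 1)) (i : Fin n) :
    rPlane z (EuclideanSpace.single i 1) = (EuclideanSpace.single i 1,
      fun I α => z.2 (MIdx.cons i I) α) := by
  rw [rPlane_apply]
  refine Prod.ext rfl ?_
  funext I α
  simp [PiLp.single_apply]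

lemma contDiff_rPlane : ContDiff ℝ ∞ (rPlane : JetCoord n m (k + 1) → _) := by
  rw [contDiff_clm_apply_iff]
  intro h
  simp only [rPlane_apply]
  fun_prop

lemma AdaptedChart.contDiffOn_prolong (c : AdaptedChart n m π) (s : LocalSection n m π) (r : ℕ) :
    ContDiffOn ℝ ∞ (c.prolong r s.toFun) (c.domIn s) :=
  contDiffOn_id.prodMk (contDiffOn_pi.2 fun I => contDiffOn_pi.2 fun α =>
    contDiffOn_pdMulti (c.isOpen_domIn s) (c.contDiffOn_localRep s α) I.1)

lemma AdaptedChart.fderiv_prolong (c : AdaptedChart n m π) (s : LocalSection n m π)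
    {y : Coord n} (hy : y ∈ c.domIn s) :
    fderiv ℝ (c.prolong k s.toFun) y = rPlane (c.prolong (k + 1) s.toFun y) := by
  have hd : ∀ (I : Multiset (Fin n)) (α : Fin m),
      DifferentiableAt ℝ (pdMulti I (c.localRep s.toFun α)) y := fun I α =>
    ((contDiffOn_pdMulti (c.isOpen_domIn s) (c.contDiffOn_localRep s α) I).contDiffAt
      ((c.isOpen_domIn s).mem_nhds hy)).differentiableAt (by simp)
  have h1 : HasFDerivAt (c.prolong k s.toFun) ((ContinuousLinearMap.id ℝ (Coord n)).prod
      (ContinuousLinearMap.pi fun I : MIdx n k => ContinuousLinearMap.pi fun α =>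
        fderiv ℝ (pdMulti I.1 (c.localRep s.toFun α)) y)) y :=
    (hasFDerivAt_id y).prodMk (hasFDerivAt_pi.2 fun I => hasFDerivAt_pi.2 fun α =>
      (hd I.1 α).hasFDerivAt)
  rw [h1.fderiv]
  ext1 h
  rw [rPlane_apply]
  refine Prod.ext rfl ?_
  funext I α
  simp only [ContinuousLinearMap.prod_apply, ContinuousLinearMap.coe_pi']
  rw [fderiv_eq_sum_pd]
  refine Finset.sum_congr rfl fun i _ => ?_
  rw [← pdMulti_cons (c.isOpen_domIn s) (c.contDiffOn_localRep s α) i I.1 hy]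
  rfl

open Classical in
/-- The map `j_k s`, extended by a constant outside the domain of `s`. -/
noncomputable def LocalSection.jetMap (s : LocalSection n m π) (θ₀ : Jet n m π k) (x : M) :
    Jet n m π k :=
  if hx : x ∈ s.dom then s.jet k x hx else θ₀

lemma LocalSection.jetMap_of_mem (s : LocalSection n m π) (θ₀ : Jet n m π k) {x : M}
    (hx : x ∈ s.dom) : s.jetMap θ₀ x = s.jet k x hx := dif_pos hx

lemma AdaptedChart.coord_jetMap_eventuallyEq (c : AdaptedChart n m π) (s : LocalSection n m π)
    (θ₀ : Jet n m π k) {x : M} (hx : x ∈ s.dom) (h : s.toFun x ∈ c.total.source) :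
    (fun y => c.coord (s.jetMap θ₀ (c.base.symm y))) =ᶠ[𝓝 (c.base x)] c.prolong k s.toFun := by
  filter_upwards [(c.isOpen_domIn s).mem_nhds (c.mem_domIn s hx h).1] with y hy
  rw [s.jetMap_of_mem θ₀ hy.2.1, c.coord_jet s hy.2.1 hy.2.2, c.base.right_inv hy.1]

namespace HolonomicConnection

variable (D : HolonomicConnection n m π k)

lemma pt_toFun (θ : Jet n m π k) : (D.toFun θ).pt = θ.pt := by
  rw [← Jet.pt_down, D.isSection]

/-- A section `s` with `∇ ∘ j_k s = j_{k+1} s` gives a `∇`-constant section `j_k s`. -/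
lemma isConstant_jetMap (s : LocalSection n m π) (θ₀ : Jet n m π k)
    (hs : ∀ x (hx : x ∈ s.dom), D.toFun (s.jet k x hx) = s.jet (k + 1 : ℕ) x hx) :
    D.IsConstant s.dom (s.jetMap θ₀) := by
  have hpt : ∀ x ∈ s.dom, (s.jetMap θ₀ x).pt = s.toFun x := fun x hx => by
    rw [s.jetMap_of_mem θ₀ hx, s.pt_jet]
  refine ⟨⟨s.isOpen_dom, fun x hx => by rw [hpt x hx, s.isSection x hx],
    s.smooth.continuousOn.congr fun x hx => hpt x hx, fun x hx c hc => ?_⟩, fun x hx c hc => ?_⟩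
  · rw [hpt x hx] at hc
    have h1 := (c.mem_domIn s hx hc).1
    exact ((c.contDiffOn_prolong s k).contDiffAt
      ((c.isOpen_domIn s).mem_nhds h1)).congr_of_eventuallyEq
        (c.coord_jetMap_eventuallyEq s θ₀ hx hc)
  · rw [hpt x hx] at hc
    rw [(c.coord_jetMap_eventuallyEq s θ₀ hx hc).fderiv_eq,
      c.fderiv_prolong s (c.mem_domIn s hx hc).1, s.jetMap_of_mem θ₀ hx, hs x hx,
      c.coord_jet s hx hc]

/-- The coordinate expression of `∇`. -/
noncomputable def coordRep (c : AdaptedChart n m π) : JetCoord n m k → JetCoord n m (k + 1) :=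
  c.rep fun θ => c.coord (D.toFun θ)

lemma coordRep_coord (c : AdaptedChart n m π) {θ : Jet n m π k} (h : θ.pt ∈ c.total.source) :
    D.coordRep c (c.coord θ) = c.coord (D.toFun θ) :=
  c.rep_coord _ h

lemma truncCoord_coordRep (c : AdaptedChart n m π) {z : JetCoord n m k}
    (hz : z ∈ c.jetTarget k) : truncCoord (D.coordRep c z) = z := by
  obtain ⟨θ, h, rfl⟩ := hz
  rw [D.coordRep_coord c h, ← c.coord_down (by rwa [D.pt_toFun]), D.isSection]

lemma coordRep_incl (c : AdaptedChart n m π) {z : JetCoord n m k}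
    (hz : z ∈ c.jetTarget k) (I : MIdx n k) : (D.coordRep c z).2 I.incl = z.2 I :=
  congrFun (congrArg Prod.snd (D.truncCoord_coordRep c hz)) I

lemma coordRep_mem_jetTarget (c : AdaptedChart n m π) {z : JetCoord n m k}
    (hz : z ∈ c.jetTarget k) : D.coordRep c z ∈ c.jetTarget (k + 1) := by
  rw [← c.truncCoord_mem_jetTarget_iff, D.truncCoord_coordRep c hz]; exact hz

lemma contDiffOn_rPlane_coordRep (c : AdaptedChart n m π) :
    ContDiffOn ℝ ∞ (fun z => rPlane (D.coordRep c z)) (c.jetTarget k) :=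
  contDiff_rPlane.comp_contDiffOn (D.smooth c)

/-- Vanishing of the curvature is the integrability condition of the total differential equation
`du = ∇(u)`. -/
lemma IsFlat.fderiv_rPlane_comm {D : HolonomicConnection n m π k} (hD : D.IsFlat)
    (c : AdaptedChart n m π) {z : JetCoord n m k} (hz : z ∈ c.jetTarget k) (g h : Coord n) :
    fderiv ℝ (fun z => rPlane (D.coordRep c z)) z (rPlane (D.coordRep c z) g) h =
      fderiv ℝ (fun z => rPlane (D.coordRep c z)) z (rPlane (D.coordRep c z) h) g := by
  have hdiff : DifferentiableAt ℝ (fun z => rPlane (D.coordRep c z)) z :=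
    ((D.contDiffOn_rPlane_coordRep c).contDiffAt
      (c.isOpen_jetTarget.mem_nhds hz)).differentiableAt (by simp)
  have key : ∀ (a : Coord n) (v : JetCoord n m k), fderiv ℝ (D.lift c fun _ => a) z v =
      fderiv ℝ (fun z => rPlane (D.coordRep c z)) z v a := by
    intro a v
    have : D.lift c (fun _ => a) = fun z => rPlane (D.coordRep c z) a := rfl
    rw [this, fderiv_clm_apply hdiff (differentiableAt_const a)]
    simp
  have h0 := hD c (fun _ => g) (fun _ => h) contDiff_const contDiff_const z hz
  have hlift0 : D.lift c (VectorField.lieBracket ℝ (fun _ => g) fun _ => h) z = 0 := by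
    simp [HolonomicConnection.lift, VectorField.lieBracket]
  rw [HolonomicConnection.curvature, hlift0, sub_zero, VectorField.lieBracket, key, key,
    sub_eq_zero] at h0
  exact h0

/-- A solution of `du = ∇(u)` in coordinates consists of the derivatives of its component `u_∅`,
since `∇` is holonomic. -/
lemma pdMulti_eq_of_solution (c : AdaptedChart n m π) {B : Set (Coord n)} (hB : IsOpen B)
    {u : Coord n → JetCoord n m k} (hu : ∀ y ∈ B, u y ∈ c.jetTarget k ∧
      HasFDerivAt u (rPlane (D.coordRep c (u y))) y) {f : Coord n → ℝ} {α : Fin m}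
    (hf : ∀ y ∈ B, f y = (u y).2 MIdx.nil α) :
    ∀ y ∈ B, ∀ K : MIdx n (k + 1), pdMulti K.1 f y = (D.coordRep c (u y)).2 K α := by
  have husm : ContDiffOn ℝ ∞ u B :=
    contDiffOn_of_hasFDerivAt_comp (D.contDiffOn_rPlane_coordRep c) hB hu
  have hcomp : ∀ I : MIdx n k, ContDiffOn ℝ ∞ (fun y => (u y).2 I α) B := fun I =>
    contDiffOn_pi.1 (contDiffOn_pi.1 (contDiff_snd.comp_contDiffOn husm) I) α
  have hfs : ContDiffOn ℝ ∞ f B := (hcomp MIdx.nil).congr hf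
  have hpd : ∀ (I : MIdx n k) (i : Fin n), ∀ y ∈ B, pd i (fun y => (u y).2 I α) y =
      (D.coordRep c (u y)).2 (MIdx.cons i I) α := by
    intro I i y hy
    have h1 := (hu y hy).2
    have h2 : HasFDerivAt (fun y => (u y).2 I α)
        (((ContinuousLinearMap.proj α).comp (ContinuousLinearMap.proj I)).comp
          ((ContinuousLinearMap.snd ℝ (Coord n) (MIdx n k → Fin m → ℝ)).comp
            (rPlane (D.coordRep c (u y))))) y :=
      (((ContinuousLinearMap.proj (R := ℝ) (φ := fun _ : Fin m => ℝ) α).comp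
        (ContinuousLinearMap.proj (R := ℝ) (φ := fun _ : MIdx n k => Fin m → ℝ) I)).comp
          (ContinuousLinearMap.snd ℝ (Coord n) (MIdx n k → Fin m → ℝ))).hasFDerivAt.comp y h1
    rw [pd, h2.fderiv]
    simp only [ContinuousLinearMap.comp_apply, rPlane_single]
    rfl
  have hle : ∀ (I : Multiset (Fin n)) (hI : I.card ≤ k),
      EqOn (pdMulti I f) (fun y => (u y).2 ⟨I, hI⟩ α) B := by
    intro I
    induction I using Multiset.induction_on with
    | empty => intro _ y hy; rw [pdMulti_zero]; exact hf y hy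
    | cons i I ih =>
      intro hI y hy
      have hI' : I.card ≤ k := by rw [Multiset.card_cons] at hI; omega
      rw [pdMulti_cons hB hfs i I hy, eqOn_pd hB (ih hI') i hy, hpd ⟨I, hI'⟩ i y hy]
      exact congrFun (D.coordRep_incl c (hu y hy).1 ⟨i ::ₘ I, hI⟩) α
  rintro y hy ⟨K, hK⟩
  rcases Nat.lt_or_ge k K.card with hlt | hge
  · obtain ⟨i, I, rfl⟩ : ∃ i I, K = i ::ₘ I :=
      Multiset.exists_cons_of_mem (Multiset.card_pos_iff_exists_mem.1 (by omega)).choose_spec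
        |>.elim fun I hI => ⟨_, I, hI⟩
    have hI' : I.card ≤ k := by rw [Multiset.card_cons] at hK; omega
    rw [pdMulti_cons hB hfs i I hy, eqOn_pd hB (hle I hI') i hy, hpd ⟨I, hI'⟩ i y hy]
    rfl
  · rw [hle K hge hy]
    exact (congrFun (D.coordRep_incl c (hu y hy).1 ⟨K, hge⟩) α).symm

/-- Through every jet passes a local `∇`-constant section, which is the prolongation of a local
section of `π`. -/
theorem IsFlat.exists_section {D : HolonomicConnection n m π k} (hD : D.IsFlat)
    (c : AdaptedChart n m π) {θ₀ : Jet n m π k} (hθ : θ₀.pt ∈ c.total.source) :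
    ∃ (s : LocalSection n m π) (x : M) (hx : x ∈ s.dom), s.jet k x hx = θ₀ ∧
      (∀ x' ∈ s.dom, s.toFun x' ∈ c.total.source) ∧
      ∀ x' (hx' : x' ∈ s.dom), D.toFun (s.jet k x' hx') = s.jet (k + 1 : ℕ) x' hx' := by
  set z₀ := c.coord θ₀ with hz₀
  obtain ⟨ρ, hρ, u, hu0, hu⟩ := exists_hasFDerivAt_of_flat c.isOpen_jetTarget
    (D.contDiffOn_rPlane_coordRep c) (fun z hz => hD.fderiv_rPlane_comm c hz)
    (c.coord_mem_jetTarget hθ)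
  set B := Metric.ball z₀.1 ρ with hB
  have hBo : IsOpen B := Metric.isOpen_ball
  -- the independent variable of `u` is the displacement from the base point of `θ₀`
  set U : Coord n → JetCoord n m k := fun y => u (y - z₀.1) with hU
  have hUd : ∀ y ∈ B, U y ∈ c.jetTarget k ∧ HasFDerivAt U (rPlane (D.coordRep c (U y))) y := by
    intro y hy
    have h1 := hu (y - z₀.1) (by rwa [mem_ball_zero_iff, ← mem_ball_iff_norm])
    exact ⟨h1.1, (hasFDerivAt_comp_sub z₀.1).2 h1.2⟩
  have hzB : z₀.1 ∈ B := Metric.mem_ball_self hρ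
  have hU0 : U z₀.1 = z₀ := by simp only [hU, sub_self, hu0]; rfl
  have hfst : ∀ y ∈ B, (U y).1 = y := by
    have hd : ∀ y ∈ B, HasFDerivAt (fun y => (U y).1 - y) (0 : Coord n →L[ℝ] Coord n) y := by
      intro y hy
      have := ((ContinuousLinearMap.fst ℝ (Coord n) (MIdx n k → Fin m → ℝ)).hasFDerivAt.comp y
        (hUd y hy).2).sub (hasFDerivAt_id y)
      refine this.congr_fderiv ?_
      ext1 h
      simp [rPlane_apply]
    intro y hy
    have := hBo.is_const_of_fderiv_eq_zero (convex_ball z₀.1 ρ).isPreconnected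
      (fun y hy => (hd y hy).differentiableAt.differentiableWithinAt)
      (fun y hy => (hd y hy).fderiv) hy hzB
    simpa [hU0, sub_eq_zero] using this
  have hUsm : ContDiffOn ℝ ∞ U B :=
    contDiffOn_of_hasFDerivAt_comp (D.contDiffOn_rPlane_coordRep c) hBo hUd
  set v : Coord n → Coord m := fun y => WithLp.toLp 2 ((U y).2 MIdx.nil) with hv
  have hvs : ContDiffOn ℝ ∞ v B := by
    refine (contDiffOn_piLp 2).2 fun α => ?_
    exact contDiffOn_pi.1 (contDiffOn_pi.1 (contDiff_snd.comp_contDiffOn hUsm) MIdx.nil) α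
  have hvt : ∀ y ∈ B, (y, v y) ∈ c.total.target := by
    intro y hy
    have := c.mem_jetTarget_iff.1 (hUd y hy).1
    rwa [JetCoord.pt, hfst y hy] at this
  set s := c.mkSection B hBo v hvs hvt with hs
  have hspec := fun (y : Coord n) (hy : y ∈ B) =>
    AdaptedChart.mkSection_spec (c := c) (hB := hBo) (hv := hvs) (h := hvt) hy
  have hpro1 : ∀ y ∈ B, c.prolong (k + 1) s.toFun y = D.coordRep c (U y) := by
    intro y hy
    refine Prod.ext ?_ ?_
    · have h1 := congrArg Prod.fst (D.truncCoord_coordRep c (hUd y hy).1)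
      exact ((hfst y hy).symm.trans h1.symm)
    · funext K α
      exact D.pdMulti_eq_of_solution c hBo hUd (fun y hy => (hspec y hy).2.2.2 α) y hy K
  have hpro : ∀ y ∈ B, c.prolong k s.toFun y = U y := by
    intro y hy
    have : c.prolong k s.toFun y = truncCoord (c.prolong (k + 1) s.toFun y) := rfl
    rw [this, hpro1 y hy, D.truncCoord_coordRep c (hUd y hy).1]
  have hsrc : ∀ x' ∈ s.dom, s.toFun x' ∈ c.total.source := by
    intro x' hx'
    exact c.total.map_target (hvt _ hx'.2)
  obtain ⟨h1, h2, h3, -⟩ := hspec z₀.1 hzB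
  refine ⟨s, c.base.symm z₀.1, h1, ?_, hsrc, ?_⟩
  · refine c.coord_inj h3 hθ ?_
    rw [c.coord_jet s h1 h3, h2, hpro _ hzB, hU0]
  · intro x' hx'
    have hxs := hsrc x' hx'
    refine c.coord_inj (by rwa [D.pt_toFun, s.pt_jet]) hxs ?_
    rw [← D.coordRep_coord (θ := s.jet k x' hx') c hxs, c.coord_jet s hx' hxs,
      c.coord_jet s hx' hxs, hpro1 _ hx'.2, hpro _ hx'.2]

end HolonomicConnection

end ConstantSections

/-! ### Level sets of submersions -/

section Submersions

variable {X Y : Type*} [NormedAddCommGroup X] [NormedSpace ℝ X] [FiniteDimensional ℝ X]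
  [NormedAddCommGroup Y] [NormedSpace ℝ Y]

/-- A map whose derivative at `x` is onto becomes a coordinate projection in suitable smooth local
coordinates, whose remaining components are linear. -/
lemma exists_straightening {G : X → Y} {x : X} (hG : ContDiffAt ℝ ∞ G x)
    (hs : Function.Surjective (fderiv ℝ G x)) :
    ∃ (p : X →L[ℝ] (fderiv ℝ G x).ker)
      (φ : OpenPartialHomeomorph X (Y × (fderiv ℝ G x).ker)),
      (∀ v : (fderiv ℝ G x).ker, p v = v) ∧ x ∈ φ.source ∧ (∀ x', φ x' = (G x', p x')) ∧
      ContDiffAt ℝ ∞ φ.symm (φ x) ∧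
      ∀ v, fderiv ℝ φ.symm (φ x) (fderiv ℝ G x v, p v) = v := by
  obtain ⟨p₀, hp₀⟩ := LinearMap.exists_leftInverse_of_injective
    (fderiv ℝ G x).ker.subtype (Submodule.ker_subtype _)
  set p : X →L[ℝ] (fderiv ℝ G x).ker := LinearMap.toContinuousLinearMap p₀ with hp
  have hpv : ∀ v : (fderiv ℝ G x).ker, p v = v := fun v => LinearMap.congr_fun hp₀ v
  have hbij : Function.Bijective ((fderiv ℝ G x).prod p) := by
    constructor
    · rw [injective_iff_map_eq_zero]
      intro v hv
      have h1 : fderiv ℝ G x v = 0 := congrArg Prod.fst hv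
      have h2 : p v = 0 := congrArg Prod.snd hv
      have h3 := hpv ⟨v, h1⟩
      rw [h2] at h3
      exact (congrArg Subtype.val h3).symm
    · rintro ⟨y, κ⟩
      obtain ⟨v, rfl⟩ := hs y
      refine ⟨v + ((κ - p v : (fderiv ℝ G x).ker) : X), Prod.ext ?_ ?_⟩
      · have : fderiv ℝ G x ((κ - p v : (fderiv ℝ G x).ker) : X) = 0 := (κ - p v).2
        change fderiv ℝ G x (v + _) = _
        rw [map_add, this, add_zero]
      · change p (v + _) = κ
        rw [map_add, hpv, add_sub_cancel]
  set e : X ≃L[ℝ] Y × (fderiv ℝ G x).ker :=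
    (LinearEquiv.ofBijective ((fderiv ℝ G x).prod p).toLinearMap hbij).toContinuousLinearEquiv
    with he
  have hev : ∀ v, e v = (fderiv ℝ G x v, p v) := fun v => rfl
  have hf : ContDiffAt ℝ ∞ (fun x' => (G x', p x')) x := hG.prodMk p.contDiff.contDiffAt
  have hf' : HasFDerivAt (fun x' => (G x', p x')) (e : X →L[ℝ] Y × (fderiv ℝ G x).ker) x :=
    (hG.differentiableAt (by simp)).hasFDerivAt.prodMk p.hasFDerivAt
  set φ := hf.toOpenPartialHomeomorph _ hf' (by simp) with hφ
  have hφc : ∀ x', φ x' = (G x', p x') := fun x' => rfl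
  have hx : x ∈ φ.source := hf.mem_toOpenPartialHomeomorph_source hf' (by simp)
  refine ⟨p, φ, hpv, hx, hφc, hf.to_localInverse hf' (by simp), fun v => ?_⟩
  have h1 : HasFDerivAt φ (e : X →L[ℝ] Y × (fderiv ℝ G x).ker) (φ.symm (φ x)) := by
    rw [φ.left_inv hx]; exact hf'
  rw [(φ.hasFDerivAt_symm (φ.map_source hx) h1).fderiv, ← hev]
  exact e.symm_apply_apply v

/-- Near a point where `G` is a submersion, points of the same level set are joined by a
differentiable arc in that level set. -/
lemma exists_arc_in_level {G : X → Y} {x : X} (hG : ContDiffAt ℝ ∞ G x)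
    (hs : Function.Surjective (fderiv ℝ G x)) {N : Set X} (hN : N ∈ 𝓝 x) :
    ∀ᶠ x' in 𝓝 x, G x' = G x → ∃ γ : ℝ → X, γ 0 = x ∧ γ 1 = x' ∧
      ∀ t ∈ Icc (0 : ℝ) 1, DifferentiableAt ℝ γ t ∧ γ t ∈ N ∧ G (γ t) = G x := by
  obtain ⟨p, φ, -, hx, hφ, hsymm, -⟩ := exists_straightening hG hs
  have hd : ∀ᶠ z in 𝓝 (φ x), DifferentiableAt ℝ φ.symm z := by
    have h1 : ContDiffAt ℝ 1 φ.symm (φ x) := hsymm.of_le (by simp)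
    filter_upwards [h1.eventually (by simp)] with z hz
    exact hz.differentiableAt (by simp)
  have hNz : ∀ᶠ z in 𝓝 (φ x), φ.symm z ∈ N :=
    (φ.continuousAt_symm (φ.map_source hx)).preimage_mem_nhds (by rwa [φ.left_inv hx])
  obtain ⟨ε, hε, hball⟩ := Metric.eventually_nhds_iff_ball.1
    ((hd.and hNz).and (φ.open_target.mem_nhds (φ.map_source hx)))
  have hnear : ∀ᶠ x' in 𝓝 x, φ x' ∈ Metric.ball (φ x) ε :=
    (φ.continuousAt hx).preimage_mem_nhds (Metric.ball_mem_nhds _ hε)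
  filter_upwards [hnear, φ.open_source.mem_nhds hx] with x' hx' hx's hlev
  refine ⟨fun t => φ.symm (φ x + t • (φ x' - φ x)), by simp [φ.left_inv hx],
    by simp [φ.left_inv hx's], fun t ht => ?_⟩
  have hmem : φ x + t • (φ x' - φ x) ∈ Metric.ball (φ x) ε := by
    rw [mem_ball_iff_norm, add_sub_cancel_left, norm_smul, Real.norm_eq_abs, abs_of_nonneg ht.1]
    rw [mem_ball_iff_norm] at hx'
    exact (mul_le_of_le_one_left (norm_nonneg _) ht.2).trans_lt hx'
  obtain ⟨⟨h1, h2⟩, h3⟩ := hball _ hmem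
  refine ⟨h1.comp t (by fun_prop), h2, ?_⟩
  have h4 := congrArg Prod.fst (φ.right_inv h3)
  rw [hφ] at h4
  refine h4.trans ?_
  simp [hφ, hlev]

/-- The kernel of the derivative of a submersion is tangent to its level set. -/
lemma exists_curve_in_level {G : X → Y} {x : X} (hG : ContDiffAt ℝ ∞ G x)
    (hs : Function.Surjective (fderiv ℝ G x)) {v : X} (hv : fderiv ℝ G x v = 0) :
    ∃ γ : ℝ → X, γ 0 = x ∧ (∀ᶠ t in 𝓝 0, G (γ t) = G x) ∧ ContDiffAt ℝ ∞ γ 0 ∧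
      deriv γ 0 = v := by
  obtain ⟨p, φ, -, hx, hφ, hsymm, hder⟩ := exists_straightening hG hs
  set a : Y × (fderiv ℝ G x).ker := (0, p v) with ha
  have hline : ContDiff ℝ ∞ fun t : ℝ => φ x + t • a := by fun_prop
  have h0 : φ x + (0 : ℝ) • a = φ x := by simp
  refine ⟨fun t => φ.symm (φ x + t • a), by simp [φ.left_inv hx], ?_, ?_, ?_⟩
  · have : ∀ᶠ t in 𝓝 (0 : ℝ), φ x + t • a ∈ φ.target :=
      hline.continuous.continuousAt.preimage_mem_nhds
        (by rw [h0]; exact φ.open_target.mem_nhds (φ.map_source hx))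
    filter_upwards [this] with t ht
    have h4 := congrArg Prod.fst (φ.right_inv ht)
    rw [hφ] at h4
    refine h4.trans ?_
    simp [hφ, ha]
  · exact ContDiffAt.comp (0 : ℝ) (by rw [h0]; exact hsymm) hline.contDiffAt
  · have h1 : HasFDerivAt φ.symm (fderiv ℝ φ.symm (φ x)) (φ x + (0 : ℝ) • a) := by
      rw [h0]; exact (hsymm.differentiableAt (by simp)).hasFDerivAt
    have h2 : HasDerivAt (fun t : ℝ => φ x + t • a) a 0 := by
      simpa using ((hasDerivAt_id (0 : ℝ)).smul_const a).const_add (φ x)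
    have h3 := (h1.comp_hasDerivAt (0 : ℝ) h2).deriv
    refine h3.trans ?_
    have := hder v
    rwa [hv] at this

end Submersions

/-! ### Fiberwise critical points -/

section FiberwiseCritical

variable {X Q : Type*} [NormedAddCommGroup X] [NormedSpace ℝ X] [FiniteDimensional ℝ X]
  [NormedAddCommGroup Q] [NormedSpace ℝ Q] [FiniteDimensional ℝ Q]

/-- The points of `O` at which the function `e` is critical along the fibers of the linear
map `F`. -/
def fiberCritical (F : X →L[ℝ] Q) (e : X → ℝ) (O : Set X) : Set X :=
  {w ∈ O | ∀ τ, F τ = 0 → fderiv ℝ e w τ = 0}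

variable {F : X →L[ℝ] Q} {e : X → ℝ} {O : Set X}

omit [FiniteDimensional ℝ X] [FiniteDimensional ℝ Q] in
lemma map_mem_tangentVectors {S : Set X} {w v : X} (hv : v ∈ tangentVectors S w) :
    F v ∈ tangentVectors (F '' S) (F w) := by
  obtain ⟨γ, h0, hS, hd, rfl⟩ := hv
  refine ⟨F ∘ γ, by simp [h0], ?_, F.contDiff.contDiffAt.comp 0 hd, ?_⟩
  · filter_upwards [hS] with t ht using mem_image_of_mem F ht
  · exact (F.hasFDerivAt.comp_hasDerivAt 0
      (hd.differentiableAt (by simp)).hasDerivAt).deriv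

omit [FiniteDimensional ℝ X] [FiniteDimensional ℝ Q] in
/-- The condition of being fiberwise critical, differentiated along a curve. -/
lemma fderiv_fderiv_tangent_eq_zero (hO : IsOpen O) (he : ContDiffOn ℝ ∞ e O) {w v τ : X}
    (hw : w ∈ O) (hv : v ∈ tangentVectors (fiberCritical F e O) w) (hτ : F τ = 0) :
    fderiv ℝ (fderiv ℝ e) w v τ = 0 := by
  obtain ⟨γ, h0, hS, hd, rfl⟩ := hv
  have hdiff : HasFDerivAt (fderiv ℝ e) (fderiv ℝ (fderiv ℝ e) w) (γ 0) := by
    rw [h0]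
    exact (((he.fderiv_of_isOpen hO (m := ∞) (by simp)).contDiffAt
      (hO.mem_nhds hw)).differentiableAt (by simp)).hasFDerivAt
  have h1 : HasDerivAt (fun t => fderiv ℝ e (γ t) τ)
      (fderiv ℝ (fderiv ℝ e) w (deriv γ 0) τ) 0 := by
    simpa using (hdiff.comp_hasDerivAt (0 : ℝ)
      (hd.differentiableAt (by simp)).hasDerivAt).clm_apply (hasDerivAt_const (0 : ℝ) τ)
  have h2 : (fun t => fderiv ℝ e (γ t) τ) =ᶠ[𝓝 0] fun _ => 0 := by
    filter_upwards [hS] with t ht using ht.2 τ hτ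
  rw [← h1.deriv, h2.deriv_eq, deriv_const]

omit [FiniteDimensional ℝ X] [FiniteDimensional ℝ Q] in
/-- Along an arc in a fiber of `F` which consists of fiberwise critical points, the derivative of
`e` in a direction that lifts to tangent vectors of the critical set is constant: by the symmetry
of the second derivative. -/
lemma fderiv_eq_of_arc (hO : IsOpen O) (he : ContDiffOn ℝ ∞ e O) {x : X} {q : Q} {γ : ℝ → X}
    (hγ : ∀ t ∈ Icc (0 : ℝ) 1, DifferentiableAt ℝ γ t ∧ γ t ∈ fiberCritical F e O ∧ F (γ t) = q)
    (hx : ∀ w ∈ fiberCritical F e O, F w = q →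
      ∃ v ∈ tangentVectors (fiberCritical F e O) w, F v = F x) :
    fderiv ℝ e (γ 1) x = fderiv ℝ e (γ 0) x := by
  have hder : ∀ (a : X), ∀ t ∈ Icc (0 : ℝ) 1, HasDerivAt (fun t => fderiv ℝ e (γ t) a)
      (fderiv ℝ (fderiv ℝ e) (γ t) (deriv γ t) a) t := by
    intro a t ht
    have hdiff : HasFDerivAt (fderiv ℝ e) (fderiv ℝ (fderiv ℝ e) (γ t)) (γ t) :=
      (((he.fderiv_of_isOpen hO (m := ∞) (by simp)).contDiffAt
        (hO.mem_nhds (hγ t ht).2.1.1)).differentiableAt (by simp)).hasFDerivAt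
    simpa using (hdiff.comp_hasDerivAt t (hγ t ht).1.hasDerivAt).clm_apply (hasDerivAt_const t a)
  have hzero : ∀ t ∈ Ioo (0 : ℝ) 1, deriv (fun t => fderiv ℝ e (γ t) x) t = 0 := by
    intro t ht
    have htc := Ioo_subset_Icc_self ht
    obtain ⟨hd, hcrit, hq⟩ := hγ t htc
    obtain ⟨v, hv, hvx⟩ := hx _ hcrit hq
    have hnhds : Ioo (0 : ℝ) 1 ∈ 𝓝 t := isOpen_Ioo.mem_nhds ht
    have hξ : F (deriv γ t) = 0 := by
      have h1 := (F.hasFDerivAt.comp_hasDerivAt t hd.hasDerivAt).deriv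
      have h2 : F ∘ γ =ᶠ[𝓝 t] fun _ => q := by
        filter_upwards [hnhds] with t' ht' using (hγ t' (Ioo_subset_Icc_self ht')).2.2
      rw [← h1, h2.deriv_eq, deriv_const]
    have hc : F (v - x) = 0 := by rw [map_sub, hvx, sub_self]
    have e1 : fderiv ℝ (fderiv ℝ e) (γ t) (deriv γ t) (v - x) = 0 := by
      have h2 : (fun t => fderiv ℝ e (γ t) (v - x)) =ᶠ[𝓝 t] fun _ => 0 := by
        filter_upwards [hnhds] with t' ht' using
          (hγ t' (Ioo_subset_Icc_self ht')).2.1.2 _ hc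
      rw [← (hder (v - x) t htc).deriv, h2.deriv_eq, deriv_const]
    have e2 : fderiv ℝ (fderiv ℝ e) (γ t) (deriv γ t) v = 0 := by
      have hsymm : IsSymmSndFDerivAt ℝ e (γ t) :=
        (he.contDiffAt (hO.mem_nhds hcrit.1)).isSymmSndFDerivAt (by
          rw [minSmoothness_of_isRCLikeNormedField]
          exact WithTop.coe_le_coe.2 le_top)
      rw [hsymm.eq]
      exact fderiv_fderiv_tangent_eq_zero hO he hcrit.1 hv hξ
    rw [(hder x t htc).deriv]
    rw [map_sub, e2, zero_sub, neg_eq_zero] at e1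
    exact e1
  obtain ⟨t, ht, h⟩ := exists_deriv_eq_slope (fun t => fderiv ℝ e (γ t) x) zero_lt_one
    (fun t ht => (hder x t ht).continuousAt.continuousWithinAt)
    (fun t ht => (hder x t (Ioo_subset_Icc_self ht)).differentiableAt.differentiableWithinAt)
  rw [hzero t ht] at h
  rw [sub_zero, div_one, eq_comm, sub_eq_zero] at h
  exact h

/-- If `F` restricts to a submersion with connected fibers from the set `S` of fiberwise critical
points of `e` onto a submanifold, then the restriction of `de` to `S` is basic.

Locally a fiber of `S` is a level set of the submersion `w ↦ (de_w|ker F, p (F w))`, where `p`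
is the linear part of coordinates on the submanifold; so close points of a fiber are joined by an
arc in it. -/
theorem fderiv_eq_of_map_eq (hO : IsOpen O) (he : ContDiffOn ℝ ∞ e O)
    (hsub : IsSubmanifold (F '' fiberCritical F e O))
    (hlift : ∀ w ∈ fiberCritical F e O, ∀ v ∈ tangentVectors (F '' fiberCritical F e O) (F w),
      ∃ v' ∈ tangentVectors (fiberCritical F e O) w, F v' = v)
    (hconn : ∀ q ∈ F '' fiberCritical F e O, IsConnected {w ∈ fiberCritical F e O | F w = q})
    (htrans : ∀ w ∈ O, ∀ l : F.ker →L[ℝ] ℝ, ∃ x, ∀ τ : F.ker,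
      fderiv ℝ (fderiv ℝ e) w x τ = l τ)
    {w w' : X} (hw : w ∈ fiberCritical F e O) (hw' : w' ∈ fiberCritical F e O)
    (hww : F w = F w') {v v' : X} (hv : v ∈ tangentVectors (fiberCritical F e O) w)
    (hvv : F v = F v') : fderiv ℝ e w v = fderiv ℝ e w' v' := by
  set S := fiberCritical F e O with hS
  -- it suffices to compare two points of the fiber on the same vector, as vertical vectors do not
  -- contribute at fiberwise critical points
  have hstep : fderiv ℝ e w v = fderiv ℝ e w' v := by
    have hvt := map_mem_tangentVectors (F := F) hv
    refine (hconn (F w) (mem_image_of_mem F hw)).isPreconnected.induction₂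
      (fun a b => fderiv ℝ e a v = fderiv ℝ e b v) ?_ (fun _ _ _ _ _ _ h h' => h.trans h')
      (fun _ _ _ _ h => h.symm) ⟨hw, rfl⟩ ⟨hw', hww.symm⟩
    rintro a ⟨ha, haq⟩
    obtain ⟨U, r, f, hU, hqU, hf, hfs, hSU⟩ := hsub (F a) (mem_image_of_mem F ha)
    have hfq : ContDiffAt ℝ ∞ f (F a) := hf.contDiffAt (hU.mem_nhds hqU)
    have hf0 : f (F a) = 0 := by
      have : F a ∈ F '' S ∩ U := ⟨mem_image_of_mem F ha, hqU⟩
      rw [hSU] at this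
      exact this.2
    obtain ⟨p, φ, hp, hφs, hφ, -, -⟩ := exists_straightening hfq (hfs _ hqU)
    set Φ : X → (F.ker →L[ℝ] ℝ) × (fderiv ℝ f (F a)).ker :=
      fun x => ((fderiv ℝ e x).comp F.ker.subtypeL, p (F x)) with hΦ
    have hde : ContDiffAt ℝ ∞ (fderiv ℝ e) a :=
      (he.fderiv_of_isOpen hO (by simp)).contDiffAt (hO.mem_nhds ha.1)
    have hΦd : ContDiffAt ℝ ∞ Φ a :=
      (hde.clm_comp contDiffAt_const).prodMk (p.contDiff.comp F.contDiff).contDiffAt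
    have hΦ' : ∀ x, fderiv ℝ Φ a x =
        ((fderiv ℝ (fderiv ℝ e) a x).comp F.ker.subtypeL, p (F x)) := by
      intro x
      have h1 := ((ContinuousLinearMap.compL ℝ F.ker X ℝ).flip F.ker.subtypeL).hasFDerivAt.comp a
        (hde.differentiableAt (by simp)).hasFDerivAt
      have h3 : fderiv ℝ Φ a = _ := (h1.prodMk (p.comp F).hasFDerivAt).fderiv
      rw [h3]
      rfl
    -- the first component is onto by `htrans`; lifts of tangent vectors of the submanifold then
    -- correct the second component without changing the first
    have hΦs : Function.Surjective (fderiv ℝ Φ a) := by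
      rintro ⟨l, κ⟩
      obtain ⟨x₁, hx₁⟩ := htrans a ha.1 l
      obtain ⟨γ, h0, hlev, hγd, hγv⟩ := exists_curve_in_level hfq (hfs _ hqU)
        (v := ((κ - p (F x₁) : (fderiv ℝ f (F a)).ker) : Q)) (κ - p (F x₁)).2
      have htan : ((κ - p (F x₁) : (fderiv ℝ f (F a)).ker) : Q) ∈
          tangentVectors (F '' S) (F a) := by
        refine ⟨γ, h0, ?_, hγd, hγv⟩
        have hUγ : ∀ᶠ t in 𝓝 (0 : ℝ), γ t ∈ U :=
          hγd.continuousAt.preimage_mem_nhds (by rw [h0]; exact hU.mem_nhds hqU)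
        filter_upwards [hlev, hUγ] with t ht htU
        have : γ t ∈ F '' S ∩ U := by rw [hSU]; exact ⟨htU, ht.trans hf0⟩
        exact this.1
      obtain ⟨v', hv', hFv'⟩ := hlift a ha _ htan
      refine ⟨x₁ + v', ?_⟩
      rw [hΦ']
      refine Prod.ext ?_ ?_
      · ext τ
        have := fderiv_fderiv_tangent_eq_zero hO he ha.1 hv' (τ := τ) τ.2
        simp [hx₁, this]
      · simp only [map_add, hFv', hp, add_sub_cancel]
    have hN : O ∩ F ⁻¹' (U ∩ φ.source) ∈ 𝓝 a :=
      inter_mem (hO.mem_nhds ha.1) (F.continuous.continuousAt.preimage_mem_nhds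
        (inter_mem (hU.mem_nhds hqU) (φ.open_source.mem_nhds hφs)))
    have harc := exists_arc_in_level hΦd hΦs hN
    refine (harc.filter_mono nhdsWithin_le_nhds).mp ?_
    filter_upwards [self_mem_nhdsWithin] with b hb hbarc
    have hb0 : ∀ x ∈ S, (fderiv ℝ e x).comp F.ker.subtypeL = 0 := by
      intro x hx
      ext τ
      exact hx.2 τ τ.2
    obtain ⟨γ, h0, h1, hγ⟩ := hbarc (by
      simp only [hΦ, hb0 a ha, hb0 b hb.1, hb.2, haq])
    have hmem : ∀ t ∈ Icc (0 : ℝ) 1, DifferentiableAt ℝ γ t ∧ γ t ∈ S ∧ F (γ t) = F w := by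
      intro t ht
      obtain ⟨hd, hNt, hlev⟩ := hγ t ht
      have hcrit : γ t ∈ S := by
        refine ⟨hNt.1, fun τ hτ => ?_⟩
        have h2 := congrArg Prod.fst hlev
        simp only [hΦ, hb0 a ha] at h2
        exact DFunLike.congr_fun h2 (⟨τ, hτ⟩ : F.ker)
      refine ⟨hd, hcrit, ?_⟩
      have h3 : F (γ t) ∈ F '' S ∩ U := ⟨mem_image_of_mem F hcrit, hNt.2.1⟩
      rw [hSU] at h3
      rw [← haq]
      refine φ.injOn hNt.2.2 hφs ?_
      rw [hφ, hφ, h3.2, hf0]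
      have h4 : p (F (γ t)) = p (F a) := congrArg Prod.snd hlev
      rw [h4]
    have := fderiv_eq_of_arc (x := v) hO he hmem fun x hx hxq => hlift x hx _ (hxq ▸ hvt)
    rw [h0, h1] at this
    exact this.symm
  rw [hstep, ← sub_eq_zero, ← map_sub]
  exact hw'.2 _ (by rw [map_sub, hvv, sub_self])

end FiberwiseCritical

/-! ### Wedge products with coordinate covectors -/

section Wedge

variable {V : Type*} [AddCommGroup V] [Module ℝ V]

lemma wedge_apply {N : ℕ} (l : Fin N → V →ₗ[ℝ] ℝ) (v : Fin N → V) :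
    wedge l v = Matrix.det (Matrix.of fun j i => l i (v j)) := rfl

lemma det_of_row_zero {n : ℕ} (A : Matrix (Fin (n + 1)) (Fin (n + 1)) ℝ)
    (h : ∀ j : Fin n, A 0 j.succ = 0) :
    A.det = A 0 0 * (A.submatrix Fin.succ Fin.succ).det := by
  rw [Matrix.det_succ_row_zero, Fin.sum_univ_succ]
  simp [h]

lemma det_one_updateCol {n : ℕ} (i : Fin n) (b : Fin n → ℝ) :
    ((1 : Matrix (Fin n) (Fin n) ℝ).updateCol i b).det = b i := by
  rw [← Matrix.cramer_apply, Matrix.cramer_one]; rfl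

variable {n : ℕ} {dx : Fin n → V →ₗ[ℝ] ℝ} {Y : V} {X : Fin n → V}

/-- The value of `e ∧ dx^1 ∧ ⋯ ∧ dx^n` on a vertical vector `Y` and lifts `X_i` of `∂/∂x^i`. -/
lemma wedge_cons_cons (hY : ∀ i, dx i Y = 0) (hX : ∀ i j, dx i (X j) = if i = j then 1 else 0)
    (e : V →ₗ[ℝ] ℝ) :
    wedge (Fin.cons e dx : Fin (n + 1) → V →ₗ[ℝ] ℝ) (Fin.cons Y X : Fin (n + 1) → V) = e Y := by
  rw [wedge_apply, det_of_row_zero _ (by simp [hY])]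
  have : (Matrix.of fun j i => (Fin.cons e dx : Fin (n + 1) → V →ₗ[ℝ] ℝ) i
      ((Fin.cons Y X : Fin (n + 1) → V) j)).submatrix Fin.succ Fin.succ = 1 := by
    ext j i
    simp [hX, Matrix.one_apply, eq_comm]
  rw [this]
  simp

/-- The value of `a ∧ b ∧ d^{n-1}x_i` on a vertical vector `Y` and lifts `X_i` of `∂/∂x^i`. -/
lemma wedge_cons_update_cons (hY : ∀ i, dx i Y = 0)
    (hX : ∀ i j, dx i (X j) = if i = j then 1 else 0) (a b : V →ₗ[ℝ] ℝ) (i : Fin n) :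
    wedge (Fin.cons a (Function.update dx i b) : Fin (n + 1) → V →ₗ[ℝ] ℝ)
      (Fin.cons Y X : Fin (n + 1) → V) = a Y * b (X i) - b Y * a (X i) := by
  rw [wedge_apply]
  set A : Matrix (Fin (n + 1)) (Fin (n + 1)) ℝ := Matrix.of fun j l =>
    (Fin.cons a (Function.update dx i b) : Fin (n + 1) → V →ₗ[ℝ] ℝ) l
      ((Fin.cons Y X : Fin (n + 1) → V) j) with hA
  -- the row of `Y` has only the entries `a Y` and `b Y`, in the columns `0` and `i + 1`
  have hrow : A 0 = Pi.single 0 (a Y) + Pi.single i.succ (b Y) := by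
    funext l
    refine Fin.cases ?_ (fun l => ?_) l
    · simp [hA, -Fin.cons_update]
    · by_cases hl : l = i
      · subst hl; simp [hA, -Fin.cons_update]
      · simp [hA, hl, hY, -Fin.cons_update]
  have hsub : ∀ r : Fin (n + 1) → ℝ, (A.updateRow 0 r).submatrix Fin.succ Fin.succ =
      (1 : Matrix (Fin n) (Fin n) ℝ).updateCol i fun j => b (X j) := by
    intro r
    ext j l
    by_cases hl : l = i
    · subst hl; simp [hA, -Fin.cons_update]
    · simp [hA, hl, hX, Matrix.one_apply, eq_comm, -Fin.cons_update]
  have h1 : (A.updateRow 0 (Pi.single 0 (a Y))).det = a Y * b (X i) := by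
    rw [det_of_row_zero _ (by simp), hsub, det_one_updateCol]
    simp
  have h2 : (A.updateRow 0 (Pi.single i.succ (b Y))).det = -(b Y * a (X i)) := by
    -- exchanging the columns `0` and `i + 1` exchanges the roles of `a` and `b`
    have hp := Matrix.det_permute' (Equiv.swap 0 i.succ) (A.updateRow 0 (Pi.single i.succ (b Y)))
    rw [Equiv.Perm.sign_swap (Fin.succ_ne_zero i).symm] at hp
    rw [det_of_row_zero] at hp
    · have hs : ((A.updateRow 0 (Pi.single i.succ (b Y))).submatrix id
          (Equiv.swap 0 i.succ)).submatrix Fin.succ Fin.succ =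
          (1 : Matrix (Fin n) (Fin n) ℝ).updateCol i fun j => a (X j) := by
        ext j l
        by_cases hl : l = i
        · subst hl; simp [hA, -Fin.cons_update]
        · have : Equiv.swap 0 i.succ l.succ = l.succ :=
            Equiv.swap_apply_of_ne_of_ne (Fin.succ_ne_zero l) (by simpa using hl)
          simp [hA, hl, hX, Matrix.one_apply, this, eq_comm, -Fin.cons_update]
      rw [hs, det_one_updateCol] at hp
      simp at hp
      linarith
    · intro j
      by_cases hj : j = i
      · subst hj; simp [(Fin.succ_ne_zero j).symm]
      · have : Equiv.swap 0 i.succ j.succ = j.succ :=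
          Equiv.swap_apply_of_ne_of_ne (Fin.succ_ne_zero j) (by simpa using hj)
        simp [this, hj]
  have h3 : A = A.updateRow 0 (Pi.single 0 (a Y) + Pi.single i.succ (b Y)) := by
    rw [← hrow, Matrix.updateRow_eq_self]
  rw [h3, Matrix.det_updateRow_add, h1, h2]
  ring

end Wedge

/-! ### The form `ω` in coordinates -/

/-- A second derivative, computed along a line on which the first derivative is affine. -/
lemma fderiv_fderiv_eq_of_line {X : Type*} [NormedAddCommGroup X] [NormedSpace ℝ X] {e : X → ℝ}
    {O : Set X} (hO : IsOpen O) (he : ContDiffOn ℝ ∞ e O) {w v τ : X} (hw : w ∈ O) {A : ℝ}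
    (h : ∀ t : ℝ, fderiv ℝ e (w + t • v) τ = t * A + fderiv ℝ e w τ) :
    fderiv ℝ (fderiv ℝ e) w v τ = A := by
  have hdiff : HasFDerivAt (fderiv ℝ e) (fderiv ℝ (fderiv ℝ e) w) w :=
    (((he.fderiv_of_isOpen hO (m := ∞) (by simp)).contDiffAt
      (hO.mem_nhds hw)).differentiableAt (by simp)).hasFDerivAt
  have h1 : HasDerivAt (fun t : ℝ => fderiv ℝ e (w + t • v) τ)
      (fderiv ℝ (fderiv ℝ e) w v τ) 0 :=
    (((ContinuousLinearMap.apply ℝ ℝ τ).hasFDerivAt).comp w hdiff).hasLineDerivAt v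
  simp only [h] at h1
  have h3 := ((hasDerivAt_id (0 : ℝ)).mul_const A).add_const (fderiv ℝ e w τ)
  simpa using h1.unique h3

section Omega

variable {n m : ℕ}
variable {M : Type*} [TopologicalSpace M] [ChartedSpace (Coord n) M]
variable {E : Type*} [TopologicalSpace E] [ChartedSpace (Coord n × Coord m) E]
variable {π : E → M} {k : ℕ}

/-- The coordinate `u_K^α`, as a linear form. -/
def uForm (K : MIdx n (k + 1)) (α : Fin m) : MixedCoord n m k →L[ℝ] ℝ :=
  (ContinuousLinearMap.proj (R := ℝ) (φ := fun _ : Fin m => ℝ) α).comp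
    ((ContinuousLinearMap.proj (R := ℝ) (φ := fun _ : MIdx n (k + 1) => Fin m → ℝ) K).comp
      ((ContinuousLinearMap.fst ℝ _ _).comp (ContinuousLinearMap.snd ℝ _ _)))

/-- The coordinate `p_α^{I.i}`, as a linear form. -/
def pForm (I : MIdx n k) (α : Fin m) (i : Fin n) : MixedCoord n m k →L[ℝ] ℝ :=
  (ContinuousLinearMap.proj (R := ℝ) (φ := fun _ : Fin n => ℝ) i).comp
    ((ContinuousLinearMap.proj (R := ℝ) (φ := fun _ : Fin m => Fin n → ℝ) α).comp
      ((ContinuousLinearMap.proj (R := ℝ) (φ := fun _ : MIdx n k => Fin m → Fin n → ℝ) I).comp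
        ((ContinuousLinearMap.snd ℝ _ _).comp (ContinuousLinearMap.snd ℝ _ _))))

/-- The projection to jet coordinates, as a linear map. -/
def jetForm : MixedCoord n m k →L[ℝ] JetCoord n m (k + 1) :=
  (ContinuousLinearMap.fst ℝ _ _).prod
    ((ContinuousLinearMap.fst ℝ _ _).comp (ContinuousLinearMap.snd ℝ _ _))

@[simp] lemma uForm_apply (K : MIdx n (k + 1)) (α : Fin m) (w : MixedCoord n m k) :
    uForm K α w = w.2.1 K α := rfl

@[simp] lemma pForm_apply (I : MIdx n k) (α : Fin m) (i : Fin n) (w : MixedCoord n m k) :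
    pForm I α i w = w.2.2 I α i := rfl

@[simp] lemma jetForm_apply (w : MixedCoord n m k) : jetForm w = (w.1, w.2.1) := rfl

/-- The projection `forget`, as a linear map. -/
def forgetL : MixedCoord n m k →L[ℝ] MMCoord n m k :=
  (ContinuousLinearMap.fst ℝ _ _).prod
    ((ContinuousLinearMap.pi fun I => (ContinuousLinearMap.proj (R := ℝ)
        (φ := fun _ : MIdx n (k + 1) => Fin m → ℝ) I.incl).comp
          ((ContinuousLinearMap.fst ℝ _ _).comp (ContinuousLinearMap.snd ℝ _ _))).prod
      ((ContinuousLinearMap.snd ℝ _ _).comp (ContinuousLinearMap.snd ℝ _ _)))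

lemma coe_forgetL : ((forgetL : MixedCoord n m k →L[ℝ] MMCoord n m k) : _ → _) = forget := rfl

lemma eq_of_forgetL_eq_zero {τ : MixedCoord n m k} (hτ : forgetL τ = 0) :
    τ = (0, (τ.2.1, 0)) ∧ ∀ I : MIdx n k, τ.2.1 I.incl = 0 := by
  have h1 : τ.1 = 0 := congrArg (fun q : MMCoord n m k => q.1) hτ
  have h3 : τ.2.2 = 0 := congrArg (fun q : MMCoord n m k => q.2.2) hτ
  exact ⟨Prod.ext h1 (Prod.ext rfl h3),
    fun I => congrFun (congrArg (fun q : MMCoord n m k => q.2.1) hτ) I⟩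

/-- The linear form `dx^i`. -/
noncomputable def dxForm (i : Fin n) : MixedCoord n m k →ₗ[ℝ] ℝ :=
  (EuclideanSpace.proj i : Coord n →L[ℝ] ℝ).toLinearMap ∘ₗ LinearMap.fst ℝ _ _

@[simp] lemma dxForm_apply (i : Fin n) (w : MixedCoord n m k) : dxForm i w = w.1 i := rfl

lemma Lagrangian.omega_apply (ℒ : Lagrangian n m π k) (c : AdaptedChart n m π)
    (w : MixedCoord n m k) (v : Fin (n + 1) → MixedCoord n m k) :
    ℒ.omega c w v = (∑ I : MIdx n k, ∑ α, ∑ i,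
      wedge (Fin.cons (pForm I α i).toLinearMap
        (Function.update dxForm i (uForm I.incl α).toLinearMap) : Fin (n + 1) → _) v) -
      wedge (Fin.cons (fderiv ℝ (ℒ.energy c) w).toLinearMap dxForm : Fin (n + 1) → _) v := by
  let ev : (MixedCoord n m k [⋀^Fin (n + 1)]→ₗ[ℝ] ℝ) →+ ℝ :=
    { toFun := fun f => f v, map_zero' := rfl, map_add' := fun _ _ => rfl }
  change ev (ℒ.omega c w) = _
  simp only [omega, map_sub, map_sum]
  rfl

/-- Every multi-index of maximal length is of the form `iI`. -/
lemma MIdx.exists_cons {K : MIdx n (k + 1)} (hK : K.1.card = k + 1) :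
    ∃ (i : Fin n) (I : MIdx n k), K = MIdx.cons i I := by
  obtain ⟨K, hK'⟩ := K
  obtain ⟨i, hi⟩ := Multiset.card_pos_iff_exists_mem.1 (show 0 < K.card by simp at hK; omega)
  obtain ⟨I, rfl⟩ := Multiset.exists_cons_of_mem hi
  exact ⟨i, ⟨I, by simp at hK; omega⟩, rfl⟩

lemma MIdx.card_eq_of_ne_incl {K : MIdx n (k + 1)} (h : ∀ I : MIdx n k, K ≠ I.incl) :
    K.1.card = k + 1 := by
  by_contra hne
  have := K.2
  exact h ⟨K.1, by omega⟩ rfl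

lemma MIdx.incl_ne_of_card {K : MIdx n (k + 1)} (hK : K.1.card = k + 1) (I : MIdx n k) :
    K ≠ I.incl := by
  rintro rfl
  have : I.1.card = k + 1 := hK
  have := I.2
  omega

lemma MIdx.incl_injective : Function.Injective (MIdx.incl : MIdx n k → MIdx n (k + 1)) :=
  fun _ _ h => Subtype.ext (congrArg (fun J : MIdx n (k + 1) => J.1) h)

/-- A sum over multi-indices whose terms of maximal length vanish. -/
lemma MIdx.sum_eq_sum_incl (f : MIdx n (k + 1) → ℝ) (hf : ∀ K, K.1.card = k + 1 → f K = 0) :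
    ∑ K, f K = ∑ I : MIdx n k, f I.incl := by
  symm
  refine Fintype.sum_of_injective MIdx.incl MIdx.incl_injective _ _ (fun K hK => ?_) fun _ => rfl
  exact hf K (MIdx.card_eq_of_ne_incl fun I h => hK ⟨I, h.symm⟩)

namespace Lagrangian

variable (ℒ : Lagrangian n m π k) (c : AdaptedChart n m π)

/-- The domain of the coordinate expressions in `W`. -/
def mixedDom : Set (MixedCoord n m k) := {w | (w.1, w.2.1) ∈ c.jetTarget (k + 1)}

lemma isOpen_mixedDom : IsOpen (mixedDom c : Set (MixedCoord n m k)) :=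
  c.isOpen_jetTarget.preimage (jetForm (n := n) (m := m) (k := k)).continuous

lemma contDiffOn_energy : ContDiffOn ℝ ∞ (ℒ.energy c) (mixedDom c) := by
  refine ContDiffOn.sub ?_ ((ℒ.smooth c).comp jetForm.contDiff.contDiffOn fun w hw => hw)
  refine ContDiffOn.sum fun I _ => ContDiffOn.sum fun α _ => ContDiffOn.sum fun i _ => ?_
  exact ((uForm (MIdx.cons i I) α).contDiff.mul (pForm I α i).contDiff).contDiffOn

lemma fderiv_energy {w : MixedCoord n m k} (hw : w ∈ mixedDom c) (v : MixedCoord n m k) :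
    fderiv ℝ (ℒ.energy c) w v = (∑ I : MIdx n k, ∑ α, ∑ i,
      (v.2.1 (I.cons i) α * w.2.2 I α i + w.2.1 (I.cons i) α * v.2.2 I α i)) -
        fderiv ℝ (ℒ.density c) (w.1, w.2.1) (v.1, v.2.1) := by
  have hL : DifferentiableAt ℝ (ℒ.density c) (jetForm w) :=
    ((ℒ.smooth c).contDiffAt (c.isOpen_jetTarget.mem_nhds hw)).differentiableAt (by simp)
  have h1 : HasFDerivAt (ℒ.energy c) ((∑ I : MIdx n k, ∑ α, ∑ i,
      (uForm (I.cons i) α w • pForm I α i + pForm I α i w • uForm (I.cons i) α :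
        MixedCoord n m k →L[ℝ] ℝ)) -
        (fderiv ℝ (ℒ.density c) (jetForm w)).comp jetForm) w := by
    refine HasFDerivAt.sub ?_ (hL.hasFDerivAt.comp w jetForm.hasFDerivAt)
    refine HasFDerivAt.fun_sum fun I _ => HasFDerivAt.fun_sum fun α _ =>
      HasFDerivAt.fun_sum fun i _ => ?_
    exact (uForm (MIdx.cons i I) α).hasFDerivAt.mul (pForm I α i).hasFDerivAt
  rw [h1.fderiv]
  simp only [sub_apply, sum_apply, add_apply, smul_apply, uForm_apply, pForm_apply, smul_eq_mul,
    ContinuousLinearMap.comp_apply, jetForm_apply]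
  congr 1
  refine Finset.sum_congr rfl fun I _ => Finset.sum_congr rfl fun α _ =>
    Finset.sum_congr rfl fun i _ => ?_
  ring

lemma fderiv_density_vertical (z : JetCoord n m (k + 1)) (a : MIdx n (k + 1) → Fin m → ℝ) :
    fderiv ℝ (ℒ.density c) z (0, a) = ∑ K, ∑ α, a K α * ℒ.dLdu c K α z := by
  have ha : a = ∑ K, ∑ α, a K α • (Pi.single K (Pi.single α 1) : MIdx n (k + 1) → Fin m → ℝ) := by
    funext K α
    simp [Finset.sum_apply, Pi.single_apply, ite_apply]
  let l : (MIdx n (k + 1) → Fin m → ℝ) →L[ℝ] ℝ :=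
    (fderiv ℝ (ℒ.density c) z).comp (ContinuousLinearMap.inr ℝ _ _)
  change l a = ∑ K, ∑ α, a K α * l (Pi.single K (Pi.single α 1))
  conv_lhs => rw [ha]
  simp only [map_sum, map_smul, smul_eq_mul]

/-- The difference `∂L/∂u_K^α - ∑_{Ji = K} p_α^{J.i}` of the two sides of the constraint. -/
noncomputable def defect (w : MixedCoord n m k) (K : MIdx n (k + 1)) (α : Fin m) : ℝ :=
  ℒ.dLdu c K α (w.1, w.2.1) - ∑ J : MIdx n k, ∑ i, if J.cons i = K then w.2.2 J α i else 0

lemma mem_constraintCoord_iff {w : MixedCoord n m k} : w ∈ ℒ.constraintCoord c ↔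
    w ∈ mixedDom c ∧ ∀ K : MIdx n (k + 1), K.1.card = k + 1 → ∀ α, ℒ.defect c w K α = 0 := by
  simp only [constraintCoord, mixedDom, defect, sub_eq_zero, mem_ofPred_eq]

/-- The sum over the pairs `(I, i)`, grouped by the value of `K = Ii`. -/
lemma sum_mul_cons (a : MIdx n (k + 1) → Fin m → ℝ) (p : MomCoord n m k) :
    ∑ I : MIdx n k, ∑ α, ∑ i, a (I.cons i) α * p I α i =
      ∑ K, ∑ α, a K α * ∑ J : MIdx n k, ∑ i, if J.cons i = K then p J α i else 0 := by
  simp only [Finset.mul_sum, mul_ite, mul_zero]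
  have h1 : ∀ K : MIdx n (k + 1), ∑ α : Fin m, ∑ J : MIdx n k, ∑ i : Fin n,
      (if J.cons i = K then a K α * p J α i else (0 : ℝ)) =
      ∑ J : MIdx n k, ∑ α : Fin m, ∑ i : Fin n,
        (if J.cons i = K then a K α * p J α i else (0 : ℝ)) := by
    intro K
    rw [Finset.sum_comm]
  simp only [h1]
  conv_rhs => rw [Finset.sum_comm]
  refine Finset.sum_congr rfl fun I _ => ?_
  conv_rhs => rw [Finset.sum_comm]
  refine Finset.sum_congr rfl fun α _ => ?_
  conv_rhs => rw [Finset.sum_comm]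
  refine Finset.sum_congr rfl fun i _ => ?_
  simp

lemma fderiv_energy_vertical {w : MixedCoord n m k} (hw : w ∈ mixedDom c)
    (a : MIdx n (k + 1) → Fin m → ℝ) (b : MomCoord n m k) :
    fderiv ℝ (ℒ.energy c) w (0, (a, b)) =
      (∑ I : MIdx n k, ∑ α, ∑ i, w.2.1 (I.cons i) α * b I α i) -
        ∑ K, ∑ α, a K α * ℒ.defect c w K α := by
  rw [ℒ.fderiv_energy c hw]
  simp only [fderiv_density_vertical, defect, mul_sub, Finset.sum_add_distrib,
    Finset.sum_sub_distrib, sum_mul_cons a w.2.2]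
  ring

/-- `𝒫` is the set of points at which the energy is critical along the fibers of
`W → J^† π_k`. -/
lemma constraintCoord_eq_fiberCritical :
    ℒ.constraintCoord c = fiberCritical forgetL (ℒ.energy c) (mixedDom c) := by
  ext w
  rw [mem_constraintCoord_iff]
  refine and_congr_right fun hw => ⟨fun h τ hτ => ?_, fun h K hK α => ?_⟩
  · obtain ⟨h1, h2⟩ := eq_of_forgetL_eq_zero hτ
    rw [h1, ℒ.fderiv_energy_vertical c hw, MIdx.sum_eq_sum_incl _ fun K hK => by simp [h K hK]]
    simp [h2]
  · have h1 := h (0, (Pi.single K (Pi.single α 1), 0)) (by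
      rw [coe_forgetL]
      refine Prod.ext rfl (Prod.ext ?_ rfl)
      funext I
      exact Pi.single_eq_of_ne (MIdx.incl_ne_of_card hK I).symm _)
    rw [ℒ.fderiv_energy_vertical c hw] at h1
    rw [Finset.sum_eq_single_of_mem K (Finset.mem_univ K) (fun K' _ hK' => by simp [hK']),
      Finset.sum_eq_single_of_mem α (Finset.mem_univ α) (fun α' _ hα' => by simp [hα'])] at h1
    simpa using h1

/-- The second derivative of the energy in a momentum direction is a pairing which does not depend
on the point. -/
lemma fderiv_fderiv_energy_momentum {w : MixedCoord n m k} (hw : w ∈ mixedDom c)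
    (b : MomCoord n m k) (a : MIdx n (k + 1) → Fin m → ℝ) :
    fderiv ℝ (fderiv ℝ (ℒ.energy c)) w (0, (0, b)) (0, (a, 0)) =
      ∑ I : MIdx n k, ∑ α, ∑ i, a (I.cons i) α * b I α i := by
  refine fderiv_fderiv_eq_of_line (isOpen_mixedDom c) (ℒ.contDiffOn_energy c) hw fun t => ?_
  have e1 : (w + t • ((0, (0, b)) : MixedCoord n m k)).1 = w.1 := by simp
  have e2 : (w + t • ((0, (0, b)) : MixedCoord n m k)).2.1 = w.2.1 := by simp
  have e3 : ∀ I α i, (w + t • ((0, (0, b)) : MixedCoord n m k)).2.2 I α i =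
      w.2.2 I α i + t * b I α i := by
    intro I α i; simp
  have hwt : w + t • ((0, (0, b)) : MixedCoord n m k) ∈ mixedDom c := by
    have e : ((w + t • ((0, (0, b)) : MixedCoord n m k)).1,
        (w + t • ((0, (0, b)) : MixedCoord n m k)).2.1) = (w.1, w.2.1) := by rw [e1, e2]
    change _ ∈ c.jetTarget (k + 1)
    exact e.symm ▸ (show (w.1, w.2.1) ∈ c.jetTarget (k + 1) from hw)
  rw [ℒ.fderiv_energy c hwt, ℒ.fderiv_energy c hw, e1, e2]
  simp only [e3, mul_add, Finset.sum_add_distrib, Finset.mul_sum, mul_left_comm t]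
  ring

/-- The pairing `(p, u) ↦ ∑ u_{Ii}^α p_α^{I.i}`. -/
noncomputable def momentumPairing (n m k : ℕ) :
    MomCoord n m k →ₗ[ℝ] (MIdx n (k + 1) → Fin m → ℝ) →ₗ[ℝ] ℝ :=
  LinearMap.mk₂ ℝ (fun b a => ∑ I : MIdx n k, ∑ α, ∑ i, a (I.cons i) α * b I α i)
    (fun b b' a => by simp [mul_add, Finset.sum_add_distrib])
    (fun t b a => by simp [Finset.mul_sum, mul_left_comm])
    (fun b a a' => by simp [add_mul, Finset.sum_add_distrib])
    (fun t b a => by simp [Finset.mul_sum, mul_assoc])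

lemma eq_zero_of_momentumPairing {a : MIdx n (k + 1) → Fin m → ℝ}
    (h : ∀ b, momentumPairing n m k b a = 0) {K : MIdx n (k + 1)} (hK : K.1.card = k + 1) :
    a K = 0 := by
  obtain ⟨i, I, rfl⟩ := MIdx.exists_cons hK
  funext α
  have := h (Pi.single I (Pi.single α (Pi.single i 1)))
  change (∑ I' : MIdx n k, ∑ α', ∑ i', a (I'.cons i') α' *
    (Pi.single I (Pi.single α (Pi.single i 1)) : MomCoord n m k) I' α' i') = 0 at this
  rw [Finset.sum_eq_single_of_mem I (Finset.mem_univ I) (fun I' _ h => by simp [h]),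
    Finset.sum_eq_single_of_mem α (Finset.mem_univ α) (fun α' _ h => by simp [h]),
    Finset.sum_eq_single_of_mem i (Finset.mem_univ i) (fun i' _ h => by simp [h])] at this
  simpa using this

/-- The fiberwise derivative of the energy is a submersion: every linear form on the kernel of
`W → J^† π_k` is its variation in the direction of suitable momenta. -/
lemma exists_fderiv_fderiv_energy_eq {w : MixedCoord n m k} (hw : w ∈ mixedDom c)
    (l : (forgetL (n := n) (m := m) (k := k)).ker →L[ℝ] ℝ) :
    ∃ x, ∀ τ : (forgetL (n := n) (m := m) (k := k)).ker,
      fderiv ℝ (fderiv ℝ (ℒ.energy c)) w x τ = l τ := by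
  -- the `u`-part of a vertical vector
  let g : (forgetL (n := n) (m := m) (k := k)).ker →ₗ[ℝ] (MIdx n (k + 1) → Fin m → ℝ) :=
    LinearMap.fst ℝ _ _ ∘ₗ LinearMap.snd ℝ _ _ ∘ₗ
      (forgetL (n := n) (m := m) (k := k)).ker.subtype
  -- on the kernel the pairing is nondegenerate, because only the components of maximal order are
  -- nonzero there and each of them is paired with a momentum
  have hB : Function.Surjective ((momentumPairing n m k).compl₂ g) := by
    rw [← LinearMap.flip_injective_iff₁, injective_iff_map_eq_zero]
    intro τ hτ
    obtain ⟨h1, h2⟩ := eq_of_forgetL_eq_zero τ.2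
    refine Subtype.ext (h1.trans ?_)
    have h3 : τ.1.2.1 = 0 := by
      funext K
      by_cases hK : K.1.card = k + 1
      · exact eq_zero_of_momentumPairing (fun b => LinearMap.congr_fun hτ b) hK
      · have hle : K.1.card ≤ k := by have := K.2; omega
        exact h2 ⟨K.1, hle⟩
    rw [h3]
    rfl
  obtain ⟨b, hb⟩ := hB l.toLinearMap
  refine ⟨(0, (0, b)), fun τ => ?_⟩
  have h4 : momentumPairing n m k b (g τ) = l τ := LinearMap.congr_fun hb τ
  rw [(eq_of_forgetL_eq_zero τ.2).1, ℒ.fderiv_fderiv_energy_momentum c hw, ← h4]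
  rfl

/-- The restriction of `dE` to `𝒫` is basic with respect to `𝒫 → 𝒫₀`. -/
lemma IsAdmissible.fderiv_energy_eq {ℒ : Lagrangian n m π k} (hℒ : ℒ.IsAdmissible)
    {w w' : MixedCoord n m k} (hw : w ∈ ℒ.constraintCoord c) (hw' : w' ∈ ℒ.constraintCoord c)
    (hww : forget w = forget w') {v v' : MixedCoord n m k}
    (hv : v ∈ tangentVectors (ℒ.constraintCoord c) w) (hvv : forget v = forget v') :
    fderiv ℝ (ℒ.energy c) w v = fderiv ℝ (ℒ.energy c) w' v' := by
  obtain ⟨h1, h2, h3⟩ := hℒ c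
  simp only [constraintCoord₀, constraintCoord_eq_fiberCritical] at h1 h2 h3 hw hw' hv
  exact fderiv_eq_of_map_eq (F := forgetL) (isOpen_mixedDom c) (ℒ.contDiffOn_energy c) h1 h2 h3
    (fun w hw l => ℒ.exists_fderiv_fderiv_energy_eq c hw l) hw hw' hww hv hvv

/-- The form `ω₀` is well defined: all the covectors in `ω` other than `dE` factor through the
projection `W → J^† π_k`, and `dE` is basic. -/
lemma IsAdmissible.omega₀_eq {ℒ : Lagrangian n m π k} (hℒ : ℒ.IsAdmissible)
    {w : MixedCoord n m k} (hw : w ∈ ℒ.constraintCoord c) {v : Fin (n + 1) → MixedCoord n m k}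
    (hv : ∀ j, v j ∈ tangentVectors (ℒ.constraintCoord c) w) :
    ℒ.omega₀ c (forget w) (fun j => forget (v j)) = ℒ.omega c w v := by
  have huniq : ∀ r : ℝ, (∃ w' ∈ ℒ.constraintCoord c, forget w' = forget w ∧
      ∃ v' : Fin (n + 1) → MixedCoord n m k,
        (∀ j, v' j ∈ tangentVectors (ℒ.constraintCoord c) w' ∧ forget (v' j) = forget (v j)) ∧
        r = ℒ.omega c w' v') → r = ℒ.omega c w v := by
    rintro r ⟨w', hw', hww, v', hv', rfl⟩
    have hE : ∀ j, fderiv ℝ (ℒ.energy c) w' (v' j) = fderiv ℝ (ℒ.energy c) w (v j) := fun j =>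
      hℒ.fderiv_energy_eq c hw' hw hww (hv' j).1 (hv' j).2
    have h1 : ∀ j, (v' j).1 = (v j).1 := fun j =>
      congrArg (fun q : MMCoord n m k => q.1) (hv' j).2
    have h2 : ∀ j, ∀ I : MIdx n k, (v' j).2.1 I.incl = (v j).2.1 I.incl := fun j I =>
      congrFun (congrArg (fun q : MMCoord n m k => q.2.1) (hv' j).2) I
    have h3 : ∀ j, (v' j).2.2 = (v j).2.2 := fun j =>
      congrArg (fun q : MMCoord n m k => q.2.2) (hv' j).2
    simp only [omega_apply, wedge_apply]
    congr 1
    · refine Finset.sum_congr rfl fun I _ => Finset.sum_congr rfl fun α _ =>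
        Finset.sum_congr rfl fun i _ => congrArg Matrix.det ?_
      ext j l
      refine Fin.cases ?_ (fun l => ?_) l
      · simp [h3, -Fin.cons_update]
      · by_cases hl : l = i
        · subst hl; simp [h2, -Fin.cons_update]
        · simp [hl, h1, -Fin.cons_update]
    · refine congrArg Matrix.det ?_
      ext j l
      refine Fin.cases ?_ (fun l => ?_) l
      · simpa using hE j
      · simp [h1]
  exact huniq _ (Classical.epsilon_spec (p := fun r : ℝ => ∃ w' ∈ ℒ.constraintCoord c,
    forget w' = forget w ∧ ∃ v' : Fin (n + 1) → MixedCoord n m k,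
      (∀ j, v' j ∈ tangentVectors (ℒ.constraintCoord c) w' ∧ forget (v' j) = forget (v j)) ∧
        r = ℒ.omega c w' v') ⟨_, w, hw, rfl, v, fun j => ⟨hv j, rfl⟩, rfl⟩)

/-- The equations `i^{1,n} ω = 0` for horizontal lifts `(∂_i, U_i, P_i)` which are holonomic. -/
lemma i1n_omega_eq {w : MixedCoord n m k} (hw : w ∈ mixedDom c) {X : Fin n → MixedCoord n m k}
    (hX : ∀ i, (X i).1 = EuclideanSpace.single i 1)
    (hol : ∀ (i : Fin n) (I : MIdx n k), (X i).2.1 I.incl = w.2.1 (I.cons i))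
    (a : MIdx n (k + 1) → Fin m → ℝ) (b : MomCoord n m k) :
    i1n (ℒ.omega c w) X (a, b) = (∑ K, ∑ α, a K α * ℒ.defect c w K α) -
      ∑ I : MIdx n k, ∑ α, a I.incl α * ∑ i, (X i).2.2 I α i := by
  have hdX : ∀ i j, dxForm i (X j) = if i = j then 1 else 0 := by
    intro i j
    simp [hX]
  have hdY : ∀ i, dxForm i ((0, (a, b)) : MixedCoord n m k) = 0 := by
    intro i; simp
  simp only [i1n, omega_apply, wedge_cons_cons hdY hdX, wedge_cons_update_cons hdY hdX]
  simp only [ContinuousLinearMap.coe_coe, ℒ.fderiv_energy_vertical c hw, pForm_apply, uForm_apply,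
    hol, Finset.sum_sub_distrib, Finset.mul_sum]
  simp only [mul_comm (b _ _ _)]
  ring

end Lagrangian

end Omega

/-! ### The Hamilton–Jacobi equations along `(∇, T)` -/

section HamiltonJacobi

variable {n m : ℕ}
variable {M : Type*} [TopologicalSpace M] [ChartedSpace (Coord n) M]
variable {E : Type*} [TopologicalSpace E] [ChartedSpace (Coord n × Coord m) E]
variable {π : E → M} {k : ℕ}

/-- The coordinate expression of `T`. -/
noncomputable def MultimomentumSection.momRep (T : MultimomentumSection n m π k)
    (c : AdaptedChart n m π) : JetCoord n m k → MomCoord n m k :=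
  c.rep fun θ => c.momCoord (T.toFun θ)

/-- The coordinate expression of `(∇, T)`. -/
noncomputable def pairRep (D : HolonomicConnection n m π k) (T : MultimomentumSection n m π k)
    (c : AdaptedChart n m π) (z : JetCoord n m k) : MixedCoord n m k :=
  (z.1, ((D.coordRep c z).2, T.momRep c z))

/-- The lift of `∂/∂x^i` along `im (∇, T)`: the image under `d(∇, T)` of the `∇`-lift. -/
noncomputable def pairLift (D : HolonomicConnection n m π k) (T : MultimomentumSection n m π k)
    (c : AdaptedChart n m π) (z : JetCoord n m k) (i : Fin n) : MixedCoord n m k :=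
  fderiv ℝ (pairRep D T c) z (rPlane (D.coordRep c z) (EuclideanSpace.single i 1))

/-- The projection `W → J^k` in coordinates, as a linear map. -/
def jetPart : MixedCoord n m k →L[ℝ] JetCoord n m k :=
  ((ContinuousLinearMap.fst ℝ (Coord n) (MIdx n k → Fin m → ℝ)).comp
      ((ContinuousLinearMap.fst ℝ _ _).prod ((ContinuousLinearMap.fst ℝ _ (MomCoord n m k)).comp
        (ContinuousLinearMap.snd ℝ _ _))) |>.prod
    ((ContinuousLinearMap.fst ℝ _ (MomCoord n m k)).comp
      (ContinuousLinearMap.snd ℝ (Coord n) _))).comp forgetL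

variable (D : HolonomicConnection n m π k) (T : MultimomentumSection n m π k)
variable (c : AdaptedChart n m π)

lemma mixedCoord_pair {θ : Jet n m π k} (h : θ.pt ∈ c.total.source) :
    c.mixedCoord (pair D T θ) = pairRep D T c (c.coord θ) := by
  have h1 : c.coord (D.toFun θ) = D.coordRep c (c.coord θ) := (D.coordRep_coord c h).symm
  have h2 : c.momCoord (T.toFun θ) = T.momRep c (c.coord θ) :=
    (c.rep_coord (fun θ => c.momCoord (T.toFun θ)) h).symm
  have h3 := congrArg Prod.fst (D.truncCoord_coordRep c (c.coord_mem_jetTarget h))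
  exact Prod.ext ((congrArg Prod.fst h1).trans h3) (Prod.ext (congrArg Prod.snd h1) h2)

lemma mmCoord_map {θ : Jet n m π k} (h : θ.pt ∈ c.total.source) :
    c.mmCoord (T.map θ) = forget (pairRep D T c (c.coord θ)) := by
  rw [← mixedCoord_pair D T c h]
  have h1 : c.coord θ = truncCoord (c.coord (D.toFun θ)) := by
    rw [← c.coord_down (by rwa [D.pt_toFun]), D.isSection]
  change ((c.coord θ).1, ((c.coord θ).2, c.momCoord (T.toFun θ))) = _
  rw [h1]
  rfl

lemma contDiffOn_pairRep : ContDiffOn ℝ ∞ (pairRep D T c) (c.jetTarget k) :=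
  contDiff_fst.contDiffOn.prodMk
    ((contDiff_snd.comp_contDiffOn (D.smooth c)).prodMk (T.smooth c))

variable {z : JetCoord n m k} (hz : z ∈ c.jetTarget k)

include hz

lemma forget_pairRep : forget (pairRep D T c z) = (z.1, (z.2, T.momRep c z)) :=
  Prod.ext rfl (Prod.ext (funext fun I => D.coordRep_incl c hz I) rfl)

lemma pairRep_mem_mixedDom : pairRep D T c z ∈ Lagrangian.mixedDom c := by
  have h1 := congrArg Prod.fst (D.truncCoord_coordRep c hz)
  have h2 : ((pairRep D T c z).1, (pairRep D T c z).2.1) = D.coordRep c z := Prod.ext h1.symm rfl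
  change _ ∈ c.jetTarget (k + 1)
  rw [h2]
  exact D.coordRep_mem_jetTarget c hz

lemma hasFDerivAt_pairRep : HasFDerivAt (pairRep D T c) (fderiv ℝ (pairRep D T c) z) z :=
  (((contDiffOn_pairRep D T c).contDiffAt
    (c.isOpen_jetTarget.mem_nhds hz)).differentiableAt (by simp)).hasFDerivAt

lemma jetPart_fderiv_pairRep (v : JetCoord n m k) :
    jetPart (fderiv ℝ (pairRep D T c) z v) = v := by
  have h1 : HasFDerivAt (jetPart ∘ pairRep D T c)
      (jetPart.comp (fderiv ℝ (pairRep D T c) z)) z :=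
    jetPart.hasFDerivAt.comp z (hasFDerivAt_pairRep D T c hz)
  have h2 : jetPart ∘ pairRep D T c =ᶠ[𝓝 z] id := by
    filter_upwards [c.isOpen_jetTarget.mem_nhds hz] with y hy
    exact Prod.ext rfl (funext fun I => D.coordRep_incl c hy I)
  have h3 := h1.unique ((hasFDerivAt_id z).congr_of_eventuallyEq h2)
  exact congrArg (fun L : JetCoord n m k →L[ℝ] JetCoord n m k => L v) h3

lemma fderiv_pairRep_fst (v : JetCoord n m k) : (fderiv ℝ (pairRep D T c) z v).1 = v.1 :=
  congrArg Prod.fst (jetPart_fderiv_pairRep D T c hz v)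

lemma fderiv_pairRep_incl (v : JetCoord n m k) (I : MIdx n k) :
    (fderiv ℝ (pairRep D T c) z v).2.1 I.incl = v.2 I :=
  congrFun (congrArg Prod.snd (jetPart_fderiv_pairRep D T c hz v)) I

lemma pairLift_fst (i : Fin n) : (pairLift D T c z i).1 = EuclideanSpace.single i 1 := by
  rw [pairLift, fderiv_pairRep_fst D T c hz, rPlane_single]

/-- The lifts along `im (∇, T)` are holonomic. -/
lemma pairLift_incl (i : Fin n) (I : MIdx n k) :
    (pairLift D T c z i).2.1 I.incl = (pairRep D T c z).2.1 (I.cons i) := by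
  rw [pairLift, fderiv_pairRep_incl D T c hz, rPlane_single]
  rfl

omit hz

namespace Lagrangian

variable (ℒ : Lagrangian n m π k)

/-- The de Donder–Weyl defect `∂L/∂u_I^α - ∑_{Ji = I} p_α^{J.i} - ∑ D_i p_α^{I.i}`, `|I| ≤ k`, along
`im (∇, T)`. -/
noncomputable def hjResidual (z : JetCoord n m k) (I : MIdx n k) (α : Fin m) : ℝ :=
  ℒ.defect c (pairRep D T c z) I.incl α - ∑ i, (pairLift D T c z i).2.2 I α i

variable {D T c ℒ}

/-- The equations `i^{1,n} ω = 0` at a point of `im (∇, T)` are the constraint together with the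
vanishing of the residuals. -/
lemma i1n_omega_pairLift_eq_zero_iff (hz : z ∈ c.jetTarget k) :
    (∀ Y, i1n (ℒ.omega c (pairRep D T c z)) (pairLift D T c z) Y = 0) ↔
      pairRep D T c z ∈ ℒ.constraintCoord c ∧ ∀ I α, ℒ.hjResidual D T c z I α = 0 := by
  have hdom := pairRep_mem_mixedDom D T c hz
  have key := fun a b => ℒ.i1n_omega_eq c hdom (pairLift_fst D T c hz) (pairLift_incl D T c hz) a b
  rw [mem_constraintCoord_iff]
  constructor
  · intro h
    have hKα : ∀ K α, ∑ K', ∑ α', (Pi.single K (Pi.single α 1) : MIdx n (k + 1) → Fin m → ℝ) K' α' *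
        ℒ.defect c (pairRep D T c z) K' α' = ℒ.defect c (pairRep D T c z) K α := by
      intro K α
      rw [Finset.sum_eq_single_of_mem K (Finset.mem_univ K) (fun K' _ hK' => by simp [hK']),
        Finset.sum_eq_single_of_mem α (Finset.mem_univ α) (fun α' _ hα' => by simp [hα'])]
      simp
    refine ⟨⟨hdom, fun K hK α => ?_⟩, fun I α => ?_⟩
    · have h1 := h (Pi.single K (Pi.single α 1), 0)
      rw [key, hKα] at h1
      rw [← h1, eq_comm, sub_eq_self]
      refine Finset.sum_eq_zero fun I _ => Finset.sum_eq_zero fun α' _ => ?_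
      rw [Pi.single_eq_of_ne (MIdx.incl_ne_of_card hK I).symm]
      simp
    · have h1 := h (Pi.single I.incl (Pi.single α 1), 0)
      rw [key, hKα] at h1
      rw [Finset.sum_eq_single_of_mem I (Finset.mem_univ I) (fun I' _ hI' => by
          rw [Pi.single_eq_of_ne (fun h => hI' (MIdx.incl_injective h))]; simp),
        Finset.sum_eq_single_of_mem α (Finset.mem_univ α) (fun α' _ hα' => by simp [hα'])] at h1
      simpa [hjResidual] using h1
  · rintro ⟨⟨-, h1⟩, h2⟩ ⟨a, b⟩
    rw [key, MIdx.sum_eq_sum_incl _ fun K hK => by simp [h1 K hK], ← Finset.sum_sub_distrib]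
    refine Finset.sum_eq_zero fun I _ => ?_
    rw [← Finset.sum_sub_distrib]
    refine Finset.sum_eq_zero fun α _ => ?_
    have h3 := h2 I α
    rw [hjResidual, sub_eq_zero] at h3
    rw [h3, sub_self]

/-- On `im (∇, T) ⊂ 𝒫` it suffices to test the equations on vectors tangent to `im (∇, T)`. -/
lemma hjResidual_eq_zero_of_tangent (hz : z ∈ c.jetTarget k)
    (hcon : pairRep D T c z ∈ ℒ.constraintCoord c)
    (h : ∀ Y, i1n (ℒ.omega c (pairRep D T c z)) (pairLift D T c z)
      (fderiv ℝ (pairRep D T c) z (0, Y)).2 = 0) (I : MIdx n k) (α : Fin m) :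
    ℒ.hjResidual D T c z I α = 0 := by
  have h1 := h (Pi.single I (Pi.single α 1))
  rw [← Prod.mk.eta (p := (fderiv ℝ (pairRep D T c) z (0, Pi.single I (Pi.single α 1))).2),
    ℒ.i1n_omega_eq c (pairRep_mem_mixedDom D T c hz) (pairLift_fst D T c hz)
      (pairLift_incl D T c hz),
    MIdx.sum_eq_sum_incl _ fun K hK => by
      simp [((ℒ.mem_constraintCoord_iff c).1 hcon).2 K hK], ← Finset.sum_sub_distrib] at h1
  simp only [fderiv_pairRep_incl D T c hz, ← Finset.sum_sub_distrib, ← mul_sub] at h1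
  rw [Finset.sum_eq_single_of_mem I (Finset.mem_univ I) (fun I' _ hI' => by simp [hI']),
    Finset.sum_eq_single_of_mem α (Finset.mem_univ α) (fun α' _ hα' => by simp [hα'])] at h1
  simpa [hjResidual] using h1

variable (ℒ D T) in
/-- The coordinate form of the generalized Hamilton–Jacobi problem, to which all the conditions are
reduced: `im (∇, T) ⊂ 𝒫` and the residuals vanish. -/
def HJCoord : Prop :=
  ∀ c : AdaptedChart n m π, ∀ z ∈ c.jetTarget k,
    pairRep D T c z ∈ ℒ.constraintCoord c ∧ ∀ I α, ℒ.hjResidual D T c z I α = 0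

lemma range_pair_subset_iff : range (pair D T) ⊆ ℒ.constraint ↔
    ∀ c : AdaptedChart n m π, ∀ z ∈ c.jetTarget k, pairRep D T c z ∈ ℒ.constraintCoord c := by
  constructor
  · rintro h c _ ⟨θ, hθ, rfl⟩
    rw [← mixedCoord_pair D T c hθ]
    exact h ⟨θ, rfl⟩ c (show (D.toFun θ).pt ∈ _ from (D.pt_toFun θ).symm ▸ hθ)
  · rintro h _ ⟨θ, rfl⟩ c hc
    change (D.toFun θ).pt ∈ _ at hc
    have hθ : θ.pt ∈ c.total.source := D.pt_toFun θ ▸ hc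
    rw [mixedCoord_pair D T c hθ]
    exact h c _ (c.coord_mem_jetTarget hθ)

lemma pullback_pairRep_cons (η : MixedCoord n m k → (Fin (n + 1) → MixedCoord n m k) → ℝ)
    (hz : z ∈ c.jetTarget k) (Y : MIdx n k → Fin m → ℝ) :
    i1n (pullback (pairRep D T c) η z)
        (fun i => D.lift c (fun _ => EuclideanSpace.single i 1) z) Y =
      i1n (η (pairRep D T c z)) (pairLift D T c z)
        (fderiv ℝ (pairRep D T c) z (0, Y)).2 := by
  unfold i1n pullback
  congr 1
  funext j
  refine Fin.cases ?_ (fun j => ?_) j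
  · exact Prod.ext (fderiv_pairRep_fst D T c hz _) rfl
  · rfl

lemma hjCoord_iff_pairEquation :
    ℒ.HJCoord D T ↔ range (pair D T) ⊆ ℒ.constraint ∧ ℒ.PairEquation D T := by
  rw [range_pair_subset_iff]
  constructor
  · refine fun h => ⟨fun c z hz => (h c z hz).1, fun c z hz Y => ?_⟩
    exact (pullback_pairRep_cons (fun w v => ℒ.omega c w v) hz Y).trans
      ((i1n_omega_pairLift_eq_zero_iff hz).2 (h c z hz) _)
  · rintro ⟨h1, h2⟩ c z hz
    refine ⟨h1 c z hz, hjResidual_eq_zero_of_tangent hz (h1 c z hz) fun Y => ?_⟩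
    exact (pullback_pairRep_cons (fun w v => ℒ.omega c w v) hz Y).symm.trans (h2 c z hz Y)

lemma fderiv_pairRep_mem_tangentVectors
    (hcon : ∀ z ∈ c.jetTarget k, pairRep D T c z ∈ ℒ.constraintCoord c)
    (hz : z ∈ c.jetTarget k) (v : JetCoord n m k) :
    fderiv ℝ (pairRep D T c) z v ∈
      tangentVectors (ℒ.constraintCoord c) (pairRep D T c z) := by
  have hline : ContDiff ℝ ∞ fun t : ℝ => z + t • v :=
    contDiff_const.add (contDiff_id.smul contDiff_const)
  have h0 : z + (0 : ℝ) • v = z := by simp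
  refine ⟨fun t : ℝ => pairRep D T c (z + t • v), by simp, ?_, ?_, ?_⟩
  · have : ∀ᶠ t in 𝓝 (0 : ℝ), z + t • v ∈ c.jetTarget k :=
      hline.continuous.continuousAt.eventually_mem (by
        rw [h0]; exact c.isOpen_jetTarget.mem_nhds hz)
    filter_upwards [this] with t ht using hcon _ ht
  · have h1 : ContDiffAt ℝ ∞ (pairRep D T c) (z + (0 : ℝ) • v) := by
      rw [h0]
      exact (contDiffOn_pairRep D T c).contDiffAt (c.isOpen_jetTarget.mem_nhds hz)
    exact h1.comp (0 : ℝ) hline.contDiffAt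
  · exact ((hasFDerivAt_pairRep D T c hz).hasLineDerivAt v).deriv

/-- Along `im (∇, T) ⊂ 𝒫`, evaluating `ω₀` on projected vectors amounts to evaluating `ω`. -/
lemma IsAdmissible.i1n_omega₀ (hℒ : ℒ.IsAdmissible)
    (hcon : ∀ z ∈ c.jetTarget k, pairRep D T c z ∈ ℒ.constraintCoord c)
    (hz : z ∈ c.jetTarget k) {v : MixedCoord n m k}
    (hv : v ∈ tangentVectors (ℒ.constraintCoord c) (pairRep D T c z)) (hv0 : v.1 = 0) :
    i1n (ℒ.omega₀ c (forget (pairRep D T c z))) (fun i => forget (pairLift D T c z i))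
      (forget v).2 = i1n (ℒ.omega c (pairRep D T c z)) (pairLift D T c z) v.2 := by
  have h1 := hℒ.omega₀_eq c (hcon z hz) (v := Fin.cons v (pairLift D T c z)) (fun j => by
    refine Fin.cases ?_ (fun j => ?_) j
    · exact hv
    · exact fderiv_pairRep_mem_tangentVectors hcon hz _)
  unfold i1n
  have h2 : (Fin.cons ((0 : Coord n), (forget v).2) fun i => forget (pairLift D T c z i)) =
      fun j => forget ((Fin.cons v (pairLift D T c z) : Fin (n + 1) → MixedCoord n m k) j) := by
    funext j
    refine Fin.cases ?_ (fun j => ?_) j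
    · exact Prod.ext hv0.symm rfl
    · rfl
  have h3 : ((0 : Coord n), v.2) = v := Prod.ext hv0.symm rfl
  rw [h2, h1, h3]

lemma IsAdmissible.reducedEquation_iff (hℒ : ℒ.IsAdmissible)
    (hcon : range (pair D T) ⊆ ℒ.constraint) : ℒ.ReducedEquation D T ↔ ℒ.PairEquation D T := by
  rw [range_pair_subset_iff] at hcon
  refine forall_congr' fun c => forall_congr' fun z => forall_congr' fun hz =>
    forall_congr' fun Y => ?_
  refine Eq.congr_left (Eq.trans ?_ (pullback_pairRep_cons (fun w v => ℒ.omega c w v) hz Y).symm)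
  have h1 := hℒ.i1n_omega₀ (hcon c) hz (fderiv_pairRep_mem_tangentVectors (hcon c) hz (0, Y))
    (fderiv_pairRep_fst D T c hz _)
  refine Eq.trans ?_ h1
  have h2 : (fun z : JetCoord n m k => (z.1, (z.2, c.rep (fun θ => c.momCoord (T.toFun θ)) z)))
      =ᶠ[𝓝 z] forgetL ∘ pairRep D T c := by
    filter_upwards [c.isOpen_jetTarget.mem_nhds hz] with y hy
    exact (forget_pairRep D T c hy).symm
  have h3 : fderiv ℝ (fun z : JetCoord n m k =>
      (z.1, (z.2, c.rep (fun θ => c.momCoord (T.toFun θ)) z))) z =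
        forgetL.comp (fderiv ℝ (pairRep D T c) z) := by
    rw [h2.fderiv_eq]
    exact (forgetL.hasFDerivAt.comp z (hasFDerivAt_pairRep D T c hz)).fderiv
  unfold i1n pullback
  rw [h3, forget_pairRep D T c hz]
  congr 1
  funext j
  refine Fin.cases ?_ (fun j => ?_) j
  · exact Prod.ext (fderiv_pairRep_fst D T c hz _) rfl
  · rfl

end Lagrangian

end HamiltonJacobi

/-! ### Solutions along constant sections -/

section ConstantSolutions

variable {n m : ℕ}
variable {M : Type*} [TopologicalSpace M] [ChartedSpace (Coord n) M]
variable {E : Type*} [TopologicalSpace E] [ChartedSpace (Coord n × Coord m) E]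
variable {π : E → M} {k : ℕ}
variable {D : HolonomicConnection n m π k} {T : MultimomentumSection n m π k}
variable {c : AdaptedChart n m π} {ℒ : Lagrangian n m π k}
variable {U : Set M} {σ : M → Jet n m π k}

lemma HolonomicConnection.IsConstant.eventually_mem_source (hσ : D.IsConstant U σ) {x : M}
    (hx : x ∈ U) (h : (σ x).pt ∈ c.total.source) :
    (∀ᶠ y in 𝓝 (c.base x), (σ (c.base.symm y)).pt ∈ c.total.source) ∧
      c.base.symm (c.base x) = x := by
  obtain ⟨⟨hU, hπ, hcont, -⟩, -⟩ := hσ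
  have h1 := c.base_mem_target h
  have h2 := c.base_symm_base h
  rw [hπ x hx] at h1 h2
  refine ⟨?_, h2⟩
  have h3 : ContinuousAt (fun x => (σ x).pt) (c.base.symm (c.base x)) := by
    rw [h2]; exact hcont.continuousAt (hU.mem_nhds hx)
  have h4 := ContinuousAt.comp (f := c.base.symm) h3 (c.base.continuousAt_symm h1)
  refine h4.eventually_mem (c.total.open_source.mem_nhds ?_)
  simpa [h2] using h

lemma HolonomicConnection.IsConstant.hasFDerivAt_coord (hσ : D.IsConstant U σ) {x : M}
    (hx : x ∈ U) (h : (σ x).pt ∈ c.total.source) :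
    HasFDerivAt (fun y => c.coord (σ (c.base.symm y)))
      (rPlane (D.coordRep c (c.coord (σ x)))) (c.base x) := by
  have h1 := ((hσ.1.2.2.2 x hx c h).differentiableAt (by simp)).hasFDerivAt
  rw [hσ.2 x hx c h] at h1
  rwa [D.coordRep_coord c h]

/-- The pair `(∇, T)` along a constant section, in coordinates. -/
lemma HolonomicConnection.IsConstant.mixedCoord_eventuallyEq (hσ : D.IsConstant U σ) {x : M}
    (hx : x ∈ U) (h : (σ x).pt ∈ c.total.source) :
    (fun y => c.mixedCoord (pair D T (σ (c.base.symm y)))) =ᶠ[𝓝 (c.base x)]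
      fun y => pairRep D T c (c.coord (σ (c.base.symm y))) := by
  filter_upwards [(hσ.eventually_mem_source hx h).1] with y hy using mixedCoord_pair D T c hy

lemma HolonomicConnection.IsConstant.mmCoord_eventuallyEq (hσ : D.IsConstant U σ) {x : M}
    (hx : x ∈ U) (h : (σ x).pt ∈ c.total.source) :
    (fun y => c.mmCoord (T.map (σ (c.base.symm y)))) =ᶠ[𝓝 (c.base x)]
      fun y => forgetL (pairRep D T c (c.coord (σ (c.base.symm y)))) := by
  filter_upwards [(hσ.eventually_mem_source hx h).1] with y hy using mmCoord_map D T c hy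

lemma HolonomicConnection.IsConstant.contDiffAt_pairRep (hσ : D.IsConstant U σ) {x : M}
    (hx : x ∈ U) (h : (σ x).pt ∈ c.total.source) :
    ContDiffAt ℝ ∞ (fun y => pairRep D T c (c.coord (σ (c.base.symm y)))) (c.base x) := by
  have h1 := hσ.1.2.2.2 x hx c h
  have h2 : ContDiffAt ℝ ∞ (pairRep D T c) (c.coord (σ (c.base.symm (c.base x)))) := by
    rw [(hσ.eventually_mem_source hx h).2]
    exact (contDiffOn_pairRep D T c).contDiffAt
      (c.isOpen_jetTarget.mem_nhds (c.coord_mem_jetTarget h))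
  exact h2.comp (c.base x) h1

lemma HolonomicConnection.IsConstant.hasFDerivAt_pairRep (hσ : D.IsConstant U σ) {x : M}
    (hx : x ∈ U) (h : (σ x).pt ∈ c.total.source) :
    HasFDerivAt (fun y => pairRep D T c (c.coord (σ (c.base.symm y))))
      ((fderiv ℝ (pairRep D T c) (c.coord (σ x))).comp
        (rPlane (D.coordRep c (c.coord (σ x))))) (c.base x) := by
  have h2 : HasFDerivAt (pairRep D T c) (fderiv ℝ (pairRep D T c) (c.coord (σ x)))
      (c.coord (σ (c.base.symm (c.base x)))) := by
    rw [(hσ.eventually_mem_source hx h).2]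
    exact HJ.hasFDerivAt_pairRep D T c (c.coord_mem_jetTarget h)
  exact h2.comp (c.base x) (hσ.hasFDerivAt_coord hx h)

lemma HolonomicConnection.IsConstant.partials_mixedCoord (hσ : D.IsConstant U σ) {x : M}
    (hx : x ∈ U) (h : (σ x).pt ∈ c.total.source) :
    partials (fun y => c.mixedCoord (pair D T (σ (c.base.symm y)))) (c.base x) =
      pairLift D T c (c.coord (σ x)) := by
  funext i
  rw [partials, (hσ.mixedCoord_eventuallyEq hx h).fderiv_eq,
    (hσ.hasFDerivAt_pairRep hx h).fderiv]
  rfl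

lemma HolonomicConnection.IsConstant.partials_mmCoord (hσ : D.IsConstant U σ) {x : M}
    (hx : x ∈ U) (h : (σ x).pt ∈ c.total.source) :
    partials (fun y => c.mmCoord (T.map (σ (c.base.symm y)))) (c.base x) =
      fun i => forget (pairLift D T c (c.coord (σ x)) i) := by
  funext i
  rw [partials, (hσ.mmCoord_eventuallyEq hx h).fderiv_eq]
  exact congrArg (fun L : Coord n →L[ℝ] MMCoord n m k => L (EuclideanSpace.single i 1))
    (forgetL.hasFDerivAt.comp (c.base x) (hσ.hasFDerivAt_pairRep (T := T) hx h)).fderiv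

lemma HolonomicConnection.IsFlat.exists_isConstant (hD : D.IsFlat) {θ : Jet n m π k}
    (h : θ.pt ∈ c.total.source) :
    ∃ (U : Set M) (σ : M → Jet n m π k), D.IsConstant U σ ∧ ∃ x ∈ U, σ x = θ := by
  obtain ⟨s, x, hx, hθ, -, hs⟩ := hD.exists_section c h
  exact ⟨s.dom, s.jetMap θ, D.isConstant_jetMap s θ hs, x, hx,
    (s.jetMap_of_mem θ hx).trans hθ⟩

namespace Lagrangian

/-- The `∇`-constant sections fill `J^k`, so the Euler–Lagrange–Hamilton equations along all of them
are equations on `J^k`. -/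
lemma solvesHJ_iff_hjCoord (hD : D.IsFlat) : ℒ.SolvesHJ D T ↔ ℒ.HJCoord D T := by
  constructor
  · rintro ⟨-, h⟩ c _ ⟨θ, hθ, rfl⟩
    obtain ⟨U, σ, hσ, x, hx, rfl⟩ := hD.exists_isConstant hθ
    refine (i1n_omega_pairLift_eq_zero_iff (c.coord_mem_jetTarget hθ)).1 fun Y => ?_
    have h1 := (h U σ hσ).2 x hx c (show (D.toFun (σ x)).pt ∈ _ by rwa [D.pt_toFun]) Y
    rwa [hσ.partials_mixedCoord hx hθ, mixedCoord_pair D T c hθ] at h1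
  · refine fun h => ⟨hD, fun U σ hσ => ?_⟩
    have hpt : ∀ x, (pair D T (σ x)).pt = (σ x).pt := fun x => D.pt_toFun (σ x)
    refine ⟨⟨hσ.1.1, fun x hx => ?_, ?_, fun x hx c hc => ?_⟩, fun x hx c hc Y => ?_⟩
    · rw [hpt]; exact hσ.1.2.1 x hx
    · simp only [hpt]; exact hσ.1.2.2.1
    · rw [hpt] at hc
      exact (hσ.contDiffAt_pairRep hx hc).congr_of_eventuallyEq (hσ.mixedCoord_eventuallyEq hx hc)
    · rw [hpt] at hc
      rw [hσ.partials_mixedCoord hx hc, mixedCoord_pair D T c hc]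
      have hz := c.coord_mem_jetTarget hc
      exact (i1n_omega_pairLift_eq_zero_iff hz).2 (h c _ hz) Y

lemma IsAdmissible.hjCoord_iff_solvesHDW (hℒ : ℒ.IsAdmissible) (hD : D.IsFlat) :
    ℒ.HJCoord D T ↔ range (pair D T) ⊆ ℒ.constraint ∧
      ∀ (U : Set M) (σ : M → Jet n m π k), D.IsConstant U σ →
        ℒ.SolvesHDW U fun x => T.map (σ x) := by
  constructor
  · intro h
    have hcon : range (pair D T) ⊆ ℒ.constraint :=
      range_pair_subset_iff.2 fun c z hz => (h c z hz).1
    refine ⟨hcon, fun U σ hσ => ⟨⟨hσ.1.1, hσ.1.2.1, hσ.1.2.2.1, fun x hx c hc => ?_⟩,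
      fun x _ => ⟨pair D T (σ x), hcon ⟨σ x, rfl⟩, rfl⟩, fun x hx c hc Y hY => ?_⟩⟩
    · exact (forgetL.contDiff.contDiffAt.comp _
        (hσ.contDiffAt_pairRep (T := T) hx hc)).congr_of_eventuallyEq
          (hσ.mmCoord_eventuallyEq hx hc)
    · change (σ x).pt ∈ _ at hc
      have hz := c.coord_mem_jetTarget hc
      rw [mmCoord_map D T c hc] at hY
      obtain ⟨v, hv, hvY⟩ := (hℒ c).2.1 _ (h c _ hz).1 _ hY
      rw [hσ.partials_mmCoord hx hc, mmCoord_map D T c hc]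
      have h1 := hℒ.i1n_omega₀ (fun z hz => (h c z hz).1) hz hv
        (congrArg Prod.fst hvY)
      rw [hvY] at h1
      exact h1.trans ((i1n_omega_pairLift_eq_zero_iff hz).2 (h c _ hz) _)
  · rintro ⟨hcon, h⟩ c _ ⟨θ, hθ, rfl⟩
    rw [range_pair_subset_iff] at hcon
    have hz := c.coord_mem_jetTarget hθ
    refine ⟨hcon c _ hz, hjResidual_eq_zero_of_tangent hz (hcon c _ hz) fun Y => ?_⟩
    obtain ⟨U, σ, hσ, x, hx, rfl⟩ := hD.exists_isConstant hθ
    have hv := fderiv_pairRep_mem_tangentVectors (hcon c) hz (0, Y)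
    have hv0 := fderiv_pairRep_fst D T c hz (0, Y)
    have h1 := (h U σ hσ).2.2 x hx c hθ (forget (fderiv ℝ (pairRep D T c) _ (0, Y))).2 (by
      rw [mmCoord_map D T c hθ]
      have h2 := map_mem_tangentVectors (F := forgetL) hv
      have h3 : ((0 : Coord n), (forget (fderiv ℝ (pairRep D T c) (c.coord (σ x)) (0, Y))).2) =
        forgetL (fderiv ℝ (pairRep D T c) (c.coord (σ x)) (0, Y)) := Prod.ext hv0.symm rfl
      rw [h3]
      exact h2)
    rw [hσ.partials_mmCoord hx hθ, mmCoord_map D T c hθ,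
      hℒ.i1n_omega₀ (hcon c) hz hv hv0] at h1
    exact h1

end Lagrangian

end ConstantSolutions

/-! ### Constant sections and the Euler–Lagrange equations -/

section EulerLagrange

variable {n m : ℕ}
variable {M : Type*} [TopologicalSpace M] [ChartedSpace (Coord n) M]
variable {E : Type*} [TopologicalSpace E] [ChartedSpace (Coord n × Coord m) E]
variable {π : E → M} {k : ℕ}

lemma pdMulti_pd {s : Set (Coord n)} {f : Coord n → ℝ} (hs : IsOpen s) (hf : ContDiffOn ℝ ∞ f s)
    (i : Fin n) (I : Multiset (Fin n)) : EqOn (pdMulti I (pd i f)) (pdMulti (i ::ₘ I) f) s := by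
  intro y hy
  have h1 : EqOn (pd i f) (pdMulti {i} f) s := by
    intro y hy
    rw [← Multiset.cons_zero, pdMulti_cons hs hf i 0 hy, pdMulti_zero]
  rw [eqOn_pdMulti hs h1 I hy, ← pdMulti_add hs hf I {i} hy, ← Multiset.singleton_add, add_comm]

/-- If `a_K = ∑_{Ji = K} P_{J,i} + ∑_i ∂_i P_{K,i}` (the last sum being absent for `|K| = k + 1`),
then `∑ (-1)^{|K|} ∂_K a_K` telescopes to zero. -/
lemma sum_neg_one_pow_pdMulti_eq_zero {s : Set (Coord n)} (hs : IsOpen s)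
    {P : MIdx n k → Fin n → Coord n → ℝ} (hP : ∀ I i, ContDiffOn ℝ ∞ (P I i) s)
    {a : MIdx n (k + 1) → Coord n → ℝ}
    (hincl : ∀ y ∈ s, ∀ I : MIdx n k, a I.incl y =
      (∑ J : MIdx n k, ∑ i, if J.cons i = I.incl then P J i y else 0) + ∑ i, pd i (P I i) y)
    (htop : ∀ y ∈ s, ∀ K : MIdx n (k + 1), K.1.card = k + 1 → a K y =
      ∑ J : MIdx n k, ∑ i, if J.cons i = K then P J i y else 0) {y : Coord n} (hy : y ∈ s) :
    ∑ K : MIdx n (k + 1), (-1 : ℝ) ^ K.1.card * pdMulti K.1 (a K) y = 0 := by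
  -- both kinds of terms of `a_K` are put into one linear combination over the pairs `(J, i)`
  let ι : Type := (MIdx n k × Fin n) ⊕ (MIdx n k × Fin n)
  let f : ι → Coord n → ℝ := Sum.elim (fun q => P q.1 q.2) (fun q => pd q.2 (P q.1 q.2))
  let w : MIdx n (k + 1) → ι → ℝ := fun K => Sum.elim
    (fun q => if q.1.cons q.2 = K then 1 else 0) (fun q => if q.1.incl = K then 1 else 0)
  have hf : ∀ q ∈ (Finset.univ : Finset ι), ContDiffOn ℝ ∞ (f q) s := by
    rintro (q | q) -
    · exact hP _ _
    · exact contDiffOn_pd hs (hP _ _) _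
  have ha : ∀ K, EqOn (a K) (fun y => ∑ q, w K q * f q y) s := by
    intro K y hy
    simp only [w, f, ι, Fintype.sum_sum_type, Sum.elim_inl, Sum.elim_inr, Fintype.sum_prod_type,
      ite_mul, one_mul, zero_mul]
    by_cases hK : K.1.card = k + 1
    · rw [htop y hy K hK, left_eq_add]
      refine Finset.sum_eq_zero fun I _ => Finset.sum_eq_zero fun i _ => ?_
      rw [if_neg (MIdx.incl_ne_of_card hK I).symm]
    · obtain ⟨I, rfl⟩ : ∃ I : MIdx n k, K = I.incl := by
        by_contra hne
        exact hK (MIdx.card_eq_of_ne_incl fun I h => hne ⟨I, h⟩)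
      rw [hincl y hy I]
      congr 1
      rw [Finset.sum_eq_single_of_mem I (Finset.mem_univ I) fun I' _ hI' =>
        Finset.sum_eq_zero fun i _ => if_neg fun h => hI' (MIdx.incl_injective h)]
      simp
  have h1 : ∀ K : MIdx n (k + 1), (-1 : ℝ) ^ K.1.card * pdMulti K.1 (a K) y =
      ∑ q, (-1 : ℝ) ^ K.1.card * (w K q * pdMulti K.1 (f q) y) := by
    intro K
    rw [eqOn_pdMulti hs (ha K) K.1 hy, pdMulti_finsum hs _ f (w K) hf K.1 hy, Finset.mul_sum]
  simp only [h1]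
  rw [Finset.sum_comm]
  simp only [ι, f, w, Fintype.sum_sum_type, Sum.elim_inl, Sum.elim_inr, ite_mul, one_mul, zero_mul,
    mul_ite, mul_zero, Finset.sum_ite_eq, Finset.mem_univ, if_true]
  rw [← Finset.sum_add_distrib]
  refine Finset.sum_eq_zero fun q _ => ?_
  simp only [MIdx.cons, MIdx.incl, Multiset.card_cons]
  rw [pdMulti_pd hs (hP _ _) _ _ hy]
  ring

variable {D : HolonomicConnection n m π k} {T : MultimomentumSection n m π k}
variable {ℒ : Lagrangian n m π k} {t : LocalSection n m π}

/-- The equation `∇ ∘ j_k t = j_{k+1} t` in coordinates. -/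
lemma HolonomicConnection.prolong_eq_coordRep
    (ht : ∀ x (hx : x ∈ t.dom), D.toFun (t.jet k x hx) = t.jet (k + 1 : ℕ) x hx)
    (c : AdaptedChart n m π) {y : Coord n} (hy : y ∈ c.domIn t) :
    c.prolong k t.toFun y ∈ c.jetTarget k ∧
      D.coordRep c (c.prolong k t.toFun y) = c.prolong (k + 1) t.toFun y := by
  have h1 := c.coord_jet (k := k) t hy.2.1 hy.2.2
  rw [c.base.right_inv hy.1] at h1
  refine ⟨h1 ▸ c.coord_mem_jetTarget hy.2.2, ?_⟩
  rw [← h1, D.coordRep_coord c (θ := t.jet k _ hy.2.1) hy.2.2, ht, c.coord_jet t hy.2.1 hy.2.2,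
    c.base.right_inv hy.1]

/-- The `∇`-constant sections are solutions of the Euler–Lagrange equations: along them the momenta
`T` express `∂L/∂u_K` as a sum of terms that cancel in the Euler–Lagrange expression. -/
theorem Lagrangian.HJCoord.eulerLagrange_eq_zero (h : ℒ.HJCoord D T)
    (ht : ∀ x (hx : x ∈ t.dom), D.toFun (t.jet k x hx) = t.jet (k + 1 : ℕ) x hx)
    (c : AdaptedChart n m π) (α : Fin m) {y : Coord n} (hy : y ∈ c.domIn t) :
    ℒ.eulerLagrange c t.toFun α y = 0 := by
  have hS := c.isOpen_domIn t
  have hpr := fun (y : Coord n) (hy : y ∈ c.domIn t) =>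
    HolonomicConnection.prolong_eq_coordRep ht c hy
  have hsm : ContDiffOn ℝ ∞ (fun y => pairRep D T c (c.prolong k t.toFun y)) (c.domIn t) :=
    (contDiffOn_pairRep D T c).comp (c.contDiffOn_prolong t k) fun y hy => (hpr y hy).1
  have hz : ∀ y ∈ c.domIn t, ((pairRep D T c (c.prolong k t.toFun y)).1,
      (pairRep D T c (c.prolong k t.toFun y)).2.1) = c.prolong (k + 1) t.toFun y := by
    intro y hy
    rw [← (hpr y hy).2]
    exact Prod.ext (congrArg Prod.fst (D.truncCoord_coordRep c (hpr y hy).1)).symm rfl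
  have hlift : ∀ y ∈ c.domIn t, ∀ (I : MIdx n k) (i : Fin n),
      (pairLift D T c (c.prolong k t.toFun y) i).2.2 I α i =
        pd i (fun y => T.momRep c (c.prolong k t.toFun y) I α i) y := by
    intro y hy I i
    have h1 : HasFDerivAt (c.prolong k t.toFun)
        (rPlane (D.coordRep c (c.prolong k t.toFun y))) y := by
      rw [(hpr y hy).2, ← c.fderiv_prolong t hy]
      exact (((c.contDiffOn_prolong t k).contDiffAt (hS.mem_nhds hy)).differentiableAt
        (by simp)).hasFDerivAt
    have h2 := (pForm I α i).hasFDerivAt.comp y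
      ((hasFDerivAt_pairRep D T c (hpr y hy).1).comp y h1)
    exact (congrArg (fun L : Coord n →L[ℝ] ℝ => L (EuclideanSpace.single i 1)) h2.fderiv).symm
  refine sum_neg_one_pow_pdMulti_eq_zero hS
    (P := fun I i y => T.momRep c (c.prolong k t.toFun y) I α i)
    (fun I i => (pForm I α i).contDiff.comp_contDiffOn hsm) (fun y hy I => ?_)
    (fun y hy K hK => ?_) hy
  · have h1 := (h c _ (hpr y hy).1).2 I α
    simp only [hjResidual, defect, hz y hy, hlift y hy] at h1
    rw [sub_sub, sub_eq_zero] at h1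
    exact h1
  · have h1 := (h c _ (hpr y hy).1).1.2 K hK α
    rw [hz y hy] at h1
    exact h1

/-- The jets of a section that solves the Euler–Lagrange equations lie in their infinite
prolongation. -/
lemma Lagrangian.jet_mem_diffiety
    (h : ∀ (c : AdaptedChart n m π) (α : Fin m), ∀ y ∈ c.domIn t,
      ℒ.eulerLagrange c t.toFun α y = 0) {x : M} (hx : x ∈ t.dom) :
    t.jet ⊤ x hx ∈ ℒ.diffiety := by
  have hEL : ∀ x (hx : x ∈ t.dom), t.jet _ x hx ∈ ℒ.eulerLagrangeEq := fun x hx =>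
    ⟨t, x, hx, rfl, fun c hc α => h c α _ (c.mem_domIn t hx hc).1⟩
  refine ⟨t, x, hx, rfl, hEL x hx, fun c hc V f hV hxV _ hfS I => ?_⟩
  have hS := (c.isOpen_domIn t).mem_nhds (c.mem_domIn t hx hc).1
  have hcont := ((c.contDiffOn_prolong t (2 * (k + 1))).contDiffAt hS).continuousAt
  have hzero : (fun y => f (c.prolong (2 * (k + 1)) t.toFun y)) =ᶠ[𝓝 (c.base x)]
      (0 : Coord n → ℝ) := by
    filter_upwards [hS, hcont.eventually_mem (hV.mem_nhds hxV)] with y hy hyV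
    have h1 := c.coord_jet (k := 2 * (k + 1)) t hy.2.1 hy.2.2
    rw [c.base.right_inv hy.1] at h1
    have h2 := hfS _ (hEL _ hy.2.1) hy.2.2 (h1 ▸ hyV)
    rwa [h1] at h2
  rw [pdMulti_congr hzero, pdMulti, foldr_pd_zero]
  rfl

/-- All derivatives of a section `s` which is tangent to `im ∇` up to infinite order are determined
by `∇` and by its derivatives of order at most `k`. -/
lemma InfinitelyTangent.pdMulti_localRep_eq {s : LocalSection n m π} {x : M} {hx : x ∈ s.dom}
    (hs : InfinitelyTangent (range D.toFun) s x hx) (hx' : x ∈ t.dom)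
    (ht : ∀ x (hx : x ∈ t.dom), D.toFun (t.jet k x hx) = t.jet (k + 1 : ℕ) x hx)
    {c : AdaptedChart n m π} (hc : s.toFun x ∈ c.total.source) (hc' : t.toFun x ∈ c.total.source)
    (hjet : t.jet k x hx' = s.jet k x hx) (I : Multiset (Fin n)) (α : Fin m) :
    pdMulti I (c.localRep s.toFun α) (c.base x) = pdMulti I (c.localRep t.toFun α) (c.base x) := by
  set y₀ := c.base x with hy₀
  have hys := (c.mem_domIn s hx hc).1
  have hyt := (c.mem_domIn t hx' hc').1
  -- both sections are smooth on a common neighbourhood of `y₀`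
  set S := c.domIn s ∩ c.domIn t with hSdef
  have hS : IsOpen S := (c.isOpen_domIn s).inter (c.isOpen_domIn t)
  have hyS : y₀ ∈ S := ⟨hys, hyt⟩
  have hss : ∀ α, ContDiffOn ℝ ∞ (c.localRep s.toFun α) S := fun α =>
    (c.contDiffOn_localRep s α).mono inter_subset_left
  have hts : ∀ α, ContDiffOn ℝ ∞ (c.localRep t.toFun α) S := fun α =>
    (c.contDiffOn_localRep t α).mono inter_subset_right
  have hps : ContDiffAt ℝ ∞ (c.prolong k s.toFun) y₀ :=
    (c.contDiffOn_prolong s k).contDiffAt ((c.isOpen_domIn s).mem_nhds hys)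
  have hpt : ContDiffAt ℝ ∞ (c.prolong k t.toFun) y₀ :=
    (c.contDiffOn_prolong t k).contDiffAt ((c.isOpen_domIn t).mem_nhds hyt)
  have hcoord : c.prolong k t.toFun y₀ = c.prolong k s.toFun y₀ := by
    rw [hy₀, ← c.coord_jet t hx' hc', ← c.coord_jet s hx hc, hjet]
  have hz₀ : c.prolong k s.toFun y₀ ∈ c.jetTarget k := by
    rw [hy₀, ← c.coord_jet s hx hc]; exact c.coord_mem_jetTarget hc
  have main : ∀ r : ℕ, k ≤ r → ∀ I : Multiset (Fin n), I.card ≤ r → ∀ α,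
      pdMulti I (c.localRep s.toFun α) y₀ = pdMulti I (c.localRep t.toFun α) y₀ := by
    intro r hr
    induction r, hr using Nat.le_induction with
    | base =>
      intro I hI α
      exact (congrFun (congrFun (congrArg Prod.snd hcoord) ⟨I, hI⟩) α).symm
    | succ r hr ih =>
      intro I hI α
      rcases Nat.lt_or_ge I.card (r + 1) with hlt | hge
      · exact ih I (by omega) α
      obtain ⟨I', K, rfl, hK⟩ : ∃ I' K : Multiset (Fin n), I' + K = I ∧ K.card = k + 1 := by
        induction I using Quotient.inductionOn with
        | h l =>
          refine ⟨(l.take (l.length - (k + 1)) : List (Fin n)),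
            (l.drop (l.length - (k + 1)) : List (Fin n)), ?_, ?_⟩
          · rw [Multiset.coe_add, List.take_append_drop]; rfl
          · have : k + 1 ≤ l.length := by
              simp only [Multiset.quot_mk_to_coe, Multiset.coe_card] at hge; omega
            simp only [Multiset.coe_card, List.length_drop]; omega
      have hI' : I'.card ≤ r - k := by rw [Multiset.card_add] at hI; omega
      -- `g` is the component `∇_K^α`, so that `im ∇` is given by the equations `u_K^α = g`
      let K' : MIdx n (k + 1) := ⟨K, hK.le⟩
      let g : JetCoord n m k → ℝ := fun z => (D.coordRep c z).2 K' α
      have hg : ContDiffOn ℝ ∞ g (c.jetTarget k) :=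
        contDiffOn_pi.1 (contDiffOn_pi.1 (contDiff_snd.comp_contDiffOn (D.smooth c)) K') α
      have hgz : ContDiffAt ℝ ∞ g (c.prolong k s.toFun y₀) :=
        hg.contDiffAt (c.isOpen_jetTarget.mem_nhds hz₀)
      have hgs : ContDiffOn ℝ ∞ (fun y => g (c.prolong k s.toFun y)) S := by
        refine hg.comp ((c.contDiffOn_prolong s k).mono inter_subset_left) fun y hy => ?_
        have h1 := c.coord_jet (k := k) s hy.1.2.1 hy.1.2.2
        rw [c.base.right_inv hy.1.1] at h1
        exact h1 ▸ c.coord_mem_jetTarget hy.1.2.2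
      have hgt : ContDiffOn ℝ ∞ (fun y => g (c.prolong k t.toFun y)) S :=
        hg.comp ((c.contDiffOn_prolong t k).mono inter_subset_right) fun y hy =>
          (HolonomicConnection.prolong_eq_coordRep ht c hy.2).1
      -- the Taylor polynomials of `j_k s` and `j_k t` agree up to order `r - k`
      have hagree : AgreeAt (r - k) (c.prolong k s.toFun) (c.prolong k t.toFun) y₀ := by
        refine AgreeAt.of_clm (ι := Option (MIdx n k × Fin m)) (X := Coord n × ℝ)
          (fun o => o.elim
            ((ContinuousLinearMap.inl ℝ _ _).comp (ContinuousLinearMap.fst ℝ _ _))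
            (fun q => (ContinuousLinearMap.inr ℝ _ _).comp
              (((ContinuousLinearMap.proj (R := ℝ) (φ := fun _ : Fin m => ℝ) q.2).comp
                (ContinuousLinearMap.proj (R := ℝ) (φ := fun _ : MIdx n k => Fin m → ℝ) q.1)).comp
                  (ContinuousLinearMap.snd ℝ _ _)))) ?_ hps hpt ?_
        · intro w w' hw
          have h0 := hw none
          have h1 := fun q => hw (some q)
          simp only [Option.elim] at h0 h1
          refine Prod.ext (congrArg (fun p : Coord n × ℝ => p.1) h0) ?_
          funext J β
          exact congrArg (fun p : Coord n × ℝ => p.2) (h1 (J, β))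
        · rintro (_ | ⟨J, β⟩)
          · exact AgreeAt.refl _ _ _
          · have h1 : AgreeAt (r - k) (pdMulti J.1 (c.localRep s.toFun β))
                (pdMulti J.1 (c.localRep t.toFun β)) y₀ := by
              refine agreeAt_of_pdMulti hS (contDiffOn_pdMulti hS (hss β) _)
                (contDiffOn_pdMulti hS (hts β) _) hyS fun I'' hI'' => ?_
              rw [← pdMulti_add hS (hss β) _ _ hyS, ← pdMulti_add hS (hts β) _ _ hyS]
              refine ih _ ?_ β
              have := J.2
              rw [Multiset.card_add]; omega
            exact AgreeAt.comp (f := pdMulti J.1 (c.localRep s.toFun β))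
              (f' := pdMulti J.1 (c.localRep t.toFun β))
              ((contDiffOn_pdMulti hS (hss β) _).contDiffAt (hS.mem_nhds hyS))
              ((contDiffOn_pdMulti hS (hts β) _).contDiffAt (hS.mem_nhds hyS))
              (ContinuousLinearMap.inr ℝ (Coord n) ℝ).contDiff.contDiffAt
              (ContinuousLinearMap.inr ℝ (Coord n) ℝ).contDiff.contDiffAt h1 (AgreeAt.refl _ _ _)
      have hcomp : pdMulti I' (fun y => g (c.prolong k s.toFun y)) y₀ =
          pdMulti I' (fun y => g (c.prolong k t.toFun y)) y₀ :=
        (AgreeAt.comp hps hpt hgz hgz hagree (AgreeAt.refl _ _ _)).pdMulti_eq hS hgs hgt hyS hI'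
      have htK : EqOn (pdMulti K (c.localRep t.toFun α))
          (fun y => g (c.prolong k t.toFun y)) S := by
        intro y hy
        exact (congrFun (congrFun (congrArg Prod.snd
          (HolonomicConnection.prolong_eq_coordRep ht c hy.2).2) K') α).symm
      -- the function `u_K^α - ∇_K^α` vanishes on `im ∇`
      have hsK := hs.2 c hc (c.jetTarget (k + 1))
        (fun z => z.2 K' α - g (truncCoord z)) c.isOpen_jetTarget
        (by rw [← c.coord_jet s hx hc]
            exact c.coord_mem_jetTarget (θ := s.jet (k + 1 : ℕ) x hx) hc)
        (by
          refine ContDiffOn.sub ?_ (hg.comp ?_ fun z hz => c.truncCoord_mem_jetTarget_iff.2 hz)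
          · exact ((contDiff_apply_apply ℝ ℝ K' α).comp contDiff_snd).contDiffOn
          · refine ContDiff.contDiffOn (contDiff_fst.prodMk ?_)
            exact contDiff_pi.2 fun J => (contDiff_apply ℝ _ J.incl).comp contDiff_snd)
        (by
          rintro _ ⟨θ, rfl⟩ hθ -
          have hθ' : θ.pt ∈ c.total.source := D.pt_toFun θ ▸ hθ
          have h1 : truncCoord (c.coord (D.toFun θ)) = c.coord θ := by
            rw [← c.coord_down hθ, D.isSection]
          simp only [g, h1, D.coordRep_coord c hθ', sub_self]) I'
      -- the derivative of the difference, as of a linear combination with coefficients `1` and `-1`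
      have hsum := pdMulti_finsum hS Finset.univ
        (fun b : Bool => if b then pdMulti K (c.localRep s.toFun α)
          else fun y => g (c.prolong k s.toFun y)) (fun b => if b then 1 else -1)
        (fun b _ => by
          cases b
          · exact hgs
          · exact contDiffOn_pdMulti hS (hss α) K) I' hyS
      simp only [Fintype.univ_bool, Finset.mem_singleton, Bool.true_eq_false, not_false_eq_true,
        Finset.sum_insert, Finset.sum_singleton, if_true, one_mul, Bool.false_eq_true, if_false,
        neg_one_mul, ← sub_eq_add_neg] at hsum
      have hsK' : pdMulti I' (fun y => pdMulti K (c.localRep s.toFun α) y -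
          g (c.prolong k s.toFun y)) y₀ = 0 := hsK
      rw [hsum, sub_eq_zero] at hsK'
      rw [pdMulti_add hS (hss α) _ _ hyS, pdMulti_add hS (hts α) _ _ hyS, hsK', hcomp,
        eqOn_pdMulti hS htK I' hyS]
  exact main (max k I.card) (le_max_left _ _) I (le_max_right _ _) α

/-- A point of `𝒴_∞^∇` is the infinite jet of the `∇`-constant section with the same `k`-jet. -/
theorem Lagrangian.HJCoord.diffiety_subset (h : ℒ.HJCoord D T) (hD : D.IsFlat) :
    D.diffiety ⊆ ℒ.diffiety := by
  rintro Θ ⟨s, x, hx, rfl, hs⟩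
  by_cases hex : ∃ c : AdaptedChart n m π, s.toFun x ∈ c.total.source
  · obtain ⟨c, hc⟩ := hex
    obtain ⟨t, x', hx', hjet, -, ht⟩ := hD.exists_section c (θ₀ := s.jet k x hx) hc
    have hval : t.toFun x' = s.toFun x := congrArg Jet.pt hjet
    obtain rfl : x' = x := by rw [← t.isSection x' hx', hval, s.isSection x hx]
    have h1 : s.jet ⊤ x' hx = t.jet ⊤ x' hx' :=
      s.jet_eq_of_chart c t hx hx' hc (hval ▸ hc) fun I _ α =>
        hs.pdMulti_localRep_eq hx' ht hc (hval ▸ hc) hjet I α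
    rw [h1]
    exact ℒ.jet_mem_diffiety (fun c α y hy => h.eulerLagrange_eq_zero ht c α hy) hx'
  · -- without adapted charts around the point, the conditions that define the diffiety are void
    exact ⟨s, x, hx, rfl, ⟨s, x, hx, rfl, fun c hc => (hex ⟨c, hc⟩).elim⟩,
      fun c hc => (hex ⟨c, hc⟩).elim⟩

end EulerLagrange

end HJ

theorem mainTheorem1 {n m k : ℕ} (hn : 0 < n)
    {M : Type*} [TopologicalSpace M] [ChartedSpace (EuclideanSpace ℝ (Fin n)) M]
    [IsManifold 𝓘(ℝ, EuclideanSpace ℝ (Fin n)) ∞ M]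
    {E : Type*} [TopologicalSpace E]
    [ChartedSpace (EuclideanSpace ℝ (Fin n) × EuclideanSpace ℝ (Fin m)) E]
    [IsManifold 𝓘(ℝ, EuclideanSpace ℝ (Fin n) × EuclideanSpace ℝ (Fin m)) ∞ E]
    {F : Type*} [TopologicalSpace F] [ChartedSpace (EuclideanSpace ℝ (Fin m)) F]
    [IsManifold 𝓘(ℝ, EuclideanSpace ℝ (Fin m)) ∞ F]
    (π : E → M) (hπ : HJ.IsSmoothFiberBundle n m F π)
    (ℒ : HJ.Lagrangian n m π k) (hℒ : ℒ.IsAdmissible)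
    (D : HJ.HolonomicConnection n m π k) (hD : D.IsFlat)
    (T : HJ.MultimomentumSection n m π k) :
    List.TFAE
      [ℒ.SolvesHJ D T,
       Set.range (HJ.pair D T) ⊆ ℒ.constraint ∧
         ∀ (U : Set M) (j : M → HJ.Jet n m π k), D.IsConstant U j →
           ℒ.SolvesHDW U (fun x => T.map (j x)),
       Set.range (HJ.pair D T) ⊆ ℒ.constraint ∧ ℒ.ReducedEquation D T,
       Set.range (HJ.pair D T) ⊆ ℒ.constraint ∧ ℒ.PairEquation D T] ∧
    ((ℒ.SolvesHJ D T ∨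
       (Set.range (HJ.pair D T) ⊆ ℒ.constraint ∧
         ∀ (U : Set M) (j : M → HJ.Jet n m π k), D.IsConstant U j →
           ℒ.SolvesHDW U (fun x => T.map (j x))) ∨
       (Set.range (HJ.pair D T) ⊆ ℒ.constraint ∧ ℒ.ReducedEquation D T) ∨
       (Set.range (HJ.pair D T) ⊆ ℒ.constraint ∧ ℒ.PairEquation D T)) →
      D.IsElementaryHJSubdiffiety ℒ.diffiety) := by
  have hELH : ℒ.SolvesHJ D T ↔ ℒ.HJCoord D T := HJ.Lagrangian.solvesHJ_iff_hjCoord hD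
  have hHDW := hℒ.hjCoord_iff_solvesHDW (T := T) hD
  have hPair : ℒ.HJCoord D T ↔ Set.range (HJ.pair D T) ⊆ ℒ.constraint ∧ ℒ.PairEquation D T :=
    HJ.Lagrangian.hjCoord_iff_pairEquation
  have hReduced : ℒ.HJCoord D T ↔ Set.range (HJ.pair D T) ⊆ ℒ.constraint ∧ ℒ.ReducedEquation D T :=
    hPair.trans (and_congr_right fun hcon => (hℒ.reducedEquation_iff hcon).symm)
  refine ⟨?_, fun h => ⟨hD, ?_⟩⟩
  · rw [hELH, ← hHDW, ← hReduced, ← hPair]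
    tfae_finish
  · rw [hELH, ← hHDW, ← hReduced, ← hPair] at h
    simp only [or_self] at h
    exact h.diffiety_subset hD
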